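/- **Theorem (critical points of $\mathcal F$).** Let $M$ be a smooth $n$-dimensional manifold (Hausdorff, second countable, without boundary), let $X:M\to\mathbb R^{n+1}$ be a smooth immersion with a smooth unit normal field $N$, and let $d\mu$ be the area measure of the induced metric. Let $H=\sum_{i,j} g^{ij}h_{ij}$, with $h_{ij}=\langle\partial_i\partial_jX,N\rangle$, be the mean curvature with respect to $N$ (so $H=-n/r$ for the sphere of radius $r$ with outer normal). Fix $\lambda\in\mathbb R$, $X_0\in\mathbb R^{n+1}$ and $t_0>0$. For a variation $X(s)$ of $X$ with area measures $d\mu_s$, a variation $X_s\in\mathbb R^{n+1}$ of $X_0$ and a variation $t_s>0$ of $t_0$, put $$\mathcal F_{X_s,t_s}(s)=(4\pi t_s)^{-\frac n2}\int_M e^{-\frac{|X(s)-X_s|^2}{2t_s}}\,d\mu_s+\lambda(4\pi t_0)^{-\frac n2}\Bigl(\frac{t_0}{t_s}\Bigr)^{\frac12}\int_M\langle X(s)-X_s,N\rangle e^{-\frac{|X-X_0|^2}{2t_0}}\,d\mu .$$ Call $X$ a *critical point of* $\mathcal F_{X_s,t_s}$ if, for every smooth compactly supported variation $X(s)$ of $X$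 with $X(0)=X$ whose variation field $\frac{\partial X(s)}{\partial s}\big|_{s=0}=fN$ is normal, and all smooth variations $X_s$ of $X_0$ and $t_s>0$ of $t_0$, both integrals converge for all sufficiently small $s$ and $\frac{d}{ds}\big|_{s=0}\mathcal F_{X_s,t_s}(s)$ exists and equals $0$. (1) If $X$ is a critical point of $\mathcal F_{X_s,t_s}$, then $$H+\Bigl\langle\frac{X-X_0}{t_0},N\Bigr\rangle=\lambda\quad\text{on }M.$$ (2) Suppose that the metric induced by $X$ is complete and that $X$ has polynomial area growth, i.e. there are constants $C,d$ with $\mu(X^{-1}(B_r(0)))\le C r^d$ for all $r\ge1$. Then $X$ is a critical point of $\mathcal F_{X_s,t_s}$ if and only if $H+\langle\frac{X-X_0}{t_0},N\rangle=\lambda$ on $M$. -/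

import Mathlib

open scoped Manifold ContDiff Topology RealInnerProductSpace ENNReal

namespace LambdaHypersurface

noncomputable section

/-- The Euclidean space `ℝ^m`. -/
abbrev Euc (m : ℕ) : Type := EuclideanSpace ℝ (Fin m)

/-- The Gram matrix `⟪A e_i, A e_j⟫` of the images of the standard basis vectors under a linear
map `A : ℝ^n → ℝ^(n+1)`. For `A = d(X ∘ φ⁻¹)` this is the matrix `(g_ij)` of the metric induced
by `X` in the chart `φ`. -/
def gramOf {n : ℕ} (A : Euc n →L[ℝ] Euc (n + 1)) : Matrix (Fin n) (Fin n) ℝ :=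
  Matrix.gram ℝ fun i => A (EuclideanSpace.single i 1)

section Manifold

variable {n : ℕ} {M : Type*} [TopologicalSpace M] [ChartedSpace (Euc n) M]

/-- The differential of `X : M → ℝ^(n+1)` at `p`. As always in Mathlib, `T_p M` is identified with
the model space `ℝ^n` through the preferred chart at `p`. -/
def diff (X : M → Euc (n + 1)) (p : M) : Euc n →L[ℝ] Euc (n + 1) :=
  mfderiv (𝓡 n) 𝓘(ℝ, Euc (n + 1)) X p

/-- `X : M → ℝ^(n+1)` is a smooth immersion. -/
structure IsSmoothImmersion (X : M → Euc (n + 1)) : Prop where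
  smooth : ContMDiff (𝓡 n) 𝓘(ℝ, Euc (n + 1)) ∞ X
  injective : ∀ p, Function.Injective (diff X p)

/-- `N` is a smooth unit normal vector field along `X : M → ℝ^(n+1)`. -/
structure IsUnitNormal (X N : M → Euc (n + 1)) : Prop where
  smooth : ContMDiff (𝓡 n) 𝓘(ℝ, Euc (n + 1)) ∞ N
  unit : ∀ p, ‖N p‖ = 1
  orthogonal : ∀ p v, ⟪diff X p v, N p⟫ = 0

/-- The matrix `h_ij = -⟪∂_i X, ∂_j N⟫ = ⟪∂_i ∂_j X, N⟫` of the second fundamental form at `p`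
with respect to the unit normal `N`. -/
def secondFundamentalForm (X N : M → Euc (n + 1)) (p : M) : Matrix (Fin n) (Fin n) ℝ :=
  Matrix.of fun i j =>
    -⟪diff X p (EuclideanSpace.single i 1), diff N p (EuclideanSpace.single j 1)⟫

/-- The mean curvature `H = ∑ g^{ij} h_ij` with respect to `N`, so that the mean curvature
vector is `H N`. For the sphere of radius `r` with outer normal, `H = -n / r`. -/
def meanCurvature (X N : M → Euc (n + 1)) (p : M) : ℝ :=
  ((gramOf (diff X p))⁻¹ * secondFundamentalForm X N p).trace

/-- The part of the area measure of `X` that lives on the domain of the preferred chart `φ` at `p`: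
the measure `√(det g_ij) du` on the target of `φ`, transported to `M` by `φ⁻¹`. -/
def chartArea [MeasurableSpace M] (X : M → Euc (n + 1)) (p : M) : MeasureTheory.Measure M :=
  ((MeasureTheory.volume.restrict (chartAt (Euc n) p).target).withDensity fun u =>
    ENNReal.ofReal (Real.sqrt
      (gramOf (fderiv ℝ (X ∘ (chartAt (Euc n) p).symm) u)).det)).map (chartAt (Euc n) p).symm

/-- The area measure `dμ` on `M` of the metric induced by `X`. It is obtained by gluing: the
measures `chartArea X p` agree on overlaps of chart domains, and (on a second countable manifold)
the least measure above all of them is the measure whose restriction to the domain of every chart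
is the chart measure `√(det g_ij) du`. -/
def area [MeasurableSpace M] (X : M → Euc (n + 1)) : MeasureTheory.Measure M :=
  ⨆ p : M, chartArea X p

/-- The distance function of the metric induced by `X`: the infimum of the lengths of `C^1` paths,
where a tangent vector `v` has length `‖dX v‖`. It is `∞` between different components. -/
def inducedEDist (X : M → Euc (n + 1)) (p q : M) : ℝ≥0∞ :=
  letI : ∀ x : M, ENorm (TangentSpace (𝓡 n) x) := fun x => ⟨fun v => ‖diff X x v‖ₑ⟩
  Manifold.riemannianEDist (𝓡 n) p q

/-- The metric induced by `X` is complete: every Cauchy sequence for the induced distance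
converges in `M`. -/
def IsCompleteHypersurface (X : M → Euc (n + 1)) : Prop :=
  ∀ u : ℕ → M,
    (∀ ε : ℝ≥0∞, 0 < ε → ∃ k, ∀ i ≥ k, ∀ j ≥ k, inducedEDist X (u i) (u j) < ε) →
      ∃ p, Filter.Tendsto u Filter.atTop (𝓝 p)

/-- Polynomial area growth: the area of the part of the hypersurface inside the ball `B_r(0)`
(counted on `M`, that is, with multiplicity) is at most `C r^d` for all `r ≥ 1`. -/
def HasPolynomialAreaGrowth [MeasurableSpace M] (X : M → Euc (n + 1)) : Prop :=
  ∃ C d : ℝ, ∀ r : ℝ, 1 ≤ r → area X (X ⁻¹' Metric.ball 0 r) ≤ ENNReal.ofReal (C * r ^ d)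

/-- The first integrand of the `ℱ`-functional, to be integrated against the area of `Y`. -/
def areaIntegrand (Y : M → Euc (n + 1)) (x : Euc (n + 1)) (t : ℝ) (p : M) : ℝ :=
  Real.exp (-‖Y p - x‖ ^ 2 / (2 * t))

/-- The second integrand of the `ℱ`-functional, to be integrated against the area of `X`. -/
def volumeIntegrand (X N : M → Euc (n + 1)) (X₀ : Euc (n + 1)) (t₀ : ℝ)
    (Y : M → Euc (n + 1)) (x : Euc (n + 1)) (p : M) : ℝ :=
  ⟪Y p - x, N p⟫ * Real.exp (-‖X p - X₀‖ ^ 2 / (2 * t₀))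

/-- The value of the `ℱ`-functional at the hypersurface `Y`, the point `x` and the number `t`:
`(4πt)^{-n/2} ∫ e^{-|Y-x|²/2t} dμ_Y + λ (4πt₀)^{-n/2} (t₀/t)^{1/2} ∫ ⟪Y-x, N⟫ e^{-|X-X₀|²/2t₀} dμ_X`,
where the reference data `X`, `N`, `X₀`, `t₀` are fixed. -/
def functionalF [MeasurableSpace M] (lam : ℝ) (X N : M → Euc (n + 1)) (X₀ : Euc (n + 1)) (t₀ : ℝ)
    (Y : M → Euc (n + 1)) (x : Euc (n + 1)) (t : ℝ) : ℝ :=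
  (4 * Real.pi * t) ^ (-(n : ℝ) / 2) * ∫ p, areaIntegrand Y x t p ∂(area Y)
    + lam * (4 * Real.pi * t₀) ^ (-(n : ℝ) / 2) * (t₀ / t) ^ (1 / 2 : ℝ)
      * ∫ p, volumeIntegrand X N X₀ t₀ Y x p ∂(area X)

/-- Both integrals in the definition of the `ℱ`-functional converge. -/
def FunctionalFDefined [MeasurableSpace M] (X N : M → Euc (n + 1)) (X₀ : Euc (n + 1)) (t₀ : ℝ)
    (Y : M → Euc (n + 1)) (x : Euc (n + 1)) (t : ℝ) : Prop :=
  MeasureTheory.Integrable (areaIntegrand Y x t) (area Y) ∧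
    MeasureTheory.Integrable (volumeIntegrand X N X₀ t₀ Y x) (area X)

/-- `Y s`, `|s| < ε`, is a smooth compactly supported variation of `X` whose variation vector field
at `s = 0` is normal, that is, of the form `f N` for a function `f`. (Then `f` is smooth with
compact support, and if `X` is an immersion, then so is `Y s` for all small `s`.) -/
structure IsNormalVariation (X N : M → Euc (n + 1)) (ε : ℝ) (Y : ℝ → M → Euc (n + 1)) : Prop where
  smooth : ContMDiffOn (𝓘(ℝ, ℝ).prod (𝓡 n)) 𝓘(ℝ, Euc (n + 1)) ∞
    (fun z : ℝ × M => Y z.1 z.2) (Set.Ioo (-ε) ε ×ˢ Set.univ)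
  initial : ∀ p, Y 0 p = X p
  compact_support : ∃ K : Set M, IsCompact K ∧ ∀ s ∈ Set.Ioo (-ε) ε, ∀ p, p ∉ K → Y s p = X p
  normal : ∃ f : M → ℝ, ∀ p, HasDerivAt (fun s => Y s p) (f p • N p) 0

/-- `X` is a critical point of the `ℱ`-functional `ℱ_{X_s,t_s}`: along all compactly supported normal
variations `X(s)` of `X` and all smooth variations `X_s` of `X₀` and `t_s > 0` of `t₀`, carried out
simultaneously, the functional is well defined for all small `s`, and its derivative at `s = 0`
exists and vanishes. -/
def IsCriticalPoint [MeasurableSpace M] (lam : ℝ) (X N : M → Euc (n + 1)) (X₀ : Euc (n + 1))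
    (t₀ : ℝ) : Prop :=
  ∀ (ε : ℝ) (Y : ℝ → M → Euc (n + 1)) (x : ℝ → Euc (n + 1)) (t : ℝ → ℝ), 0 < ε →
    IsNormalVariation X N ε Y →
    ContDiffOn ℝ ∞ x (Set.Ioo (-ε) ε) → x 0 = X₀ →
    ContDiffOn ℝ ∞ t (Set.Ioo (-ε) ε) → t 0 = t₀ → (∀ s ∈ Set.Ioo (-ε) ε, 0 < t s) →
      (∀ᶠ s in 𝓝 0, FunctionalFDefined X N X₀ t₀ (Y s) (x s) (t s)) ∧
        HasDerivAt (fun s => functionalF lam X N X₀ t₀ (Y s) (x s) (t s)) 0 0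

end Manifold

end

end LambdaHypersurface

open LambdaHypersurface

/-! For a variation with field fN and velocities x', t' of centre and scale, put E = exp(-|X -
X₀|²/2t₀), Z = X - X₀ and β = t'/(2t₀). Up to the factor (4πt₀)^(-n/2), the derivative of the
functional at s = 0 is a normal part ∫ f (λ - H - ⟨Z/t₀, N⟩) E dμ plus a part depending only on x'
and t'. The normal part rests on the first variation of area: the area element changes at the rate
-fH (`IsNormalVariation.hasDerivAt_areaRatio`). Since the variation is compactly supported, the
integrals for X(s) differ from those for X by integrals over a compact set, so the two parts can be
differentiated separately (`IsNormalVariation.hasDerivAt_functionalF`).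

For necessity, keep centre and scale fixed. Then only the normal part remains, f is an arbitrary
test function, and E > 0, so the fundamental lemma of the calculus of variations gives the equation
(`IsCriticalPoint.equation`). Neither completeness nor area growth enters.

For sufficiency, the equation kills the normal part. What remains is minus the integral of the
divergence of the tangential part of V = E (x' + β Z) (`divAlong_exp_smul_affine`), so it has to be
shown that this integral is zero. Polynomial area growth makes V and its divergence integrable and
allows differentiation under the integral. Completeness gives, through a Hopf–Rinow argument,
compactly supported cutoffs whose Lipschitz constants for the induced distance tend to 0.
Integrating by parts against them bounds the cut-off integral by that constant times ∫ |V|, and the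
limit is zero (`integral_divAlong_eq_zero`). The cutoffs are only Lipschitz, so the integration by
parts takes place in charts, for functions differentiable almost everywhere. -/

namespace LambdaHypersurface

/-! ### Gram determinants, tangential projection and Jacobi's formula. -/

section LinearAlgebra

variable {n : ℕ}

theorem gramOf_apply (A : Euc n →L[ℝ] Euc (n + 1)) (i j : Fin n) :
    gramOf A i j = ⟪A (EuclideanSpace.single i 1), A (EuclideanSpace.single j 1)⟫ := rfl

/-- The matrix of an endomorphism of `ℝ^n` in the standard basis. -/
noncomputable def stdMatrix (T : Euc n →L[ℝ] Euc n) : Matrix (Fin n) (Fin n) ℝ :=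
  Matrix.of fun i j => T (EuclideanSpace.single j 1) i

theorem stdMatrix_eq_toMatrix (T : Euc n →L[ℝ] Euc n) :
    stdMatrix T = LinearMap.toMatrix (EuclideanSpace.basisFun (Fin n) ℝ).toBasis
      (EuclideanSpace.basisFun (Fin n) ℝ).toBasis T.toLinearMap := by
  ext i j
  simp [stdMatrix, LinearMap.toMatrix_apply]

theorem det_stdMatrix (T : Euc n →L[ℝ] Euc n) : (stdMatrix T).det = T.det := by
  rw [stdMatrix_eq_toMatrix, LinearMap.det_toMatrix]

/-- The trace of an endomorphism of `ℝ^n`. -/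
noncomputable def endTrace (T : Euc n →L[ℝ] Euc n) : ℝ :=
  LinearMap.trace ℝ (Euc n) T.toLinearMap

theorem trace_stdMatrix (T : Euc n →L[ℝ] Euc n) : (stdMatrix T).trace = endTrace T := by
  rw [stdMatrix_eq_toMatrix, endTrace, LinearMap.trace_eq_matrix_trace ℝ
    (EuclideanSpace.basisFun (Fin n) ℝ).toBasis]

theorem endTrace_add (S T : Euc n →L[ℝ] Euc n) :
    endTrace (S + T) = endTrace S + endTrace T := by
  simp [endTrace]

theorem endTrace_smul (c : ℝ) (T : Euc n →L[ℝ] Euc n) :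
    endTrace (c • T) = c * endTrace T := by
  simp [endTrace]

theorem endTrace_id : endTrace (ContinuousLinearMap.id ℝ (Euc n)) = n := by
  simp [endTrace]

theorem endTrace_comm (S T : Euc n →L[ℝ] Euc n) :
    endTrace (S.comp T) = endTrace (T.comp S) := by
  exact LinearMap.trace_mul_comm ℝ S.toLinearMap T.toLinearMap

theorem endTrace_smulRight (f : Euc n →L[ℝ] ℝ) (v : Euc n) :
    endTrace (f.smulRight v) = f v := by
  have h := LinearMap.trace_smulRight (R := ℝ) (M := Euc n) f.toLinearMap v
  exact h

theorem endTrace_eq_sum (T : Euc n →L[ℝ] Euc n) :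
    endTrace T = ∑ i, T (EuclideanSpace.single i 1) i := by
  rw [← trace_stdMatrix]; rfl

theorem sum_single (v : Euc n) : v = ∑ i, v i • EuclideanSpace.single i (1 : ℝ) := by
  ext j
  simp [Pi.single_apply]

theorem apply_eq_sum_stdMatrix {F : Type*} [AddCommGroup F] [Module ℝ F] [TopologicalSpace F]
    (A : Euc n →L[ℝ] F) (T : Euc n →L[ℝ] Euc n) (j : Fin n) :
    A (T (EuclideanSpace.single j 1)) = ∑ k, stdMatrix T k j • A (EuclideanSpace.single k 1) := by
  conv_lhs => rw [sum_single (T (EuclideanSpace.single j 1))]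
  simp [stdMatrix]

theorem gramOf_comp (A : Euc n →L[ℝ] Euc (n + 1)) (T : Euc n →L[ℝ] Euc n) :
    gramOf (A.comp T) = (stdMatrix T).transpose * gramOf A * stdMatrix T := by
  ext i j
  simp only [gramOf_apply, ContinuousLinearMap.comp_apply, apply_eq_sum_stdMatrix A T, sum_inner,
    inner_sum, Matrix.mul_apply, Matrix.transpose_apply, real_inner_smul_left,
    real_inner_smul_right, Finset.sum_mul]
  exact Finset.sum_congr rfl fun k _ => Finset.sum_congr rfl fun l _ => by ring

theorem det_gramOf_comp (A : Euc n →L[ℝ] Euc (n + 1)) (T : Euc n →L[ℝ] Euc n) :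
    (gramOf (A.comp T)).det = T.det ^ 2 * (gramOf A).det := by
  rw [gramOf_comp, Matrix.det_mul, Matrix.det_mul, Matrix.det_transpose, det_stdMatrix]
  ring

theorem det_gramOf_pos {A : Euc n →L[ℝ] Euc (n + 1)} (hA : Function.Injective A) :
    0 < (gramOf A).det := by
  refine (Matrix.posDef_gram_of_linearIndependent ?_).det_pos
  have h := (EuclideanSpace.basisFun (Fin n) ℝ).toBasis.linearIndependent
  have := h.map' A.toLinearMap (LinearMap.ker_eq_bot.2 hA)
  have e : (A.toLinearMap ∘ (EuclideanSpace.basisFun (Fin n) ℝ).toBasis) =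
      fun i => A (EuclideanSpace.single i 1) := by
    ext i
    simp
  rwa [e] at this

/-- The map `(v, c) ↦ A v + c ν`. -/
noncomputable def frame (A : Euc n →L[ℝ] Euc (n + 1)) (ν : Euc (n + 1)) :
    (Euc n × ℝ) →L[ℝ] Euc (n + 1) :=
  A.coprod ((ContinuousLinearMap.id ℝ ℝ).smulRight ν)

@[simp] theorem frame_apply (A : Euc n →L[ℝ] Euc (n + 1)) (ν : Euc (n + 1)) (z : Euc n × ℝ) :
    frame A ν z = A z.1 + z.2 • ν := by
  simp [frame]

/-- `A` is injective with image the orthogonal complement of the unit vector `ν`. -/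
structure IsFrame (A : Euc n →L[ℝ] Euc (n + 1)) (ν : Euc (n + 1)) : Prop where
  injective : Function.Injective A
  unit : ‖ν‖ = 1
  orthogonal : ∀ v, ⟪A v, ν⟫ = 0

/-- The left inverse of `A` that vanishes on `ν`. -/
noncomputable def leftInv (A : Euc n →L[ℝ] Euc (n + 1)) (ν : Euc (n + 1)) :
    Euc (n + 1) →L[ℝ] Euc n :=
  (ContinuousLinearMap.fst ℝ (Euc n) ℝ).comp (frame A ν).inverse

theorem IsFrame.inner_self {A : Euc n →L[ℝ] Euc (n + 1)} {ν : Euc (n + 1)} (h : IsFrame A ν) :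
    ⟪ν, ν⟫ = 1 := by
  rw [real_inner_self_eq_norm_sq, h.unit]; norm_num

/-- Pairing a kernel element with ν isolates its scalar component, and injectivity of A then
disposes of the vector component. Both sides have dimension n + 1. -/
theorem IsFrame.isInvertible {A : Euc n →L[ℝ] Euc (n + 1)} {ν : Euc (n + 1)} (h : IsFrame A ν) :
    (frame A ν).IsInvertible := by
  have hinj : Function.Injective (frame A ν) := by
    rw [injective_iff_map_eq_zero]
    rintro ⟨v, c⟩ hz
    simp only [frame_apply] at hz
    have h1 : c = 0 := by
      have := congrArg (fun y => ⟪y, ν⟫) hz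
      simpa only [inner_add_left, h.orthogonal, real_inner_smul_left, h.inner_self, zero_add,
        mul_one, inner_zero_left] using this
    subst h1
    have h2 : v = 0 := h.injective (by simpa using hz)
    simp [h2]
  have hsurj : Function.Surjective (frame A ν) := by
    have := LinearMap.injective_iff_surjective_of_finrank_eq_finrank
      (f := (frame A ν).toLinearMap) (by simp)
    exact this.1 hinj
  exact ⟨ContinuousLinearEquiv.ofBijective (frame A ν) (LinearMap.ker_eq_bot.2 hinj)
    (LinearMap.range_eq_top.2 hsurj), by ext <;> simp⟩

theorem IsFrame.leftInv_frame {A : Euc n →L[ℝ] Euc (n + 1)} {ν : Euc (n + 1)} (h : IsFrame A ν)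
    (v : Euc n) (c : ℝ) : leftInv A ν (A v + c • ν) = v := by
  have := h.isInvertible.inverse_apply_eq (x := (v, c)) (y := A v + c • ν)
  rw [leftInv, ContinuousLinearMap.comp_apply, this.2 (by simp)]
  rfl

theorem IsFrame.leftInv_apply {A : Euc n →L[ℝ] Euc (n + 1)} {ν : Euc (n + 1)} (h : IsFrame A ν)
    (v : Euc n) : leftInv A ν (A v) = v := by
  simpa using h.leftInv_frame v 0

theorem IsFrame.leftInv_normal {A : Euc n →L[ℝ] Euc (n + 1)} {ν : Euc (n + 1)} (h : IsFrame A ν) :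
    leftInv A ν ν = 0 := by
  simpa using h.leftInv_frame 0 1

/-- `A ∘ leftInv A ν` is thus the orthogonal projection onto the tangent space, and `endTrace
(leftInv A ν ∘ B)` is the tangential trace of B, with no inverse Gram matrix in sight. -/
theorem IsFrame.decomp {A : Euc n →L[ℝ] Euc (n + 1)} {ν : Euc (n + 1)} (h : IsFrame A ν)
    (y : Euc (n + 1)) : y = A (leftInv A ν y) + ⟪y, ν⟫ • ν := by
  obtain ⟨e, he⟩ := h.isInvertible
  obtain ⟨⟨v, c⟩, rfl⟩ := e.surjective y
  have : e (v, c) = A v + c • ν := by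
    rw [← frame_apply A ν (v, c), ← he]; rfl
  rw [this, h.leftInv_frame]
  rw [inner_add_left, h.orthogonal, real_inner_smul_left, h.inner_self, zero_add, mul_one]

theorem IsFrame.norm_leftInv_le {A : Euc n →L[ℝ] Euc (n + 1)} {ν : Euc (n + 1)} (h : IsFrame A ν)
    (y : Euc (n + 1)) : ‖A (leftInv A ν y)‖ ≤ ‖y‖ := by
  have h1 := h.decomp y
  have h2 : ‖y‖ ^ 2 = ‖A (leftInv A ν y)‖ ^ 2 + ⟪y, ν⟫ ^ 2 := by
    conv_lhs => rw [h1]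
    rw [norm_add_sq_real, real_inner_smul_right, h.orthogonal, norm_smul, h.unit]
    simp
  exact le_of_sq_le_sq (by nlinarith [sq_nonneg ⟪y, ν⟫]) (norm_nonneg _)

theorem IsFrame.comp {A : Euc n →L[ℝ] Euc (n + 1)} {ν : Euc (n + 1)} (h : IsFrame A ν)
    (T : Euc n ≃L[ℝ] Euc n) : IsFrame (A.comp (T : Euc n →L[ℝ] Euc n)) ν :=
  ⟨h.injective.comp T.injective, h.unit, fun _ => h.orthogonal _⟩

theorem IsFrame.leftInv_comp {A : Euc n →L[ℝ] Euc (n + 1)} {ν : Euc (n + 1)} (h : IsFrame A ν)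
    (T : Euc n ≃L[ℝ] Euc n) :
    leftInv (A.comp (T : Euc n →L[ℝ] Euc n)) ν = (T.symm : Euc n →L[ℝ] Euc n).comp (leftInv A ν) := by
  ext1 y
  have h1 := h.decomp y
  conv_lhs => rw [h1]
  have h2 : A (leftInv A ν y) = (A.comp (T : Euc n →L[ℝ] Euc n)) (T.symm (leftInv A ν y)) := by simp
  rw [h2, (h.comp T).leftInv_frame]
  rfl

/-- A reparametrization T conjugates the endomorphism by T. This makes tangential traces independent
of the chart. -/
theorem IsFrame.endTrace_leftInv_comp {A : Euc n →L[ℝ] Euc (n + 1)} {ν : Euc (n + 1)}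
    (h : IsFrame A ν) (T : Euc n ≃L[ℝ] Euc n) (B : Euc n →L[ℝ] Euc (n + 1)) :
    endTrace ((leftInv (A.comp (T : Euc n →L[ℝ] Euc n)) ν).comp
      (B.comp (T : Euc n →L[ℝ] Euc n))) = endTrace ((leftInv A ν).comp B) := by
  rw [h.leftInv_comp, ContinuousLinearMap.comp_assoc, endTrace_comm]
  congr 1
  ext1 v
  simp

theorem IsFrame.contDiffAt_leftInv {E : Type*} [NormedAddCommGroup E] [NormedSpace ℝ E]
    {k : WithTop ℕ∞} {A : E → Euc n →L[ℝ] Euc (n + 1)} {ν : E → Euc (n + 1)} {u : E}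
    (h : IsFrame (A u) (ν u)) (hA : ContDiffAt ℝ k A u) (hν : ContDiffAt ℝ k ν u) :
    ContDiffAt ℝ k (fun z => leftInv (A z) (ν z)) u := by
  have h1 : ContDiffAt ℝ k (fun z => frame (A z) (ν z)) u := by
    have e : (fun z => frame (A z) (ν z)) = fun z => (A z).comp (ContinuousLinearMap.fst ℝ _ _) +
        (ContinuousLinearMap.snd ℝ (Euc n) ℝ).smulRight (ν z) := by
      ext z <;> simp
    rw [e]
    exact (hA.clm_comp contDiffAt_const).add (contDiffAt_const.smulRight hν)
  have h2 := (h.isInvertible.contDiffAt_map_inverse (n := k)).comp u h1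
  exact contDiffAt_const.clm_comp h2

/-- Jacobi's formula for the determinant along a differentiable curve of matrices. -/
theorem hasDerivAt_det {m : Type*} [Fintype m] [DecidableEq m] {M : ℝ → Matrix m m ℝ}
    {M' L : Matrix m m ℝ} {s : ℝ} (hM : ∀ i j, HasDerivAt (fun r => M r i j) (M' i j) s)
    (hL : M' = M s * L) :
    HasDerivAt (fun r => (M r).det) ((M s).det * L.trace) s := by
  -- By the Leibniz formula the derivative of the determinant depends only on the value and the
  -- derivative of the curve at s, so M may be replaced by its affine approximation there.
  have key : ∀ P : ℝ → Matrix m m ℝ, (∀ i j, HasDerivAt (fun r => P r i j) (M' i j) s) →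
      P s = M s → HasDerivAt (fun r => (P r).det) (∑ σ : Equiv.Perm m,
        (Equiv.Perm.sign σ : ℝ) * ∑ i, (∏ j ∈ Finset.univ.erase i, M s (σ j) j) * M' (σ i) i) s := by
    intro P hP hPs
    simp only [Matrix.det_apply']
    refine HasDerivAt.fun_sum fun σ _ => ?_
    refine HasDerivAt.const_mul _ ?_
    have := HasDerivAt.fun_finsetProd (u := Finset.univ) (f := fun i r => P r (σ i) i)
      (f' := fun i => M' (σ i) i) (x := s) fun i _ => hP (σ i) i
    simpa [hPs] using this
  have h1 := key M hM rfl
  have h2 := key (fun r => M s + (r - s) • M') (fun i j => by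
    have := ((hasDerivAt_id s).sub_const s).mul_const (M' i j)
    simpa using this.const_add (M s i j)) (by simp)
  -- Along the affine curve the determinant is det M(s) · det(1 + (r - s) L), a polynomial in r - s
  -- with linear coefficient tr L.
  have h3 : HasDerivAt (fun r => (M s + (r - s) • M').det) ((M s).det * L.trace) s := by
    have e : ∀ r, (M s + (r - s) • M').det = (M s).det * (1 + L.trace * (r - s) + Polynomial.eval (r - s)
        (1 + (Polynomial.X : Polynomial ℝ) • L.map Polynomial.C).det.divX.divX * (r - s) ^ 2) := by
      intro r
      rw [← Matrix.det_one_add_smul, ← Matrix.det_mul, hL, mul_add, mul_one, Matrix.mul_smul]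
    simp only [e]
    have hid := (hasDerivAt_id s).sub_const s
    have hp := ((Polynomial.hasDerivAt (1 + (Polynomial.X : Polynomial ℝ) •
      L.map Polynomial.C).det.divX.divX (id s - s)).comp (h := fun x => id x - s) s hid).mul (hid.pow 2)
    have := (((hid.const_mul L.trace).const_add 1).add hp).const_mul (M s).det
    exact HasDerivAt.congr_deriv (f := fun r => _) this (by simp)
  rw [h3.unique h2]
  exact h1

theorem IsFrame.inner_eq {A : Euc n →L[ℝ] Euc (n + 1)} {ν : Euc (n + 1)} (h : IsFrame A ν)
    (B : Euc n →L[ℝ] Euc (n + 1)) (i j : Fin n) :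
    ⟪A (EuclideanSpace.single i 1), B (EuclideanSpace.single j 1)⟫ =
      (gramOf A * stdMatrix ((leftInv A ν).comp B)) i j := by
  conv_lhs => rw [h.decomp (B (EuclideanSpace.single j 1)), inner_add_right,
    real_inner_smul_right, h.orthogonal, mul_zero, add_zero,
    ← ContinuousLinearMap.comp_apply (leftInv A ν) B, apply_eq_sum_stdMatrix]
  simp [inner_sum, real_inner_smul_right, Matrix.mul_apply, gramOf_apply, mul_comm]

theorem IsFrame.hasDerivAt_det_gramOf {A : ℝ → Euc n →L[ℝ] Euc (n + 1)}
    {A' : Euc n →L[ℝ] Euc (n + 1)} {ν : Euc (n + 1)} {s : ℝ} (h : IsFrame (A s) ν)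
    (hA : HasDerivAt A A' s) :
    HasDerivAt (fun r => (gramOf (A r)).det)
      (2 * (gramOf (A s)).det * endTrace ((leftInv (A s) ν).comp A')) s := by
  set G := gramOf (A s) with hG
  set L := stdMatrix ((leftInv (A s) ν).comp A') with hL
  have hdet : IsUnit G.det := (det_gramOf_pos h.injective).ne'.isUnit
  have hsymm : G.transpose = G := by
    ext i j; simp [hG, gramOf_apply, real_inner_comm]
  have hC : ∀ i j, ⟪A s (EuclideanSpace.single i 1), A' (EuclideanSpace.single j 1)⟫ =
      (G * L) i j := fun i j => h.inner_eq A' i j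
  -- Differentiating the Gram matrix gives GL + (GL)ᵀ. Symmetry of G turns the second term into
  -- G(G⁻¹LᵀG), and both summands of the resulting logarithmic derivative have trace tr L, whence
  -- the factor 2.
  have := hasDerivAt_det (M := fun r => gramOf (A r)) (M' := G * L + (G * L).transpose)
    (L := L + G⁻¹ * (L.transpose * G)) (s := s) (fun i j => by
      have h1 := (hA.clm_apply (hasDerivAt_const s (EuclideanSpace.single i (1 : ℝ)))).inner ℝ
        (hA.clm_apply (hasDerivAt_const s (EuclideanSpace.single j (1 : ℝ))))
      simp only [map_zero, add_zero] at h1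
      rw [Matrix.add_apply, Matrix.transpose_apply, ← hC, ← hC, real_inner_comm (A' (EuclideanSpace.single i 1))]
      exact h1)
    (by
      rw [mul_add, ← mul_assoc G⁻¹ _ _, ← mul_assoc G, ← mul_assoc G, Matrix.mul_nonsing_inv _ hdet,
        one_mul, Matrix.transpose_mul, hsymm])
  convert this using 1
  have : (G⁻¹ * (L.transpose * G)).trace = L.trace := by
    rw [Matrix.trace_mul_comm, mul_assoc, Matrix.mul_nonsing_inv _ hdet, mul_one,
      Matrix.trace_transpose]
  rw [Matrix.trace_add, this, ← trace_stdMatrix, ← hL]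
  ring

theorem IsFrame.hasDerivAt_sqrt_det_gramOf {A : ℝ → Euc n →L[ℝ] Euc (n + 1)}
    {A' : Euc n →L[ℝ] Euc (n + 1)} {ν : Euc (n + 1)} {s : ℝ} (h : IsFrame (A s) ν)
    (hA : HasDerivAt A A' s) :
    HasDerivAt (fun r => Real.sqrt (gramOf (A r)).det)
      (Real.sqrt (gramOf (A s)).det * endTrace ((leftInv (A s) ν).comp A')) s := by
  have hpos := det_gramOf_pos h.injective
  refine ((h.hasDerivAt_det_gramOf hA).sqrt hpos.ne').congr_deriv ?_
  have hs : Real.sqrt (gramOf (A s)).det ≠ 0 := (Real.sqrt_pos.2 hpos).ne'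
  have hss : Real.sqrt (gramOf (A s)).det * Real.sqrt (gramOf (A s)).det = (gramOf (A s)).det :=
    Real.mul_self_sqrt hpos.le
  rw [div_eq_iff (by positivity)]
  linear_combination (-2 * endTrace ((leftInv (A s) ν).comp A')) * hss

/-- With B = dN this gives H = -tr(dN), the trace being tangential; all later computations use that
form. -/
theorem IsFrame.trace_inv_gramOf_mul {A : Euc n →L[ℝ] Euc (n + 1)} {ν : Euc (n + 1)}
    (h : IsFrame A ν) (B : Euc n →L[ℝ] Euc (n + 1)) :
    ((gramOf A)⁻¹ * Matrix.of fun i j =>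
      -⟪A (EuclideanSpace.single i 1), B (EuclideanSpace.single j 1)⟫).trace =
      -endTrace ((leftInv A ν).comp B) := by
  have e : (Matrix.of fun i j =>
      -⟪A (EuclideanSpace.single i 1), B (EuclideanSpace.single j 1)⟫) =
      -(gramOf A * stdMatrix ((leftInv A ν).comp B)) := by
    ext i j
    simp only [Matrix.of_apply, Matrix.neg_apply, h.inner_eq B i j]
  rw [e, Matrix.mul_neg, Matrix.trace_neg, Matrix.nonsing_inv_mul_cancel_left _ _
    (det_gramOf_pos h.injective).ne'.isUnit, trace_stdMatrix]

theorem contDiff_det_gramOf {k : WithTop ℕ∞} :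
    ContDiff ℝ k fun A : Euc n →L[ℝ] Euc (n + 1) => (gramOf A).det := by
  simp only [Matrix.det_apply', gramOf_apply]
  refine ContDiff.sum fun σ _ => contDiff_const.mul (contDiff_prod fun i _ => ?_)
  exact (contDiff_id.clm_apply contDiff_const).inner ℝ (contDiff_id.clm_apply contDiff_const)

end LinearAlgebra

/-! ### The area measure in charts. -/

section Charts

open MeasureTheory Set

variable {n : ℕ} {M : Type*} [TopologicalSpace M] [ChartedSpace (Euc n) M]

/-- `diff` at a point refers to the preferred chart of that very point, so it differs from the
derivative in a fixed chart by the derivative T of a transition map. The same T serves all maps X,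
and therefore cancels in area ratios and tangential traces. -/
theorem exists_chart_equiv [IsManifold (𝓡 n) ∞ M] (p : M) {u : Euc n}
    (hu : u ∈ (chartAt (Euc n) p).target) :
    ∃ T : Euc n ≃L[ℝ] Euc n, ∀ X : M → Euc (n + 1),
      MDifferentiableAt (𝓡 n) 𝓘(ℝ, Euc (n + 1)) X ((chartAt (Euc n) p).symm u) →
        HasFDerivAt (X ∘ (chartAt (Euc n) p).symm)
          ((diff X ((chartAt (Euc n) p).symm u)).comp (T : Euc n →L[ℝ] Euc n)) u := by
  have hc := (mdifferentiable_chart (I := 𝓡 n) p).symm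
  refine ⟨hc.mfderiv hu, fun X hX => ?_⟩
  have h1 : MDifferentiableAt (𝓡 n) (𝓡 n) (chartAt (Euc n) p).symm u := hc.mdifferentiableAt hu
  have h2 := hX.hasMFDerivAt.comp u h1.hasMFDerivAt
  exact h2.hasFDerivAt

theorem fderiv_chart_of_equiv {p : M} {u : Euc n} {T : Euc n ≃L[ℝ] Euc n}
    (hT : ∀ X : M → Euc (n + 1),
      MDifferentiableAt (𝓡 n) 𝓘(ℝ, Euc (n + 1)) X ((chartAt (Euc n) p).symm u) →
        HasFDerivAt (X ∘ (chartAt (Euc n) p).symm)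
          ((diff X ((chartAt (Euc n) p).symm u)).comp (T : Euc n →L[ℝ] Euc n)) u)
    {X : M → Euc (n + 1)} (hX : MDifferentiable (𝓡 n) 𝓘(ℝ, Euc (n + 1)) X) :
    fderiv ℝ (X ∘ (chartAt (Euc n) p).symm) u =
      (diff X ((chartAt (Euc n) p).symm u)).comp (T : Euc n →L[ℝ] Euc n) :=
  (hT X (hX _)).fderiv

theorem contDiffOn_comp_chart_symm [IsManifold (𝓡 n) ∞ M] {F : Type*} [NormedAddCommGroup F]
    [NormedSpace ℝ F] {V : M → F} (hV : ContMDiff (𝓡 n) 𝓘(ℝ, F) ∞ V) (p : M) :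
    ContDiffOn ℝ ∞ (V ∘ (chartAt (Euc n) p).symm) (chartAt (Euc n) p).target :=
  (hV.comp_contMDiffOn contMDiffOn_chart_symm).contDiffOn

theorem contDiffAt_fderiv_comp_chart_symm [IsManifold (𝓡 n) ∞ M] {F : Type*} [NormedAddCommGroup F]
    [NormedSpace ℝ F] {V : M → F} (hV : ContMDiff (𝓡 n) 𝓘(ℝ, F) ∞ V) (p : M) {u : Euc n}
    (hu : u ∈ (chartAt (Euc n) p).target) :
    ContDiffAt ℝ ∞ (fderiv ℝ (V ∘ (chartAt (Euc n) p).symm)) u :=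
  (((contDiffOn_comp_chart_symm hV p).contDiffAt
    ((chartAt (Euc n) p).open_target.mem_nhds hu)).fderiv_right (by simp))

/-- The density `√(det g_ij)` of the area measure in the preferred chart at `p`. -/
noncomputable def chartDensity (X : M → Euc (n + 1)) (p : M) (u : Euc n) : ℝ :=
  Real.sqrt (gramOf (fderiv ℝ (X ∘ (chartAt (Euc n) p).symm) u)).det

theorem chartDensity_nonneg (X : M → Euc (n + 1)) (p : M) (u : Euc n) :
    0 ≤ chartDensity X p u := Real.sqrt_nonneg _

theorem measurable_chartDensity (X : M → Euc (n + 1)) (p : M) :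
    Measurable (chartDensity X p) :=
  ((contDiff_det_gramOf (k := 0)).continuous.measurable.comp (measurable_fderiv ℝ _)).sqrt

theorem IsSmoothImmersion.fderiv_chart_injective [IsManifold (𝓡 n) ∞ M] {X : M → Euc (n + 1)}
    (hX : IsSmoothImmersion X) (p : M) {u : Euc n} (hu : u ∈ (chartAt (Euc n) p).target) :
    Function.Injective (fderiv ℝ (X ∘ (chartAt (Euc n) p).symm) u) := by
  obtain ⟨T, hT⟩ := exists_chart_equiv p hu
  rw [fderiv_chart_of_equiv hT (hX.smooth.mdifferentiable (by simp))]
  exact (hX.injective _).comp T.injective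

theorem IsSmoothImmersion.chartDensity_pos [IsManifold (𝓡 n) ∞ M] {X : M → Euc (n + 1)}
    (hX : IsSmoothImmersion X) (p : M) {u : Euc n} (hu : u ∈ (chartAt (Euc n) p).target) :
    0 < chartDensity X p u :=
  Real.sqrt_pos.2 (det_gramOf_pos (hX.fderiv_chart_injective p hu))

theorem continuousOn_chartDensity [IsManifold (𝓡 n) ∞ M] {X : M → Euc (n + 1)}
    (hX : ContMDiff (𝓡 n) 𝓘(ℝ, Euc (n + 1)) ∞ X) (p : M) :
    ContinuousOn (chartDensity X p) (chartAt (Euc n) p).target := fun _ hu =>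
  ((contDiff_det_gramOf (k := 0)).continuous.continuousAt.comp
    (contDiffAt_fderiv_comp_chart_symm hX p hu).continuousAt).sqrt.continuousWithinAt

/-- The ratio of the area elements of `Y` and `X`. -/
noncomputable def areaRatio (X Y : M → Euc (n + 1)) (p : M) : ℝ :=
  Real.sqrt (gramOf (diff Y p)).det / Real.sqrt (gramOf (diff X p)).det

theorem areaRatio_nonneg (X Y : M → Euc (n + 1)) (p : M) : 0 ≤ areaRatio X Y p := by
  unfold areaRatio; positivity

/-- Both Gram determinants pick up the same factor (det T)², which cancels. -/
theorem areaRatio_chart_symm [IsManifold (𝓡 n) ∞ M] {X Y : M → Euc (n + 1)}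
    (hX : ContMDiff (𝓡 n) 𝓘(ℝ, Euc (n + 1)) ∞ X) (hY : ContMDiff (𝓡 n) 𝓘(ℝ, Euc (n + 1)) ∞ Y)
    (p : M) {u : Euc n} (hu : u ∈ (chartAt (Euc n) p).target) :
    areaRatio X Y ((chartAt (Euc n) p).symm u) = chartDensity Y p u / chartDensity X p u := by
  obtain ⟨T, hT⟩ := exists_chart_equiv p hu
  rw [chartDensity, chartDensity, fderiv_chart_of_equiv hT (hX.mdifferentiable (by simp)),
    fderiv_chart_of_equiv hT (hY.mdifferentiable (by simp)), det_gramOf_comp, det_gramOf_comp,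
    Real.sqrt_mul (sq_nonneg _), Real.sqrt_mul (sq_nonneg _), mul_div_mul_left, areaRatio]
  rw [Real.sqrt_sq_eq_abs]
  have : IsUnit (T : Euc n →L[ℝ] Euc n).det := by
    exact LinearEquiv.isUnit_det' T.toLinearEquiv
  exact abs_ne_zero.2 this.ne_zero

/-- `diff` itself may jump from point to point with the preferred chart, so continuity is read off
in one fixed chart, where the ratio is a quotient of continuous densities. -/
theorem IsSmoothImmersion.continuous_areaRatio [IsManifold (𝓡 n) ∞ M] {X Y : M → Euc (n + 1)}
    (hX : IsSmoothImmersion X) (hY : ContMDiff (𝓡 n) 𝓘(ℝ, Euc (n + 1)) ∞ Y) :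
    Continuous (areaRatio X Y) := by
  refine continuous_iff_continuousAt.2 fun p => ?_
  set e := chartAt (Euc n) p with he
  have hp := mem_chart_source (Euc n) p
  have h1 : ContinuousAt (fun u => chartDensity Y p u / chartDensity X p u) (e p) :=
    ((continuousOn_chartDensity hY p).continuousAt (e.open_target.mem_nhds (e.map_source hp))).div
      ((continuousOn_chartDensity hX.smooth p).continuousAt
        (e.open_target.mem_nhds (e.map_source hp)))
      (hX.chartDensity_pos p (e.map_source hp)).ne'
  refine (h1.comp (e.continuousAt hp)).congr ?_
  filter_upwards [chart_source_mem_nhds (Euc n) p] with q hq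
  have := areaRatio_chart_symm hX.smooth hY p (e.map_source hq)
  rw [← he, e.left_inv hq] at this
  exact this.symm

theorem chartArea_eq [MeasurableSpace M] (X : M → Euc (n + 1)) (p : M) :
    chartArea X p = ((volume.restrict (chartAt (Euc n) p).target).withDensity
      fun u => ENNReal.ofReal (chartDensity X p u)).map (chartAt (Euc n) p).symm := rfl

variable [MeasurableSpace M] [BorelSpace M]

theorem aemeasurable_chart_symm (p : M) :
    AEMeasurable (chartAt (Euc n) p).symm (volume.restrict (chartAt (Euc n) p).target) :=
  (chartAt (Euc n) p).continuousOn_symm.aemeasurable (chartAt (Euc n) p).open_target.measurableSet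

theorem aemeasurable_chart_symm_withDensity (X : M → Euc (n + 1)) (p : M) :
    AEMeasurable (chartAt (Euc n) p).symm ((volume.restrict (chartAt (Euc n) p).target).withDensity
      fun u => ENNReal.ofReal (chartDensity X p u)) :=
  (aemeasurable_chart_symm p).mono_ac (withDensity_absolutelyContinuous _ _)

theorem chartArea_apply (X : M → Euc (n + 1)) (p : M) {S : Set M} (hS : MeasurableSet S) :
    chartArea X p S = ∫⁻ u in (chartAt (Euc n) p).target ∩ (chartAt (Euc n) p).symm ⁻¹' S,
      ENNReal.ofReal (chartDensity X p u) := by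
  rw [chartArea_eq, Measure.map_apply_of_aemeasurable (aemeasurable_chart_symm_withDensity X p) hS,
    withDensity_apply', Measure.restrict_restrict' (chartAt (Euc n) p).open_target.measurableSet,
    inter_comm]

theorem measurableSet_chart_preimage (p : M) {S : Set M} (hS : MeasurableSet S) :
    MeasurableSet ((chartAt (Euc n) p).target ∩ (chartAt (Euc n) p).symm ⁻¹' S) := by
  classical
  have h := (chartAt (Euc n) p).continuousOn_symm.measurable_piecewise
    (continuousOn_const (c := p)) (chartAt (Euc n) p).open_target.measurableSet (g := fun _ => p)
  have e : (chartAt (Euc n) p).target ∩ (chartAt (Euc n) p).symm ⁻¹' S =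
      (chartAt (Euc n) p).target ∩ ((chartAt (Euc n) p).target.piecewise
        (chartAt (Euc n) p).symm (fun _ => p)) ⁻¹' S := by
    ext u
    simp only [mem_inter_iff, mem_preimage]
    refine and_congr_right fun hu => ?_
    rw [piecewise_eq_of_mem _ _ _ hu]
  rw [e]
  exact (chartAt (Euc n) p).open_target.measurableSet.inter (h hS)

theorem chartArea_inter_source (X : M → Euc (n + 1)) (p : M) {S : Set M} (hS : MeasurableSet S) :
    chartArea X p (S ∩ (chartAt (Euc n) p).source) = chartArea X p S := by
  rw [chartArea_apply X p hS, chartArea_apply X p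
    (hS.inter (chartAt (Euc n) p).open_source.measurableSet)]
  congr 2
  ext u
  simp only [mem_inter_iff, mem_preimage]
  exact ⟨fun h => ⟨h.1, h.2.1⟩, fun h => ⟨h.1, h.2, (chartAt (Euc n) p).map_target h.1⟩⟩

/-- This is the change of variables formula for the transition map τ, whose Jacobian |det dτ| is the
quotient of the two densities. -/
theorem chartArea_eq_of_subset [IsManifold (𝓡 n) ∞ M] {X : M → Euc (n + 1)}
    (hX : ContMDiff (𝓡 n) 𝓘(ℝ, Euc (n + 1)) ∞ X) {p q : M} {S : Set M} (hS : MeasurableSet S)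
    (hp : S ⊆ (chartAt (Euc n) p).source) (hq : S ⊆ (chartAt (Euc n) q).source) :
    chartArea X p S = chartArea X q S := by
  set e := chartAt (Euc n) p with he
  set f := chartAt (Euc n) q with hf
  set τ : Euc n → Euc n := f ∘ e.symm with hτ
  set B := e.target ∩ e.symm ⁻¹' S with hB
  have himage : τ '' B = f.target ∩ f.symm ⁻¹' S := by
    ext w
    constructor
    · rintro ⟨u, hu, rfl⟩
      refine ⟨f.map_source (hq hu.2), ?_⟩
      simpa [hτ, f.left_inv (hq hu.2)] using hu.2
    · rintro ⟨hw, hwS⟩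
      refine ⟨e (f.symm w), ⟨e.map_source (hp hwS), ?_⟩, ?_⟩
      · simpa [e.left_inv (hp hwS)] using hwS
      · simp [hτ, e.left_inv (hp hwS), f.right_inv hw]
  have hinj : InjOn τ B := by
    intro u hu v hv huv
    have h1 : e.symm u = e.symm v := f.injOn (hq hu.2) (hq hv.2) huv
    exact e.symm.injOn hu.1 hv.1 h1
  have hdiff : ∀ u ∈ B, DifferentiableAt ℝ τ u := by
    intro u hu
    have h1 : MDifferentiableAt (𝓡 n) (𝓡 n) e.symm u :=
      (mdifferentiable_chart (I := 𝓡 n) p).mdifferentiableAt_symm hu.1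
    have h2 : MDifferentiableAt (𝓡 n) (𝓡 n) f (e.symm u) :=
      (mdifferentiable_chart (I := 𝓡 n) q).mdifferentiableAt (hq hu.2)
    exact (h2.comp u h1).differentiableAt
  have hdens : ∀ u ∈ B, chartDensity X p u = |(fderiv ℝ τ u).det| * chartDensity X q (τ u) := by
    intro u hu
    have hτu : τ u ∈ f.target := f.map_source (hq hu.2)
    have h1 : fderiv ℝ (X ∘ e.symm) u = (fderiv ℝ (X ∘ f.symm) (τ u)).comp (fderiv ℝ τ u) := by
      have h2 : DifferentiableAt ℝ (X ∘ f.symm) (τ u) :=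
        ((contDiffOn_comp_chart_symm hX q).contDiffAt (f.open_target.mem_nhds hτu)).differentiableAt
          (by simp)
      rw [← fderiv_comp u h2 (hdiff u hu)]
      refine Filter.EventuallyEq.fderiv_eq ?_
      have h3 : e.symm ⁻¹' f.source ∈ 𝓝 u :=
        (e.continuousAt_symm hu.1).preimage_mem_nhds (f.open_source.mem_nhds (hq hu.2))
      filter_upwards [h3] with v hv
      simp [hτ, f.left_inv hv]
    rw [chartDensity, chartDensity, h1, det_gramOf_comp, Real.sqrt_mul (sq_nonneg _),
      Real.sqrt_sq_eq_abs]
  rw [chartArea_apply X p hS, chartArea_apply X q hS, ← himage,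
    lintegral_image_eq_lintegral_abs_det_fderiv_mul volume (measurableSet_chart_preimage p hS)
      (fun u hu => (hdiff u hu).hasFDerivAt.hasFDerivWithinAt) hinj]
  refine setLIntegral_congr_fun (measurableSet_chart_preimage p hS) fun u hu => ?_
  rw [← ENNReal.ofReal_mul (abs_nonneg _), ← hdens u hu]

theorem area_apply_of_subset_source [IsManifold (𝓡 n) ∞ M] {X : M → Euc (n + 1)}
    (hX : ContMDiff (𝓡 n) 𝓘(ℝ, Euc (n + 1)) ∞ X) {p : M} {S : Set M} (hS : MeasurableSet S)
    (hp : S ⊆ (chartAt (Euc n) p).source) : area X S = chartArea X p S := by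
  refine le_antisymm ?_ ((le_iSup (fun q => chartArea X q) p) S)
  have hsrc := (chartAt (Euc n) p).open_source.measurableSet
  -- A supremum of measures cannot be evaluated set by set, so it is bounded by one measure that
  -- dominates every `chartArea X q`. On the domain of the chart at p the overlap formula compares
  -- with `chartArea X p`; on the complement `area X` itself serves.
  have h : area X ≤ chartArea X p + (area X).restrict (chartAt (Euc n) p).sourceᶜ := by
    refine iSup_le fun q => Measure.le_iff.2 fun A hA => ?_
    rw [← measure_inter_add_sdiff A hsrc, Measure.add_apply]
    refine add_le_add ?_ ?_
    · rw [← chartArea_inter_source X q (hA.inter hsrc), chartArea_eq_of_subset hX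
        ((hA.inter hsrc).inter (chartAt (Euc n) q).open_source.measurableSet)
        inter_subset_right (inter_subset_left.trans inter_subset_right)]
      exact measure_mono (inter_subset_left.trans inter_subset_left)
    · rw [Measure.restrict_apply hA, sdiff_eq]
      exact (le_iSup (fun q => chartArea X q) q) _
  refine (h S).trans ?_
  rw [Measure.add_apply, Measure.restrict_apply hS, (disjoint_compl_right.mono_left hp).inter_eq,
    measure_empty, add_zero]

theorem area_restrict_source [IsManifold (𝓡 n) ∞ M] {X : M → Euc (n + 1)}
    (hX : ContMDiff (𝓡 n) 𝓘(ℝ, Euc (n + 1)) ∞ X) (p : M) :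
    (area X).restrict (chartAt (Euc n) p).source = chartArea X p := by
  ext S hS
  rw [Measure.restrict_apply hS, area_apply_of_subset_source hX
    (hS.inter (chartAt (Euc n) p).open_source.measurableSet) inter_subset_right,
    chartArea_inter_source X p hS]

theorem setIntegral_source_eq [IsManifold (𝓡 n) ∞ M] {X : M → Euc (n + 1)}
    (hX : ContMDiff (𝓡 n) 𝓘(ℝ, Euc (n + 1)) ∞ X) (p : M) {f : M → ℝ}
    (hf : AEStronglyMeasurable f (area X)) :
    ∫ q in (chartAt (Euc n) p).source, f q ∂(area X) =
      ∫ u in (chartAt (Euc n) p).target,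
        chartDensity X p u * f ((chartAt (Euc n) p).symm u) := by
  have hf' := hf.restrict (s := (chartAt (Euc n) p).source)
  rw [area_restrict_source hX p] at hf' ⊢
  rw [chartArea_eq] at hf' ⊢
  rw [integral_map (aemeasurable_chart_symm_withDensity X p) hf',
    integral_withDensity_eq_integral_toReal_smul₀
      (measurable_chartDensity X p).ennreal_ofReal.aemeasurable (by simp)]
  simp [ENNReal.toReal_ofReal, chartDensity_nonneg]

theorem isLocallyFiniteMeasure_area [IsManifold (𝓡 n) ∞ M] {X : M → Euc (n + 1)}
    (hX : ContMDiff (𝓡 n) 𝓘(ℝ, Euc (n + 1)) ∞ X) : IsLocallyFiniteMeasure (area X) := by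
  refine ⟨fun p => ?_⟩
  set e := chartAt (Euc n) p with he
  have hp : e p ∈ e.target := e.map_source (mem_chart_source _ p)
  have hc : ContinuousAt (chartDensity X p) (e p) :=
    (continuousOn_chartDensity hX p).continuousAt (e.open_target.mem_nhds hp)
  obtain ⟨r, hr, hball⟩ := Metric.mem_nhds_iff.1
    (hc.preimage_mem_nhds (Iio_mem_nhds (lt_add_one (chartDensity X p (e p)))))
  refine ⟨e.source ∩ e ⁻¹' Metric.ball (e p) r, ?_, ?_⟩
  · exact Filter.inter_mem (chart_source_mem_nhds _ p)
      ((e.continuousAt (mem_chart_source _ p)).preimage_mem_nhds (Metric.ball_mem_nhds _ hr))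
  have hm : MeasurableSet (e.source ∩ e ⁻¹' Metric.ball (e p) r) :=
    (e.isOpen_inter_preimage Metric.isOpen_ball).measurableSet
  rw [area_apply_of_subset_source hX hm inter_subset_left, chartArea_apply X p hm]
  calc _ ≤ ∫⁻ u in Metric.ball (e p) r, ENNReal.ofReal (chartDensity X p u) := by
        refine lintegral_mono_set ?_
        rintro u ⟨hu, -, hu'⟩
        rwa [mem_preimage, ← he, e.right_inv hu] at hu'
    _ ≤ ∫⁻ u in Metric.ball (e p) r, ENNReal.ofReal (chartDensity X p (e p) + 1) :=
        setLIntegral_mono measurable_const fun u hu => ENNReal.ofReal_le_ofReal (hball hu).le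
    _ < ⊤ := by
        rw [setLIntegral_const]
        exact ENNReal.mul_lt_top ENNReal.ofReal_lt_top measure_ball_lt_top

theorem IsSmoothImmersion.isOpenPosMeasure_area [IsManifold (𝓡 n) ∞ M] {X : M → Euc (n + 1)}
    (hX : IsSmoothImmersion X) : (area X).IsOpenPosMeasure := by
  refine ⟨fun U hU ⟨p, hp⟩ h0 => ?_⟩
  set e := chartAt (Euc n) p with he
  have hU' : IsOpen (U ∩ e.source) := hU.inter e.open_source
  have h1 : area X (U ∩ e.source) = 0 := measure_mono_null inter_subset_left h0
  rw [area_apply_of_subset_source hX.smooth hU'.measurableSet inter_subset_right,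
    chartArea_apply X p hU'.measurableSet] at h1
  have h2 : 0 < ∫⁻ u in e.target ∩ e.symm ⁻¹' (U ∩ e.source),
      ENNReal.ofReal (chartDensity X p u) := by
    rw [setLIntegral_pos_iff (measurable_chartDensity X p).ennreal_ofReal]
    have h3 : Function.support (fun u => ENNReal.ofReal (chartDensity X p u)) ∩
        (e.target ∩ e.symm ⁻¹' (U ∩ e.source)) = e.target ∩ e.symm ⁻¹' (U ∩ e.source) := by
      refine inter_eq_right.2 fun u hu => ?_
      simpa using hX.chartDensity_pos p hu.1
    rw [h3]
    refine (e.isOpen_inter_preimage_symm hU').measure_pos volume ⟨e p, ?_, ?_⟩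
    · exact e.map_source (mem_chart_source _ p)
    · rw [mem_preimage, e.left_inv (mem_chart_source _ p)]
      exact ⟨hp, mem_chart_source _ p⟩
  exact h2.ne' h1

/-- Integrals over the moving measure become integrals over the fixed one. The identity is checked
on countably many chart domains. Only the density of X is divided by, so Y need not be an immersion.
-/
theorem IsSmoothImmersion.area_eq_withDensity [IsManifold (𝓡 n) ∞ M] [SecondCountableTopology M]
    {X Y : M → Euc (n + 1)}
    (hX : IsSmoothImmersion X) (hY : ContMDiff (𝓡 n) 𝓘(ℝ, Euc (n + 1)) ∞ Y) :
    area Y = (area X).withDensity fun p => ENNReal.ofReal (areaRatio X Y p) := by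
  obtain ⟨s, hs, hcover⟩ := TopologicalSpace.countable_cover_nhds
    (fun p : M => chart_source_mem_nhds (Euc n) p)
  have := hs.to_subtype
  refine Measure.ext_of_iUnion_eq_univ (s := fun p : s => (chartAt (Euc n) (p : M)).source)
    (by simpa [iUnion_subtype] using hcover) fun ⟨p, _⟩ => ?_
  have hJ : Measurable fun p => ENNReal.ofReal (areaRatio X Y p) :=
    (hX.continuous_areaRatio hY).measurable.ennreal_ofReal
  rw [restrict_withDensity (chartAt (Euc n) p).open_source.measurableSet, area_restrict_source hY,
    area_restrict_source hX.smooth]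
  ext S hS
  rw [withDensity_apply _ hS, chartArea_eq X p, ← lintegral_indicator hS,
    lintegral_map' (hJ.indicator hS).aemeasurable (aemeasurable_chart_symm_withDensity X p),
    lintegral_withDensity_eq_lintegral_mul₀ (g := fun u => S.indicator _ _)
      (measurable_chartDensity X p).ennreal_ofReal.aemeasurable
      ((hJ.indicator hS).comp_aemeasurable (aemeasurable_chart_symm p)), chartArea_apply Y p hS,
    inter_comm, ← Measure.restrict_restrict' (chartAt (Euc n) p).open_target.measurableSet,
    ← lintegral_indicator₀]
  · refine setLIntegral_congr_fun (chartAt (Euc n) p).open_target.measurableSet fun u hu => ?_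
    by_cases huS : (chartAt (Euc n) p).symm u ∈ S
    · simp only [indicator, mem_preimage, huS, if_true, Pi.mul_apply]
      rw [areaRatio_chart_symm hX.smooth hY p hu, ← ENNReal.ofReal_mul (chartDensity_nonneg _ _ _),
        mul_div_cancel₀ _ (hX.chartDensity_pos p hu).ne']
    · simp [indicator, huS]
  · exact (aemeasurable_chart_symm p).nullMeasurableSet_preimage hS

end Charts

/-! ### Compactness of balls in length spaces, and cutoffs. -/

section HopfRinow

open Set Metric

variable {α : Type*} [PseudoEMetricSpace α]

/-- A form of the length space property: a point at distance less than `a + b` from `p` is within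
`b` of a point at distance at most `a` from `p`. -/
def HasIntermediatePoints (α : Type*) [PseudoEMetricSpace α] : Prop :=
  ∀ (p q : α) (a b : ℝ≥0∞), 0 < b → edist p q < a + b → ∃ m, edist p m ≤ a ∧ edist m q < b

/-- Every point of the R-ball is within ε/2 of the ball of radius R - ε/4, because R < (R - ε/4) +
ε/2. A finite ε/2-net of that compact ball is therefore an ε-net of the R-ball. -/
theorem closedEBall_totallyBounded_of_forall_lt (h : HasIntermediatePoints α) (p : α) {R : NNReal}
    (hR : ∀ r < R, IsCompact (closedEBall p r)) : TotallyBounded (closedEBall p R) := by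
  refine EMetric.totallyBounded_iff.2 fun ε hε => ?_
  rcases lt_or_ge (R : ℝ≥0∞) ε with hRε | hRε
  · exact ⟨{p}, finite_singleton p, fun x hx => by
      simpa using (mem_closedEBall.1 hx).trans_lt hRε⟩
  · lift ε to NNReal using (hRε.trans_lt ENNReal.coe_lt_top).ne
    have hε' : 0 < ε := by simpa using hε
    have hεR : ε ≤ R := by simpa using hRε
    obtain ⟨t, ht, hsub⟩ := EMetric.totallyBounded_iff.1
      (hR (R - ε / 4) (tsub_lt_self (hε'.trans_le hεR) (by positivity))).totallyBounded
      ((ε / 2 : NNReal) : ℝ≥0∞) (by simpa using hε'.ne')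
    refine ⟨t, ht, fun x hx => ?_⟩
    have hx' : edist p x < ((R - ε / 4 : NNReal) : ℝ≥0∞) + ((ε / 2 : NNReal) : ℝ≥0∞) := by
      rw [edist_comm]
      refine (mem_closedEBall.1 hx).trans_lt ?_
      rw [← ENNReal.coe_add, ENNReal.coe_lt_coe]
      have h4 : ε / 4 ≤ R := (div_le_self (zero_le) (by norm_num)).trans hεR
      rw [← NNReal.coe_lt_coe, NNReal.coe_add, NNReal.coe_sub h4]
      push_cast
      have : (0 : ℝ) < ε := hε'
      linarith
    obtain ⟨m, hm1, hm2⟩ := h p x _ _ (by simpa using hε'.ne') hx'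
    have hm : m ∈ closedEBall p ((R - ε / 4 : NNReal) : ℝ≥0∞) := by
      rwa [mem_closedEBall, edist_comm]
    obtain ⟨y, hy, hmy⟩ := mem_iUnion₂.1 (hsub hm)
    refine mem_iUnion₂.2 ⟨y, hy, ?_⟩
    rw [mem_eball] at hmy ⊢
    calc edist x y ≤ edist x m + edist m y := edist_triangle _ _ _
      _ < ((ε / 2 : NNReal) : ℝ≥0∞) + ((ε / 2 : NNReal) : ℝ≥0∞) := by
        rw [edist_comm x m]; exact ENNReal.add_lt_add hm2 hmy
      _ = ε := by rw [← ENNReal.coe_add, add_halves]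

/-- Closed balls are compact in a complete, locally compact length space. -/
theorem isCompact_closedEBall_of_hasIntermediatePoints [CompleteSpace α] [LocallyCompactSpace α]
    (h : HasIntermediatePoints α) (p : α) (r : NNReal) : IsCompact (closedEBall p r) := by
  by_contra hr
  -- Let R be the infimum of the radii of noncompact balls. The R-ball is still compact, being
  -- complete and totally bounded, hence has a compact neighbourhood that contains its δ-thickening.
  -- By the length property this thickening contains the ball of radius R + δ/2, which contradicts
  -- the choice of R.
  set S : Set NNReal := {s | ¬ IsCompact (closedEBall p (s : ℝ≥0∞))} with hS
  set R := sInf S with hRdef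
  have hlt : ∀ s < R, IsCompact (closedEBall p (s : ℝ≥0∞)) := fun s hs => by
    by_contra hs'
    exact (csInf_le (OrderBot.bddBelow S) hs').not_gt hs
  have hRc : IsCompact (closedEBall p (R : ℝ≥0∞)) :=
    isCompact_iff_totallyBounded_isComplete.2
      ⟨closedEBall_totallyBounded_of_forall_lt h p hlt, isClosed_closedEBall.isComplete⟩
  obtain ⟨K', hK', hsub⟩ := exists_compact_superset hRc
  obtain ⟨δ, hδ, hthick⟩ := hRc.exists_cthickening_subset_open isOpen_interior hsub
  have hbig : IsCompact (closedEBall p ((R + (δ / 2).toNNReal : NNReal) : ℝ≥0∞)) := by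
    refine hK'.of_isClosed_subset isClosed_closedEBall fun x hx => interior_subset (hthick ?_)
    have hx' : edist p x < (R : ℝ≥0∞) + ENNReal.ofReal δ := by
      rw [edist_comm]
      refine (mem_closedEBall.1 hx).trans_lt ?_
      rw [ENNReal.coe_add]
      refine ENNReal.add_lt_add_left ENNReal.coe_ne_top ?_
      exact (ENNReal.ofReal_lt_ofReal_iff hδ).2 (by linarith)
    obtain ⟨m, hm1, hm2⟩ := h p x _ _ (ENNReal.ofReal_pos.2 hδ) hx'
    rw [mem_cthickening_iff]
    refine (infEDist_le_edist_of_mem (y := m) ?_).trans ?_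
    · rwa [mem_closedEBall, edist_comm]
    · rw [edist_comm]; exact hm2.le
  have hle : R + (δ / 2).toNNReal ≤ R := le_csInf ⟨r, hr⟩ fun s hs => by
    by_contra hs'
    refine hs (hbig.of_isClosed_subset isClosed_closedEBall ?_)
    exact closedEBall_subset_closedEBall (ENNReal.coe_le_coe.2 (not_le.1 hs').le)
  have : 0 < (δ / 2).toNNReal := by simpa using hδ
  exact (lt_add_of_pos_right R this).not_ge hle

/-- Compactly supported Lipschitz cutoff functions with Lipschitz constants tending to zero. -/
theorem exists_cutoff_of_isCompact_closedEBall [TopologicalSpace.SeparableSpace α]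
    [R1Space α]
    (h : ∀ (p : α) (r : NNReal), IsCompact (closedEBall p r)) :
    ∃ φ : ℕ → α → ℝ, (∀ j q, 0 ≤ φ j q ∧ φ j q ≤ 1) ∧ (∀ j, HasCompactSupport (φ j)) ∧
      (∀ (j : ℕ) q q', edist (φ j q) (φ j q') ≤ ENNReal.ofReal ((j + 1 : ℝ)⁻¹) * edist q q') ∧
      ∀ q, ∀ᶠ j in Filter.atTop, φ j q = 1 := by
  cases isEmpty_or_nonempty α with
  | inl he =>
    exact ⟨fun _ q => (he.false q).elim, fun _ q => (he.false q).elim,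
      fun _ => HasCompactSupport.of_compactSpace _, fun _ q => (he.false q).elim,
      fun q => (he.false q).elim⟩
  | inr hne =>
  -- Distances may be infinite between components, of which there may be infinitely many, so the
  -- distance D is measured from a growing finite set of dense points rather than from one base
  -- point. The cutoff is min(1, (R - D)/(j + 1)), with truncated subtraction. For R = 2(j + 1) it
  -- equals 1 wherever D ≤ 1, since 2j + 1 ≥ j + 1.
  set F : ℕ → Set α := fun j => (TopologicalSpace.denseSeq α) '' (Iic j) with hF
  set D : ℕ → α → ℝ≥0∞ := fun j q => infEDist q (F j) with hD
  set R : ℕ → NNReal := fun j => 2 * (j + 1) with hR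
  set g : ℕ → α → ℝ := fun j q => ((R j : ℝ≥0∞) - D j q).toReal with hg
  have hfin : ∀ j q, (R j : ℝ≥0∞) - D j q ≠ ⊤ := fun j q => ENNReal.sub_ne_top ENNReal.coe_ne_top
  have hgle : ∀ j q q', edist q q' ≠ ⊤ → g j q ≤ g j q' + (edist q q').toReal := by
    intro j q q' hd
    simp only [hg]
    rw [← ENNReal.toReal_add (hfin j q') hd]
    refine ENNReal.toReal_mono (ENNReal.add_ne_top.2 ⟨hfin j q', hd⟩) ?_
    rw [tsub_le_iff_right, add_assoc]
    refine tsub_le_iff_right.1 (tsub_le_tsub_left ?_ _)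
    rw [add_comm, edist_comm]
    exact infEDist_le_infEDist_add_edist
  refine ⟨fun j q => min 1 (g j q / (j + 1)), fun j q => ⟨?_, min_le_left _ _⟩, fun j => ?_,
    fun j q q' => ?_, fun q => ?_⟩
  · exact le_min zero_le_one (div_nonneg ENNReal.toReal_nonneg (by positivity))
  · refine HasCompactSupport.intro (K := ⋃ x ∈ F j, closedEBall x ((R j + 1 : NNReal) : ℝ≥0∞))
      (((finite_Iic j).image _).isCompact_biUnion fun x _ => h x _) fun q hq => ?_
    have h1 : (R j : ℝ≥0∞) ≤ D j q := by
      by_contra hlt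
      obtain ⟨y, hy, hqy⟩ := infEDist_lt_iff.1 (not_le.1 hlt)
      refine hq (mem_iUnion₂.2 ⟨y, hy, mem_closedEBall.2 (hqy.le.trans ?_)⟩)
      exact ENNReal.coe_le_coe.2 (by simp)
    simp [hg, tsub_eq_zero_of_le h1]
  -- At infinite distance the Lipschitz bound is vacuous, the constant being positive.
  · by_cases hd : edist q q' = ⊤
    · rw [hd, ENNReal.mul_top]
      · exact le_top
      · simpa using (by positivity : (0 : ℝ) < j + 1)
    rw [← ENNReal.ofReal_toReal hd, ← ENNReal.ofReal_mul (by positivity), edist_dist, Real.dist_eq]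
    refine ENNReal.ofReal_le_ofReal ?_
    refine (abs_min_sub_min_le_max _ _ _ _).trans (max_le ?_ ?_)
    · simp only [sub_self, abs_zero]; positivity
    rw [← sub_div, abs_div, abs_of_pos (by positivity : (0 : ℝ) < j + 1), div_eq_inv_mul]
    refine mul_le_mul_of_nonneg_left ?_ (by positivity)
    rw [abs_sub_le_iff]
    constructor
    · linarith [hgle j q q' hd]
    · have := hgle j q' q (by rwa [edist_comm])
      rw [edist_comm] at this
      linarith
  · obtain ⟨i, hi⟩ := (TopologicalSpace.denseRange_denseSeq α).exists_mem_open
      (isOpen_eball (x := q) (ε := 1)) ⟨q, mem_eball_self one_pos⟩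
    filter_upwards [Filter.eventually_ge_atTop i] with j hj
    have h1 : D j q ≤ 1 := (infEDist_le_edist_of_mem (mem_image_of_mem _ (mem_Iic.2 hj))).trans
      (by rw [edist_comm]; exact (mem_eball.1 hi).le)
    have h2 : (j + 1 : ℝ) ≤ g j q := by
      have h3 : ((j + 1 : NNReal) : ℝ≥0∞) ≤ (R j : ℝ≥0∞) - D j q := by
        refine le_trans ?_ (tsub_le_tsub_left h1 _)
        rw [← ENNReal.coe_one, ← ENNReal.coe_sub, ENNReal.coe_le_coe]
        refine le_tsub_of_add_le_right ?_
        simp only [hR, two_mul]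
        gcongr
        simp
      have := ENNReal.toReal_mono (hfin j q) h3
      rwa [ENNReal.coe_toReal, NNReal.coe_add, NNReal.coe_natCast, NNReal.coe_one] at this
    exact min_eq_left ((one_le_div (by positivity)).2 h2)

end HopfRinow

/-! ### The distance function of the induced metric. -/

section InducedDistance

open Manifold Set

variable {n : ℕ} {M : Type*} [TopologicalSpace M] [ChartedSpace (Euc n) M]

/-- The length of tangent vectors for the metric induced by `X`. -/
@[reducible] noncomputable def inducedENorm (X : M → Euc (n + 1)) (x : M) :
    ENorm (TangentSpace (𝓡 n) x) := ⟨fun v => ‖diff X x v‖ₑ⟩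

theorem inducedENormSMulClass (X : M → Euc (n + 1)) (x : M) :
    letI := inducedENorm X x
    ENormSMulClass ℝ (TangentSpace (𝓡 n) x) := by
  let := inducedENorm X x
  refine ⟨fun c v => ?_⟩
  change ‖diff X x (c • v)‖ₑ = ‖c‖ₑ * ‖diff X x v‖ₑ
  erw [map_smul, enorm_smul]

theorem inducedEDist_self (X : M → Euc (n + 1)) (p : M) : inducedEDist X p p = 0 := by
  let := inducedENorm X
  have := inducedENormSMulClass X
  exact riemannianEDist_self

theorem inducedEDist_comm (X : M → Euc (n + 1)) (p q : M) :
    inducedEDist X p q = inducedEDist X q p := by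
  let := inducedENorm X
  have := inducedENormSMulClass X
  exact riemannianEDist_comm

theorem inducedEDist_triangle (X : M → Euc (n + 1)) (p q r : M) :
    inducedEDist X p r ≤ inducedEDist X p q + inducedEDist X q r := by
  let := inducedENorm X
  have := inducedENormSMulClass X
  exact riemannianEDist_triangle

/-- The length of a path for the metric induced by `X`. -/
noncomputable def inducedLength (X : M → Euc (n + 1)) (γ : ℝ → M) (a b : ℝ) : ℝ≥0∞ :=
  letI := inducedENorm X
  pathELength (𝓡 n) γ a b

theorem inducedLength_eq (X : M → Euc (n + 1)) (γ : ℝ → M) (a b : ℝ) :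
    inducedLength X γ a b = ∫⁻ t in Ioo a b,
      ‖(diff X (γ t)) (mfderiv 𝓘(ℝ, ℝ) (𝓡 n) γ t (1 : ℝ))‖ₑ := by
  let := inducedENorm X
  exact pathELength_eq_lintegral_mfderiv_Ioo

theorem inducedLength_add (X : M → Euc (n + 1)) (γ : ℝ → M) {a b c : ℝ} (hab : a ≤ b)
    (hbc : b ≤ c) : inducedLength X γ a b + inducedLength X γ b c = inducedLength X γ a c := by
  let := inducedENorm X
  exact pathELength_add hab hbc

theorem inducedEDist_le_inducedLength (X : M → Euc (n + 1)) {γ : ℝ → M} {a b : ℝ}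
    (hγ : ContMDiffOn 𝓘(ℝ, ℝ) (𝓡 n) 1 γ (Icc a b)) (hab : a ≤ b) :
    inducedEDist X (γ a) (γ b) ≤ inducedLength X γ a b := by
  let := inducedENorm X
  have := inducedENormSMulClass X
  exact riemannianEDist_le_pathELength hγ rfl rfl hab

theorem exists_inducedLength_lt (X : M → Euc (n + 1)) {p q : M} {r : ℝ≥0∞}
    (h : inducedEDist X p q < r) : ∃ γ : ℝ → M, γ 0 = p ∧ γ 1 = q ∧
      ContMDiffOn 𝓘(ℝ, ℝ) (𝓡 n) 1 γ (Icc 0 1) ∧ inducedLength X γ 0 1 < r := by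
  let := inducedENorm X
  have := inducedENormSMulClass X
  exact exists_lt_of_riemannianEDist_lt h

theorem hasDerivAt_comp_path {X : M → Euc (n + 1)} {γ : ℝ → M} {t : ℝ}
    (hX : MDifferentiableAt (𝓡 n) 𝓘(ℝ, Euc (n + 1)) X (γ t))
    (hγ : MDifferentiableAt 𝓘(ℝ, ℝ) (𝓡 n) γ t) :
    HasDerivAt (X ∘ γ) (diff X (γ t) (mfderiv 𝓘(ℝ, ℝ) (𝓡 n) γ t (1 : ℝ))) t := by
  have h : HasFDerivAt (X ∘ γ) ((diff X (γ t)).comp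
      (show ℝ →L[ℝ] Euc n from mfderiv 𝓘(ℝ, ℝ) (𝓡 n) γ t)) t :=
    (hX.hasMFDerivAt.comp t hγ.hasMFDerivAt).hasFDerivAt
  exact h.hasDerivAt

/-- The speed of γ in the induced metric is the Euclidean speed of X ∘ γ, and a chord is no longer
than its curve. -/
theorem edist_le_inducedLength {X : M → Euc (n + 1)}
    (hX : ContMDiff (𝓡 n) 𝓘(ℝ, Euc (n + 1)) ∞ X) {γ : ℝ → M} {a b : ℝ}
    (hγ : ContMDiffOn 𝓘(ℝ, ℝ) (𝓡 n) 1 γ (Icc a b)) (hab : a ≤ b) :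
    edist (X (γ a)) (X (γ b)) ≤ inducedLength X γ a b := by
  have hXγ : ContMDiffOn 𝓘(ℝ, ℝ) 𝓘(ℝ, Euc (n + 1)) 1 (X ∘ γ) (Icc a b) :=
    (hX.of_le (by norm_cast)).comp_contMDiffOn hγ
  have h1 := enorm_sub_le_lintegral_deriv_of_contDiffOn_Icc hXγ.contDiffOn hab
  rw [← edist_eq_enorm_sub, edist_comm, ← MeasureTheory.restrict_Ioo_eq_restrict_Icc] at h1
  refine h1.trans_eq ?_
  rw [inducedLength_eq]
  refine MeasureTheory.setLIntegral_congr_fun measurableSet_Ioo fun t ht => ?_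
  have hγt : MDifferentiableAt 𝓘(ℝ, ℝ) (𝓡 n) γ t :=
    (hγ.contMDiffAt (Icc_mem_nhds ht.1 ht.2)).mdifferentiableAt one_ne_zero
  have hXt : MDifferentiableAt (𝓡 n) 𝓘(ℝ, Euc (n + 1)) X (γ t) :=
    hX.mdifferentiable (by simp) _
  rw [(hasDerivAt_comp_path hXt hγt).deriv]

theorem inducedEDist_chart_symm_le [IsManifold (𝓡 n) ∞ M] {X : M → Euc (n + 1)}
    (hX : ContMDiff (𝓡 n) 𝓘(ℝ, Euc (n + 1)) ∞ X) (p : M) {u v : Euc n} {c : ℝ≥0∞}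
    (hseg : segment ℝ u v ⊆ (chartAt (Euc n) p).target)
    (h : ∀ z ∈ segment ℝ u v,
      ‖fderiv ℝ (X ∘ (chartAt (Euc n) p).symm) z (v - u)‖ₑ ≤ c) :
    inducedEDist X ((chartAt (Euc n) p).symm u) ((chartAt (Euc n) p).symm v) ≤ c := by
  set e := chartAt (Euc n) p with he
  set l : ℝ → Euc n := fun t => AffineMap.lineMap u v t with hl
  have hmem : ∀ t ∈ Icc (0 : ℝ) 1, l t ∈ segment ℝ u v := fun t ht => by
    rw [segment_eq_image_lineMap]; exact mem_image_of_mem _ ht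
  have hlc : ContMDiff 𝓘(ℝ, ℝ) (𝓡 n) 1 l := by
    refine ContDiff.contMDiff ?_
    exact (ContinuousAffineMap.lineMap (R := ℝ) u v).contDiff
  have hγ : ContMDiffOn 𝓘(ℝ, ℝ) (𝓡 n) 1 (e.symm ∘ l) (Icc 0 1) :=
    (contMDiffOn_chart_symm (n := 1)).comp hlc.contMDiffOn fun t ht => hseg (hmem t ht)
  have h1 := inducedEDist_le_inducedLength X hγ zero_le_one
  simp only [Function.comp, hl, AffineMap.lineMap_apply_zero, AffineMap.lineMap_apply_one] at h1
  refine h1.trans ?_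
  rw [inducedLength_eq]
  calc _ ≤ ∫⁻ t in Ioo (0 : ℝ) 1, c := by
        refine MeasureTheory.setLIntegral_mono measurable_const fun t ht => ?_
        have ht' := Ioo_subset_Icc_self ht
        have hγt : MDifferentiableAt 𝓘(ℝ, ℝ) (𝓡 n) (e.symm ∘ l) t :=
          (hγ.contMDiffAt (Icc_mem_nhds ht.1 ht.2)).mdifferentiableAt one_ne_zero
        have hXt : MDifferentiableAt (𝓡 n) 𝓘(ℝ, Euc (n + 1)) X ((e.symm ∘ l) t) :=
          hX.mdifferentiable (by simp) _
        have hF : DifferentiableAt ℝ (X ∘ e.symm) (l t) :=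
          ((contDiffOn_comp_chart_symm hX p).contDiffAt
            (e.open_target.mem_nhds (hseg (hmem t ht')))).differentiableAt (by simp)
        have hlt : HasDerivAt l (v - u) t := AffineMap.hasDerivAt_lineMap
        have h2 := hasDerivAt_comp_path hXt hγt
        have h3 := hF.hasFDerivAt.comp_hasDerivAt t hlt
        have h4 := h2.unique h3
        refine (le_of_eq ?_).trans (h _ (hmem t ht'))
        rw [← h4]
    _ = c := by simp

/-- The differential at p is injective, so X differs from X p on a small punctured chart ball; by
compactness X stays at distance at least some c > 0 from X p on the bounding sphere. A path from p
of length less than c cannot meet this sphere, hence by connectedness stays inside the ball.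
Together with `eventually_inducedEDist_lt` this shows that the induced distance gives the topology
of M. -/
theorem IsSmoothImmersion.exists_inducedEDist_lt_subset [IsManifold (𝓡 n) ∞ M] [T2Space M]
    {X : M → Euc (n + 1)} (hX : IsSmoothImmersion X) (p : M) {s : Set M} (hs : s ∈ 𝓝 p) :
    ∃ c : ℝ≥0∞, 0 < c ∧ {q | inducedEDist X p q < c} ⊆ s := by
  set e := chartAt (Euc n) p with he
  have hp : p ∈ e.source := mem_chart_source _ p
  have hep : e p ∈ e.target := e.map_source hp
  have hF : HasFDerivAt (X ∘ e.symm) (fderiv ℝ (X ∘ e.symm) (e p)) (e p) :=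
    (((contDiffOn_comp_chart_symm hX.smooth p).contDiffAt
      (e.open_target.mem_nhds hep)).differentiableAt (by simp)).hasFDerivAt
  have hanti : ∃ C, AntilipschitzWith C (fderiv ℝ (X ∘ e.symm) (e p)) := by
    obtain ⟨K, -, hK⟩ := (fderiv ℝ (X ∘ e.symm) (e p)).toLinearMap.exists_antilipschitzWith
      (LinearMap.ker_eq_bot.2 (hX.fderiv_chart_injective p hep))
    exact ⟨K, hK⟩
  have hne := hF.eventually_ne (c := X p) hanti
  rw [eventually_nhdsWithin_iff] at hne
  have hs' : e.symm ⁻¹' s ∈ 𝓝 (e p) := (e.continuousAt_symm hep).preimage_mem_nhds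
    (by rwa [e.left_inv hp])
  obtain ⟨r, hr, hball⟩ := Metric.nhds_basis_closedBall.mem_iff.1
    (Filter.inter_mem (Filter.inter_mem hne hs') (e.open_target.mem_nhds hep))
  have hcb : ContinuousOn e.symm (Metric.closedBall (e p) r) :=
    e.continuousOn_symm.mono fun u hu => (hball hu).2
  have hcpt : IsCompact (e.symm '' Metric.closedBall (e p) r) :=
    (isCompact_closedBall _ _).image_of_continuousOn hcb
  have hScpt : IsCompact (e.symm '' Metric.sphere (e p) r) :=
    (isCompact_sphere _ _).image_of_continuousOn (hcb.mono Metric.sphere_subset_closedBall)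
  obtain ⟨c, hc, hcS⟩ : ∃ c : ℝ≥0∞, 0 < c ∧ ∀ q ∈ e.symm '' Metric.sphere (e p) r,
      c ≤ edist (X p) (X q) := by
    rcases (e.symm '' Metric.sphere (e p) r).eq_empty_or_nonempty with h0 | h0
    · exact ⟨1, one_pos, by simp [h0]⟩
    · obtain ⟨q, hq, hmin⟩ := hScpt.exists_isMinOn h0
        (continuous_const.edist hX.smooth.continuous).continuousOn (f := fun q => edist (X p) (X q))
      refine ⟨edist (X p) (X q), ?_, hmin⟩
      obtain ⟨u, hu, rfl⟩ := hq
      have hu' := hball (Metric.sphere_subset_closedBall hu)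
      have hne' : u ≠ e p := by
        rintro rfl
        simp [hr.ne] at hu
      exact edist_pos.2 (Ne.symm (hu'.1.1 hne'))
  have hopen : IsOpen (e.source ∩ e ⁻¹' Metric.ball (e p) r) :=
    e.isOpen_inter_preimage Metric.isOpen_ball
  have hsub : e.source ∩ e ⁻¹' Metric.ball (e p) r ⊆ e.symm '' Metric.closedBall (e p) r :=
    fun q hq => ⟨e q, Metric.ball_subset_closedBall hq.2, e.left_inv hq.1⟩
  refine ⟨c, hc, fun q hq => ?_⟩
  obtain ⟨γ, hγ0, hγ1, hγ, hlen⟩ := exists_inducedLength_lt X hq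
  have himg : γ '' Icc 0 1 ⊆ (e.source ∩ e ⁻¹' Metric.ball (e p) r) ∪
      (e.symm '' Metric.closedBall (e p) r)ᶜ := by
    rintro _ ⟨t, ht, rfl⟩
    by_contra hcon
    rw [mem_union, not_or, notMem_compl_iff] at hcon
    obtain ⟨u, hu, hut⟩ := hcon.2
    have hus : u ∈ Metric.sphere (e p) r := by
      rw [Metric.mem_sphere]
      refine le_antisymm (Metric.mem_closedBall.1 hu) (not_lt.1 fun hlt => hcon.1 ?_)
      rw [← hut]
      refine ⟨e.map_target (hball hu).2, ?_⟩
      rw [mem_preimage, e.right_inv (hball hu).2]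
      exact hlt
    have h1 := hcS _ ⟨u, hus, hut⟩
    have h2 := edist_le_inducedLength hX.smooth (hγ.mono (Icc_subset_Icc_right ht.2)) ht.1
    rw [hγ0] at h2
    have h3 : inducedLength X γ 0 t ≤ inducedLength X γ 0 1 := by
      rw [← inducedLength_add X γ ht.1 ht.2]; exact le_self_add
    exact ((h1.trans h2).trans h3).not_gt hlen
  have hconn := isPreconnected_Icc.image γ hγ.continuousOn
  have hfinal := hconn.subset_left_of_subset_union hopen hcpt.isClosed.isOpen_compl
    (disjoint_compl_right.mono_left hsub) himg
    ⟨γ 0, mem_image_of_mem _ (by simp), by rw [hγ0]; exact ⟨hp, Metric.mem_ball_self hr⟩⟩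
  obtain ⟨u, hu, huq⟩ := hsub (hfinal ⟨1, by simp, hγ1⟩)
  rw [← huq]
  exact (hball hu).1.2

/-- A function that is Lipschitz for the induced distance is locally Lipschitz in a chart. -/
theorem exists_lipschitzOnWith_comp_chart_symm [IsManifold (𝓡 n) ∞ M] {X : M → Euc (n + 1)}
    (hX : ContMDiff (𝓡 n) 𝓘(ℝ, Euc (n + 1)) ∞ X) {φ : M → ℝ} {c : NNReal}
    (hφ : ∀ q q', edist (φ q) (φ q') ≤ c * inducedEDist X q q') (p : M) {u : Euc n}
    (hu : u ∈ (chartAt (Euc n) p).target) :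
    ∃ K : NNReal, ∃ s ∈ 𝓝 u, LipschitzOnWith K (φ ∘ (chartAt (Euc n) p).symm) s := by
  set e := chartAt (Euc n) p with he
  have hc : ContinuousAt (fun z => ‖fderiv ℝ (X ∘ e.symm) z‖₊) u :=
    (contDiffAt_fderiv_comp_chart_symm hX p hu).continuousAt.nnnorm
  set C := ‖fderiv ℝ (X ∘ e.symm) u‖₊ + 1 with hC
  have hlt : ∀ᶠ z in 𝓝 u, ‖fderiv ℝ (X ∘ e.symm) z‖₊ < C :=
    hc.eventually_lt continuousAt_const (lt_add_one _)
  obtain ⟨r, hr, hball⟩ := Metric.mem_nhds_iff.1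
    (Filter.inter_mem hlt (e.open_target.mem_nhds hu))
  refine ⟨c * C, Metric.ball u r, Metric.ball_mem_nhds _ hr, fun v hv w hw => ?_⟩
  have hseg : segment ℝ v w ⊆ Metric.ball u r := (convex_ball u r).segment_subset hv hw
  have h1 := inducedEDist_chart_symm_le hX p (c := C * edist v w)
    (hseg.trans fun z hz => (hball hz).2) fun z hz => by
      rw [edist_comm, edist_eq_enorm_sub]
      refine ((fderiv ℝ (X ∘ e.symm) z).le_opENorm _).trans ?_
      gcongr
      have : ‖fderiv ℝ (X ∘ e.symm) z‖₊ ≤ C := (hball (hseg hz)).1.le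
      exact ENNReal.coe_le_coe.2 this
  calc edist (φ (e.symm v)) (φ (e.symm w)) ≤ c * inducedEDist X (e.symm v) (e.symm w) := hφ _ _
    _ ≤ c * (C * edist v w) := by gcongr
    _ = (c * C : NNReal) * edist v w := by rw [ENNReal.coe_mul, mul_assoc]

/-- The increment of φ along the segment from u to u + tv is at most c times the length of its
image, which to first order in t is |t| ‖dX v‖. This recovers the sharp constant c that the crude
local Lipschitz bound in the chart loses. -/
theorem abs_fderiv_comp_chart_symm_le [IsManifold (𝓡 n) ∞ M] {X : M → Euc (n + 1)}
    (hX : ContMDiff (𝓡 n) 𝓘(ℝ, Euc (n + 1)) ∞ X) {φ : M → ℝ} {c : NNReal}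
    (hφ : ∀ q q', edist (φ q) (φ q') ≤ c * inducedEDist X q q') (p : M) {u : Euc n}
    (hu : u ∈ (chartAt (Euc n) p).target)
    (hd : DifferentiableAt ℝ (φ ∘ (chartAt (Euc n) p).symm) u) (v : Euc n) :
    |fderiv ℝ (φ ∘ (chartAt (Euc n) p).symm) u v| ≤
      c * ‖fderiv ℝ (X ∘ (chartAt (Euc n) p).symm) u v‖ := by
  set e := chartAt (Euc n) p with he
  have hline : HasDerivAt (fun t : ℝ => u + t • v) v 0 := by
    simpa using ((hasDerivAt_id (0 : ℝ)).smul_const v).const_add u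
  have hder : HasDerivAt (fun t : ℝ => (φ ∘ e.symm) (u + t • v))
      (fderiv ℝ (φ ∘ e.symm) u v) 0 := by
    have h1 : HasFDerivAt (φ ∘ e.symm) (fderiv ℝ (φ ∘ e.symm) u) (u + (0 : ℝ) • v) := by
      simpa using hd.hasFDerivAt
    exact h1.comp_hasDerivAt 0 hline
  have hc : ContinuousAt (fun z => ‖fderiv ℝ (X ∘ e.symm) z v‖) u :=
    ((contDiffAt_fderiv_comp_chart_symm hX p hu).continuousAt.clm_apply continuousAt_const).norm
  have key : ∀ ε : ℝ, 0 < ε → |fderiv ℝ (φ ∘ e.symm) u v| ≤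
      c * (‖fderiv ℝ (X ∘ e.symm) u v‖ + ε) := by
    intro ε hε
    have hlt : ∀ᶠ z in 𝓝 u, ‖fderiv ℝ (X ∘ e.symm) z v‖ <
        ‖fderiv ℝ (X ∘ e.symm) u v‖ + ε :=
      hc.eventually_lt continuousAt_const (lt_add_of_pos_right _ hε)
    obtain ⟨r, hr, hball⟩ := Metric.mem_nhds_iff.1
      (Filter.inter_mem hlt (e.open_target.mem_nhds hu))
    refine hder.le_of_lip' (by positivity) ?_
    have hev : ∀ᶠ t : ℝ in 𝓝 0, u + t • v ∈ Metric.ball u r := by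
      have := hline.continuousAt.tendsto
      simp only [zero_smul, add_zero] at this
      exact this (Metric.ball_mem_nhds u hr)
    filter_upwards [hev] with t ht
    have hseg : segment ℝ u (u + t • v) ⊆ Metric.ball u r :=
      (convex_ball u r).segment_subset (Metric.mem_ball_self hr) ht
    have h1 := inducedEDist_chart_symm_le hX p
      (c := ENNReal.ofReal (|t| * (‖fderiv ℝ (X ∘ e.symm) u v‖ + ε)))
      (hseg.trans fun z hz => (hball hz).2) fun z hz => by
        rw [add_sub_cancel_left, map_smul, ← ofReal_norm, norm_smul, Real.norm_eq_abs]
        exact ENNReal.ofReal_le_ofReal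
          (mul_le_mul_of_nonneg_left (hball (hseg hz)).1.le (abs_nonneg t))
    have h2 := (hφ (e.symm u) (e.symm (u + t • v))).trans (mul_le_mul_right h1 _)
    rw [edist_comm, edist_dist, ← ENNReal.ofReal_coe_nnreal, ← ENNReal.ofReal_mul c.coe_nonneg,
      ENNReal.ofReal_le_ofReal_iff (by positivity), Real.dist_eq] at h2
    simp only [Function.comp, zero_smul, add_zero, sub_zero, Real.norm_eq_abs]
    linarith
  refine le_of_forall_pos_le_add fun ε hε => ?_
  have h1 := key (ε / (c + 1)) (by positivity)
  have h2 : (c : ℝ) * (ε / (c + 1)) ≤ ε := by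
    rw [mul_div_assoc', div_le_iff₀ (by positivity)]
    nlinarith [c.coe_nonneg]
  linarith

theorem eventually_inducedEDist_lt [IsManifold (𝓡 n) ∞ M] {X : M → Euc (n + 1)}
    (hX : ContMDiff (𝓡 n) 𝓘(ℝ, Euc (n + 1)) ∞ X) (p : M) {c : ℝ≥0∞} (hc : 0 < c) :
    ∀ᶠ q in 𝓝 p, inducedEDist X p q < c := by
  set e := chartAt (Euc n) p with he
  have hp : p ∈ e.source := mem_chart_source _ p
  have hu := e.map_source hp
  have hcont : ContinuousAt (fun z => ‖fderiv ℝ (X ∘ e.symm) z‖₊) (e p) :=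
    (contDiffAt_fderiv_comp_chart_symm hX p hu).continuousAt.nnnorm
  set C := ‖fderiv ℝ (X ∘ e.symm) (e p)‖₊ + 1 with hC
  have hlt : ∀ᶠ z in 𝓝 (e p), ‖fderiv ℝ (X ∘ e.symm) z‖₊ < C :=
    hcont.eventually_lt continuousAt_const (lt_add_one _)
  obtain ⟨r, hr, hball⟩ := Metric.mem_nhds_iff.1
    (Filter.inter_mem hlt (e.open_target.mem_nhds hu))
  have hsmall : ∀ᶠ v in 𝓝 (e p), (C : ℝ≥0∞) * edist (e p) v < c := by
    have h0 : Filter.Tendsto (fun v => (C : ℝ≥0∞) * edist (e p) v) (𝓝 (e p)) (𝓝 (C * 0)) := by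
      refine ENNReal.Tendsto.const_mul ?_ (Or.inr ENNReal.coe_ne_top)
      have := (continuous_const.edist continuous_id : Continuous fun v => edist (e p) v).tendsto (e p)
      simpa using this
    rw [mul_zero] at h0
    exact h0.eventually_lt_const hc
  filter_upwards [e.open_source.mem_nhds hp, (e.continuousAt hp).eventually hsmall,
    (e.continuousAt hp).preimage_mem_nhds (Metric.ball_mem_nhds _ hr)] with q hq h1 h2
  have hseg : segment ℝ (e p) (e q) ⊆ Metric.ball (e p) r :=
    (convex_ball _ r).segment_subset (Metric.mem_ball_self hr) h2
  have h3 := inducedEDist_chart_symm_le hX p (c := C * edist (e p) (e q))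
    (hseg.trans fun z hz => (hball hz).2) fun z hz => by
      rw [edist_comm, edist_eq_enorm_sub]
      refine ((fderiv ℝ (X ∘ e.symm) z).le_opENorm _).trans ?_
      gcongr
      have : ‖fderiv ℝ (X ∘ e.symm) z‖₊ ≤ C := (hball (hseg hz)).1.le
      exact ENNReal.coe_le_coe.2 this
  rw [e.left_inv hp, e.left_inv hq] at h3
  exact h3.trans_lt h1

/-- The extended metric structure of the metric induced by an immersion. -/
@[reducible] noncomputable def IsSmoothImmersion.emetric [IsManifold (𝓡 n) ∞ M] [T2Space M]
    {X : M → Euc (n + 1)} (hX : IsSmoothImmersion X) : PseudoEMetricSpace M :=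
  PseudoEMetricSpace.ofEDistOfTopology (inducedEDist X) (inducedEDist_self X)
    (inducedEDist_comm X) (inducedEDist_triangle X) fun p =>
      (Filter.basis_sets (𝓝 p)).to_hasBasis' (fun _ hs => hX.exists_inducedEDist_lt_subset p hs)
        fun _ hc => eventually_inducedEDist_lt hX.smooth p hc

/-- Take a path of length less than a + b and, by the intermediate value theorem, a point on it at
distance exactly a from its start. The first piece has length at least a, which leaves less than b
for the rest. -/
theorem IsSmoothImmersion.hasIntermediatePoints [IsManifold (𝓡 n) ∞ M] [T2Space M]
    {X : M → Euc (n + 1)} (hX : IsSmoothImmersion X) :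
    letI := hX.emetric
    HasIntermediatePoints M := by
  let := hX.emetric
  intro p q a b hb hpq
  change inducedEDist X p q < a + b at hpq
  obtain ⟨γ, rfl, rfl, hγ, hlen⟩ := exists_inducedLength_lt X hpq
  rcases le_total (inducedEDist X (γ 0) (γ 1)) a with hle | hle
  · exact ⟨γ 1, hle, by rwa [edist_self]⟩
  have hcont : ContinuousOn (fun t => edist (γ 0) (γ t)) (Icc 0 1) :=
    (continuous_const.edist continuous_id).comp_continuousOn hγ.continuousOn
  obtain ⟨t, ht, hta⟩ := intermediate_value_Icc zero_le_one hcont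
    (show a ∈ Icc (edist (γ 0) (γ 0)) (edist (γ 0) (γ 1)) from ⟨by simp, hle⟩)
  refine ⟨γ t, hta.le, ?_⟩
  have h1 := inducedEDist_le_inducedLength X (hγ.mono (Icc_subset_Icc_right ht.2)) ht.1
  have h2 := inducedEDist_le_inducedLength X (hγ.mono (Icc_subset_Icc_left ht.1)) ht.2
  rw [← inducedLength_add X γ ht.1 ht.2] at hlen
  have ha : a ≤ inducedLength X γ 0 t := hta.symm.le.trans h1
  have ha' : a ≠ ⊤ := by
    rintro rfl
    simp [top_le_iff.1 ha] at hlen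
  refine h2.trans_lt ?_
  have : a + inducedLength X γ t 1 < a + b := (add_le_add_left ha _).trans_lt hlen
  exact (ENNReal.add_lt_add_iff_left ha').1 this

theorem IsSmoothImmersion.exists_cutoff [IsManifold (𝓡 n) ∞ M] [T2Space M]
    [SecondCountableTopology M] {X : M → Euc (n + 1)} (hX : IsSmoothImmersion X)
    (hcomp : IsCompleteHypersurface X) :
    ∃ φ : ℕ → M → ℝ, (∀ j q, 0 ≤ φ j q ∧ φ j q ≤ 1) ∧ (∀ j, HasCompactSupport (φ j)) ∧
      (∀ (j : ℕ) q q', edist (φ j q) (φ j q') ≤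
        ENNReal.ofReal ((j + 1 : ℝ)⁻¹) * inducedEDist X q q') ∧
      ∀ q, ∀ᶠ j in Filter.atTop, φ j q = 1 := by
  have : LocallyCompactSpace M := ChartedSpace.locallyCompactSpace (Euc n) M
  let := hX.emetric
  have : CompleteSpace M := EMetric.complete_of_cauchySeq_tendsto fun u hu =>
    hcomp u (EMetric.cauchySeq_iff.1 hu)
  exact exists_cutoff_of_isCompact_closedEBall
    fun p r => isCompact_closedEBall_of_hasIntermediatePoints hX.hasIntermediatePoints p r

end InducedDistance

/-! ### Integration by parts for Lipschitz functions on ℝⁿ. -/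

section IntegrationByParts

open MeasureTheory Set

variable {n : ℕ}

/-- Integration by parts on `ℝ^n` of a locally Lipschitz function against a compactly supported
vector field. -/
theorem integral_fderiv_apply_eq_neg_integral_mul_endTrace {Ω : Set (Euc n)} (hΩ : IsOpen Ω)
    {h : Euc n → ℝ}
    (hh : ∀ u ∈ Ω, ∃ K : NNReal, ∃ s ∈ 𝓝 u, LipschitzOnWith K h s)
    {G : Euc n → Euc n} (hG : ContDiff ℝ 1 G) (hGc : HasCompactSupport G) (hGΩ : tsupport G ⊆ Ω) :
    ∫ u, fderiv ℝ h u (G u) = -∫ u, h u * endTrace (fderiv ℝ G u) := by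
  -- Nothing is known about h outside Ω. It is replaced by a globally Lipschitz H that agrees with
  -- it on a compact neighbourhood L of the support of G; H is differentiable almost everywhere, by
  -- Rademacher's theorem.
  obtain ⟨L, hL, hKL, hLΩ⟩ := exists_compact_between hGc hΩ hGΩ
  have hlip : LocallyLipschitzOn L h := fun u hu => by
    obtain ⟨K, s, hs, hK⟩ := hh u (hLΩ hu)
    exact ⟨K, s, mem_nhdsWithin_of_mem_nhds hs, hK⟩
  obtain ⟨C, hC⟩ := hlip.exists_lipschitzOnWith_of_compact hL
  obtain ⟨H, hH, hHh⟩ := hC.extend_real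
  have hcomp : ∀ i, ContDiff ℝ 1 fun u => G u i := fun i => (contDiff_piLp_apply (p := 2) (i := i)).comp hG
  have hsupp : ∀ i, HasCompactSupport fun u => G u i := fun i =>
    hGc.comp_left (g := fun v : Euc n => v i) rfl
  have hGlip : ∀ i, ∃ D, LipschitzWith D fun u => G u i := fun i =>
    ContDiff.lipschitzWith_of_hasCompactSupport (hsupp i) (hcomp i) one_ne_zero
  choose D hD using hGlip
  have hparts : ∀ i, ∫ u, lineDeriv ℝ H u (EuclideanSpace.single i 1) * G u i =
      ∫ u, lineDeriv ℝ (fun u => G u i) u (-EuclideanSpace.single i 1) * H u := fun i =>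
    hH.integral_lineDeriv_mul_eq (hD i) (hsupp i) _
  have hint1 : ∀ i ∈ Finset.univ, Integrable
      (fun u => lineDeriv ℝ H u (EuclideanSpace.single i 1) * G u i) volume := fun i _ =>
    ((hcomp i).continuous.integrable_of_hasCompactSupport (hsupp i)).mul_of_top_right
      (hH.memLp_lineDeriv _)
  have hlineG : ∀ i u, lineDeriv ℝ (fun u => G u i) u (-EuclideanSpace.single i 1) =
      -(fderiv ℝ G u (EuclideanSpace.single i 1) i) := by
    intro i u
    have h1 : HasFDerivAt (fun u => G u i)
        ((EuclideanSpace.proj i : Euc n →L[ℝ] ℝ).comp (fderiv ℝ G u)) u :=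
      (EuclideanSpace.proj i : Euc n →L[ℝ] ℝ).hasFDerivAt.comp u
        (hG.differentiable one_ne_zero u).hasFDerivAt
    rw [h1.differentiableAt.lineDeriv_eq_fderiv, h1.fderiv]
    simp
  have hzero : ∀ u, u ∉ tsupport G → G =ᶠ[𝓝 u] 0 := fun u hu =>
    notMem_tsupport_iff_eventuallyEq.1 hu
  have hHnear : ∀ u ∈ tsupport G, H =ᶠ[𝓝 u] h := fun u hu => by
    filter_upwards [isOpen_interior.mem_nhds (hKL hu)] with v hv
    exact (hHh (interior_subset hv)).symm
  have hint2 : ∀ i ∈ Finset.univ, Integrable (fun u =>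
      lineDeriv ℝ (fun u => G u i) u (-EuclideanSpace.single i 1) * H u) volume := fun i _ => by
    simp only [hlineG]
    refine Continuous.integrable_of_hasCompactSupport (Continuous.mul ?_ hH.continuous) ?_
    · exact ((contDiff_piLp_apply (𝕜 := ℝ) (n := 0) (p := 2) (i := i)).continuous.comp
        ((hG.continuous_fderiv one_ne_zero).clm_apply continuous_const)).neg
    · refine HasCompactSupport.intro hGc fun u hu => ?_
      rw [(hzero u hu).fderiv_eq]
      simp
  have hsum := Finset.sum_congr (rfl : (Finset.univ : Finset (Fin n)) = _) fun i _ => hparts i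
  rw [← integral_finsetSum _ hint1, ← integral_finsetSum _ hint2] at hsum
  have hleft : ∫ u, fderiv ℝ h u (G u) =
      ∫ u, ∑ i, lineDeriv ℝ H u (EuclideanSpace.single i 1) * G u i := by
    refine integral_congr_ae ?_
    filter_upwards [hH.ae_differentiableAt (μ := volume)] with u hu
    by_cases hus : u ∈ tsupport G
    · rw [← (hHnear u hus).fderiv_eq]
      conv_lhs => rw [sum_single (G u)]
      simp only [map_sum, map_smul, smul_eq_mul, hu.lineDeriv_eq_fderiv, mul_comm]
    · simp [(hzero u hus).eq_of_nhds]
  rw [hleft, hsum, ← integral_neg]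
  refine integral_congr_ae (Filter.Eventually.of_forall fun u => ?_)
  simp only [hlineG]
  by_cases hus : u ∈ tsupport G
  · rw [(hHnear u hus).eq_of_nhds, endTrace_eq_sum, Finset.mul_sum, ← Finset.sum_neg_distrib]
    exact Finset.sum_congr rfl fun i _ => by ring
  · rw [(hzero u hus).fderiv_eq]
    simp [endTrace]

end IntegrationByParts

/-! ### The coordinate divergence of a tangential part. -/

section ChartDivergence

variable {n : ℕ}

theorem hasFDerivAt_sqrt_det_gramOf {A : Euc n → Euc n →L[ℝ] Euc (n + 1)} {ν : Euc (n + 1)}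
    {u : Euc n} (h : IsFrame (A u) ν) (hA : DifferentiableAt ℝ A u) :
    DifferentiableAt ℝ (fun z => Real.sqrt (gramOf (A z)).det) u ∧
    ∀ w, fderiv ℝ (fun z => Real.sqrt (gramOf (A z)).det) u w =
      Real.sqrt (gramOf (A u)).det * endTrace ((leftInv (A u) ν).comp (fderiv ℝ A u w)) := by
  have hpos := det_gramOf_pos h.injective
  have hd : DifferentiableAt ℝ (fun z => Real.sqrt (gramOf (A z)).det) u :=
    (((contDiff_det_gramOf (k := 1)).differentiable one_ne_zero _).comp u hA).sqrt hpos.ne'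
  refine ⟨hd, fun w => ?_⟩
  have hline : HasDerivAt (fun t : ℝ => u + t • w) w 0 := by
    simpa using ((hasDerivAt_id (0 : ℝ)).smul_const w).const_add u
  have hu : u + (0 : ℝ) • w = u := by simp
  have h1 : HasDerivAt (fun t : ℝ => A (u + t • w)) (fderiv ℝ A u w) 0 := by
    have : HasFDerivAt A (fderiv ℝ A u) (u + (0 : ℝ) • w) := by
      rw [hu]; exact hA.hasFDerivAt
    exact this.comp_hasDerivAt 0 hline
  have h2 : HasDerivAt (fun t : ℝ => Real.sqrt (gramOf (A (u + t • w))).det)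
      (fderiv ℝ (fun z => Real.sqrt (gramOf (A z)).det) u w) 0 := by
    have : HasFDerivAt (fun z => Real.sqrt (gramOf (A z)).det)
        (fderiv ℝ (fun z => Real.sqrt (gramOf (A z)).det) u) (u + (0 : ℝ) • w) := by
      rw [hu]; exact hd.hasFDerivAt
    exact this.comp_hasDerivAt 0 hline
  rw [h2.unique (IsFrame.hasDerivAt_sqrt_det_gramOf (ν := ν) (by rw [hu]; exact h) h1)]
  simp only [hu]

/-- The divergence, in coordinates, of the tangential part of a vector field `V` along a
parametrized hypersurface `F` with unit normal `ν`. -/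
theorem endTrace_fderiv_smul_leftInv {Ω : Set (Euc n)} (hΩ : IsOpen Ω)
    {F ν V : Euc n → Euc (n + 1)} (hF : ContDiffOn ℝ ∞ F Ω) (hν : ContDiffOn ℝ ∞ ν Ω)
    (hV : ContDiffOn ℝ ∞ V Ω) (hframe : ∀ z ∈ Ω, IsFrame (fderiv ℝ F z) (ν z)) {u : Euc n}
    (hu : u ∈ Ω) :
    endTrace (fderiv ℝ (fun z => Real.sqrt (gramOf (fderiv ℝ F z)).det •
      leftInv (fderiv ℝ F z) (ν z) (V z)) u) = Real.sqrt (gramOf (fderiv ℝ F u)).det *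
        (endTrace ((leftInv (fderiv ℝ F u) (ν u)).comp (fderiv ℝ V u)) -
          ⟪V u, ν u⟫ * endTrace ((leftInv (fderiv ℝ F u) (ν u)).comp (fderiv ℝ ν u))) := by
  have hFu : ContDiffAt ℝ ∞ F u := hF.contDiffAt (hΩ.mem_nhds hu)
  have hνu : ContDiffAt ℝ ∞ ν u := hν.contDiffAt (hΩ.mem_nhds hu)
  have hVu : ContDiffAt ℝ ∞ V u := hV.contDiffAt (hΩ.mem_nhds hu)
  have hA : ContDiffAt ℝ ∞ (fderiv ℝ F) u := hFu.fderiv_right (by simp)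
  set A := fderiv ℝ F with hAdef
  set w : Euc n → Euc n := fun z => leftInv (A z) (ν z) (V z) with hw
  have hfu := hframe u hu
  have hwu : DifferentiableAt ℝ w u :=
    ((hfu.contDiffAt_leftInv hA hνu).clm_apply hVu).differentiableAt (by simp)
  have hAd : DifferentiableAt ℝ A u := hA.differentiableAt (by simp)
  obtain ⟨hρ, hρ'⟩ := hasFDerivAt_sqrt_det_gramOf hfu hAd
  have hνd : DifferentiableAt ℝ ν u := hνu.differentiableAt (by simp)
  have hVd : DifferentiableAt ℝ V u := hVu.differentiableAt (by simp)
  have hid : DifferentiableAt ℝ (fun z => ⟪V z, ν z⟫) u := hVd.inner ℝ hνd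
  have hVeq : V =ᶠ[𝓝 u] fun z => A z (w z) + ⟪V z, ν z⟫ • ν z := by
    filter_upwards [hΩ.mem_nhds hu] with z hz
    exact (hframe z hz).decomp (V z)
  -- Differentiate V = A w + ⟨V, ν⟩ ν and apply the left inverse, which kills the term d⟨V, ν⟩ ν.
  -- Symmetry of the second derivative of F lets the slots of D²F(e, w) be exchanged, so that the
  -- trace of this term is the logarithmic derivative of the area density along w.
  have hVder : (leftInv (A u) (ν u)).comp (fderiv ℝ V u) =
      (leftInv (A u) (ν u)).comp (fderiv ℝ A u (w u)) + fderiv ℝ w u +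
        ⟪V u, ν u⟫ • (leftInv (A u) (ν u)).comp (fderiv ℝ ν u) := by
    ext1 e
    have h1 := ((hAd.hasFDerivAt.clm_apply hwu.hasFDerivAt).add
      (hid.hasFDerivAt.smul hνd.hasFDerivAt)).congr_of_eventuallyEq hVeq
    have hsymm : fderiv ℝ A u e (w u) = fderiv ℝ A u (w u) e :=
      (hFu.isSymmSndFDerivAt (by simp; exact WithTop.coe_le_coe.2 le_top)) e (w u)
    rw [h1.fderiv]
    simp [hsymm, hfu.leftInv_apply, hfu.leftInv_normal]
    abel
  rw [fderiv_fun_smul hρ hwu, endTrace_add, endTrace_smul, endTrace_smulRight, hρ', hVder,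
    endTrace_add, endTrace_add, endTrace_smul]
  ring

end ChartDivergence

/-! ### The divergence theorem on the hypersurface. -/

section Divergence

open MeasureTheory Set

variable {n : ℕ} {M : Type*} [TopologicalSpace M] [ChartedSpace (Euc n) M]

theorem IsUnitNormal.isFrame {X N : M → Euc (n + 1)} (hX : IsSmoothImmersion X)
    (hN : IsUnitNormal X N) (p : M) : IsFrame (diff X p) (N p) :=
  ⟨hX.injective p, hN.unit p, hN.orthogonal p⟩

theorem meanCurvature_eq {X N : M → Euc (n + 1)} (hX : IsSmoothImmersion X)
    (hN : IsUnitNormal X N) (p : M) :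
    meanCurvature X N p = -endTrace ((leftInv (diff X p) (N p)).comp (diff N p)) :=
  (hN.isFrame hX p).trace_inv_gramOf_mul (diff N p)

/-- The divergence of the tangential part of a vector field `V` along `X`. -/
noncomputable def divAlong (X N V : M → Euc (n + 1)) (p : M) : ℝ :=
  endTrace ((leftInv (diff X p) (N p)).comp (diff V p)) + meanCurvature X N p * ⟪V p, N p⟫

theorem diff_eq_fderiv {V : M → Euc (n + 1)} (hV : ContMDiff (𝓡 n) 𝓘(ℝ, Euc (n + 1)) ∞ V)
    (p : M) : diff V p = fderiv ℝ (V ∘ (chartAt (Euc n) p).symm) (chartAt (Euc n) p p) := by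
  have h := hV.mdifferentiable (by simp) p
  refine h.mfderiv.trans ?_
  simp [writtenInExtChartAt, Function.comp_def]
  rfl

theorem diff_congr {V W : M → Euc (n + 1)} {p : M} (h : V =ᶠ[𝓝 p] W) : diff V p = diff W p :=
  h.mfderiv_eq

theorem divAlong_congr {X N V W : M → Euc (n + 1)} {p : M} (h : V =ᶠ[𝓝 p] W) :
    divAlong X N V p = divAlong X N W p := by
  rw [divAlong, divAlong, diff_congr h, h.eq_of_nhds]

theorem divAlong_eq_zero {X N V : M → Euc (n + 1)} {p : M} (h : V =ᶠ[𝓝 p] 0) :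
    divAlong X N V p = 0 := by
  have h0 : diff (0 : M → Euc (n + 1)) p = 0 := by
    exact mfderiv_const
  rw [divAlong_congr h, divAlong, h0]
  simp [endTrace]

variable [IsManifold (𝓡 n) ∞ M]

theorem IsUnitNormal.isFrame_chart {X N : M → Euc (n + 1)} (hX : IsSmoothImmersion X)
    (hN : IsUnitNormal X N) (p : M) {u : Euc n} (hu : u ∈ (chartAt (Euc n) p).target) :
    IsFrame (fderiv ℝ (X ∘ (chartAt (Euc n) p).symm) u) ((N ∘ (chartAt (Euc n) p).symm) u) := by
  obtain ⟨T, hT⟩ := exists_chart_equiv p hu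
  rw [fderiv_chart_of_equiv hT (hX.smooth.mdifferentiable (by simp))]
  exact (hN.isFrame hX _).comp T

theorem endTrace_leftInv_chart {X N V : M → Euc (n + 1)} (hX : IsSmoothImmersion X)
    (hN : IsUnitNormal X N) (hV : ContMDiff (𝓡 n) 𝓘(ℝ, Euc (n + 1)) ∞ V) (p : M) {u : Euc n}
    (hu : u ∈ (chartAt (Euc n) p).target) :
    endTrace ((leftInv (diff X ((chartAt (Euc n) p).symm u)) (N ((chartAt (Euc n) p).symm u))).comp
      (diff V ((chartAt (Euc n) p).symm u))) =
    endTrace ((leftInv (fderiv ℝ (X ∘ (chartAt (Euc n) p).symm) u)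
      ((N ∘ (chartAt (Euc n) p).symm) u)).comp (fderiv ℝ (V ∘ (chartAt (Euc n) p).symm) u)) := by
  obtain ⟨T, hT⟩ := exists_chart_equiv p hu
  rw [fderiv_chart_of_equiv hT (hX.smooth.mdifferentiable (by simp)),
    fderiv_chart_of_equiv hT (hV.mdifferentiable (by simp))]
  exact ((hN.isFrame hX _).endTrace_leftInv_comp T _).symm

theorem continuous_endTrace : Continuous (endTrace (n := n)) := by
  have : endTrace (n := n) = fun T => ∑ i, T (EuclideanSpace.single i 1) i :=
    funext endTrace_eq_sum
  rw [this]
  fun_prop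

theorem continuous_endTrace_leftInv_diff {X N V : M → Euc (n + 1)} (hX : IsSmoothImmersion X)
    (hN : IsUnitNormal X N) (hV : ContMDiff (𝓡 n) 𝓘(ℝ, Euc (n + 1)) ∞ V) :
    Continuous fun p => endTrace ((leftInv (diff X p) (N p)).comp (diff V p)) := by
  refine continuous_iff_continuousAt.2 fun p => ?_
  set e := chartAt (Euc n) p with he
  have hp := mem_chart_source (Euc n) p
  have hu := e.map_source hp
  have h1 : ContinuousAt (fun u => endTrace ((leftInv (fderiv ℝ (X ∘ e.symm) u)
      ((N ∘ e.symm) u)).comp (fderiv ℝ (V ∘ e.symm) u))) (e p) :=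
    continuous_endTrace.continuousAt.comp
      (((hN.isFrame_chart hX p hu).contDiffAt_leftInv
        (contDiffAt_fderiv_comp_chart_symm hX.smooth p hu)
        ((contDiffOn_comp_chart_symm hN.smooth p).contDiffAt (e.open_target.mem_nhds hu))).clm_comp
        (contDiffAt_fderiv_comp_chart_symm hV p hu)).continuousAt
  refine (h1.comp (e.continuousAt hp)).congr ?_
  filter_upwards [chart_source_mem_nhds (Euc n) p] with q hq
  have := endTrace_leftInv_chart hX hN hV p (e.map_source hq)
  rw [← he, e.left_inv hq] at this
  exact this.symm

theorem IsUnitNormal.continuous_meanCurvature {X N : M → Euc (n + 1)} (hX : IsSmoothImmersion X)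
    (hN : IsUnitNormal X N) : Continuous (meanCurvature X N) := by
  rw [funext (meanCurvature_eq hX hN)]
  exact (continuous_endTrace_leftInv_diff hX hN hN.smooth).neg

theorem continuous_divAlong {X N V : M → Euc (n + 1)} (hX : IsSmoothImmersion X)
    (hN : IsUnitNormal X N) (hV : ContMDiff (𝓡 n) 𝓘(ℝ, Euc (n + 1)) ∞ V) :
    Continuous (divAlong X N V) :=
  (continuous_endTrace_leftInv_diff hX hN hV).add
    ((hN.continuous_meanCurvature hX).mul (hV.continuous.inner hN.smooth.continuous))

theorem divAlong_sum {ι : Type*} (s : Finset ι) {X N : M → Euc (n + 1)}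
    {V : ι → M → Euc (n + 1)} (hV : ∀ i, ContMDiff (𝓡 n) 𝓘(ℝ, Euc (n + 1)) ∞ (V i)) (p : M) :
    divAlong X N (fun q => ∑ i ∈ s, V i q) p = ∑ i ∈ s, divAlong X N (V i) p := by
  have hsum : ContMDiff (𝓡 n) 𝓘(ℝ, Euc (n + 1)) ∞ fun q => ∑ i ∈ s, V i q :=
    contMDiff_finsetSum fun i _ => hV i
  have hd : diff (fun q => ∑ i ∈ s, V i q) p = ∑ i ∈ s, diff (V i) p := by
    rw [diff_eq_fderiv hsum, Finset.sum_congr rfl fun i _ => diff_eq_fderiv (hV i) p]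
    exact fderiv_fun_sum fun i _ => ((contDiffOn_comp_chart_symm (hV i) p).contDiffAt
      ((chartAt (Euc n) p).open_target.mem_nhds
        ((chartAt (Euc n) p).map_source (mem_chart_source _ p)))).differentiableAt (by simp)
  simp only [divAlong]
  rw [hd, Finset.sum_add_distrib, sum_inner, Finset.mul_sum]
  congr 1
  simp [endTrace_eq_sum]
  rw [Finset.sum_comm]

theorem continuous_of_edist_le {X : M → Euc (n + 1)}
    (hX : ContMDiff (𝓡 n) 𝓘(ℝ, Euc (n + 1)) ∞ X) {φ : M → ℝ} {c : NNReal}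
    (hφ : ∀ q q', edist (φ q) (φ q') ≤ c * inducedEDist X q q') : Continuous φ := by
  refine continuous_iff_continuousAt.2 fun p => ?_
  set e := chartAt (Euc n) p with he
  have hp := mem_chart_source (Euc n) p
  obtain ⟨K, s, hs, hK⟩ := exists_lipschitzOnWith_comp_chart_symm hX hφ p (e.map_source hp)
  have h1 : ContinuousAt (φ ∘ e.symm) (e p) := hK.continuousOn.continuousAt hs
  refine (h1.comp (e.continuousAt hp)).congr ?_
  filter_upwards [chart_source_mem_nhds (Euc n) p] with q hq
  simp [e.left_inv hq]

variable [MeasurableSpace M] [BorelSpace M] [T2Space M]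

/-- The divergence theorem for vector fields supported in a chart, tested against a function that
is Lipschitz for the induced distance. -/
theorem abs_integral_mul_divAlong_le_of_subset_source {X N V : M → Euc (n + 1)}
    (hX : IsSmoothImmersion X) (hN : IsUnitNormal X N)
    (hV : ContMDiff (𝓡 n) 𝓘(ℝ, Euc (n + 1)) ∞ V) (hVc : HasCompactSupport V) {p : M}
    (hVp : tsupport V ⊆ (chartAt (Euc n) p).source) {φ : M → ℝ} {c : NNReal}
    (hφ : ∀ q q', edist (φ q) (φ q') ≤ c * inducedEDist X q q') :
    |∫ q, φ q * divAlong X N V q ∂(area X)| ≤ c * ∫ q, ‖V q‖ ∂(area X) := by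
  set e := chartAt (Euc n) p with he
  have hφc := continuous_of_edist_le hX.smooth hφ
  set G₀ : Euc n → Euc n := fun z => Real.sqrt (gramOf (fderiv ℝ (X ∘ e.symm) z)).det •
      leftInv (fderiv ℝ (X ∘ e.symm) z) ((N ∘ e.symm) z) ((V ∘ e.symm) z) with hG₀
  -- The coordinate field √(det g) times the tangential part of V, extended by zero. Outside the
  -- chart target the formula for G₀ has no meaning; inside it, G vanishes off the compact image of
  -- the support of V, so the extension is C¹.
  set G : Euc n → Euc n := e.target.indicator G₀ with hG
  have hGeq : ∀ u ∈ e.target, G =ᶠ[𝓝 u] G₀ := fun u hu => by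
    filter_upwards [e.open_target.mem_nhds hu] with z hz
    exact indicator_of_mem hz _
  have hKc : IsCompact (e '' tsupport V) :=
    IsCompact.image_of_continuousOn hVc (e.continuousOn.mono hVp)
  have hzero : ∀ u, u ∉ e '' tsupport V → G u = 0 := fun u hu => by
    by_cases hut : u ∈ e.target
    · have : V (e.symm u) = 0 := by
        by_contra hne
        exact hu ⟨e.symm u, subset_tsupport _ hne, e.right_inv hut⟩
      simp [hG, hG₀, this]
    · exact indicator_of_notMem hut _
  have hGc : HasCompactSupport G := HasCompactSupport.intro hKc hzero
  have hGsub : tsupport G ⊆ e.target := by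
    refine (closure_minimal (fun u hu => ?_) hKc.isClosed).trans
      (image_subset_iff.2 fun q hq => e.map_source (hVp hq))
    by_contra hcon
    exact hu (hzero u hcon)
  have hGs : ContDiff ℝ 1 G := by
    refine contDiff_iff_contDiffAt.2 fun u => ?_
    by_cases hut : u ∈ e.target
    · refine ContDiffAt.congr_of_eventuallyEq ?_ (hGeq u hut)
      have hA := (contDiffAt_fderiv_comp_chart_symm hX.smooth p hut).of_le
        (m := 1) (by norm_cast)
      have hf := hN.isFrame_chart hX p hut
      have hpos := det_gramOf_pos hf.injective
      refine ContDiffAt.smul (𝕜' := ℝ) ?_ ?_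
      · exact (contDiff_det_gramOf.contDiffAt.comp u hA).sqrt hpos.ne'
      · exact (hf.contDiffAt_leftInv hA
          (((contDiffOn_comp_chart_symm hN.smooth p).contDiffAt
            (e.open_target.mem_nhds hut)).of_le (by norm_cast))).clm_apply
          (((contDiffOn_comp_chart_symm hV p).contDiffAt
            (e.open_target.mem_nhds hut)).of_le (by norm_cast))
    · have : G =ᶠ[𝓝 u] fun _ => 0 :=
        notMem_tsupport_iff_eventuallyEq.1 fun h => hut (hGsub h)
      exact contDiffAt_const.congr_of_eventuallyEq this
  have hdiv : ∀ u ∈ e.target, endTrace (fderiv ℝ G u) =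
      chartDensity X p u * divAlong X N V (e.symm u) := fun u hu => by
    rw [(hGeq u hu).fderiv_eq, endTrace_fderiv_smul_leftInv e.open_target
      (contDiffOn_comp_chart_symm hX.smooth p) (contDiffOn_comp_chart_symm hN.smooth p)
      (contDiffOn_comp_chart_symm hV p) (fun z hz => hN.isFrame_chart hX p hz) hu,
      ← endTrace_leftInv_chart hX hN hV p hu, ← endTrace_leftInv_chart hX hN hN.smooth p hu,
      divAlong, meanCurvature_eq hX hN, chartDensity]
    simp only [Function.comp_apply, ← he]
    ring
  have hibp := integral_fderiv_apply_eq_neg_integral_mul_endTrace e.open_target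
    (fun u hu => exists_lipschitzOnWith_comp_chart_symm hX.smooth hφ p hu) hGs hGc hGsub
  have hGout : ∀ u, u ∉ e.target → (φ ∘ e.symm) u * endTrace (fderiv ℝ G u) = 0 := by
    intro u hu
    have : G =ᶠ[𝓝 u] fun _ => 0 :=
      notMem_tsupport_iff_eventuallyEq.1 fun h => hu (hGsub h)
    rw [this.fderiv_eq]
    simp [endTrace]
  have hleft : ∫ q, φ q * divAlong X N V q ∂(area X) =
      ∫ u, (φ ∘ e.symm) u * endTrace (fderiv ℝ G u) := by
    rw [← setIntegral_eq_integral_of_forall_compl_eq_zero (s := e.source),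
      setIntegral_source_eq hX.smooth p (f := fun q => φ q * divAlong X N V q)
        (hφc.mul (continuous_divAlong hX hN hV)).aestronglyMeasurable,
      ← setIntegral_eq_integral_of_forall_compl_eq_zero hGout]
    · refine setIntegral_congr_fun e.open_target.measurableSet fun u hu => ?_
      simp only [hdiv u hu, Function.comp, ← he]
      ring
    · intro q hq
      rw [divAlong_eq_zero (notMem_tsupport_iff_eventuallyEq.1 fun h => hq (hVp h)), mul_zero]
  have hright : ∫ q, ‖V q‖ ∂(area X) =
      ∫ u in e.target, chartDensity X p u * ‖V (e.symm u)‖ := by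
    rw [← setIntegral_eq_integral_of_forall_compl_eq_zero (s := e.source),
      setIntegral_source_eq hX.smooth p hV.continuous.norm.aestronglyMeasurable]
    intro q hq
    rw [norm_eq_zero]
    exact image_eq_zero_of_notMem_tsupport fun h => hq (hVp h)
  -- Here |dφ(G)| ≤ c ‖dX(G)‖, and dX(G) is √(det g) times the orthogonal projection of V, of norm
  -- at most ‖V‖. Where φ is not differentiable, `fderiv` is zero by convention and the bound is
  -- trivial.
  have hbound : ∀ u ∈ e.target, ‖fderiv ℝ (φ ∘ e.symm) u (G u)‖ ≤
      c * (chartDensity X p u * ‖V (e.symm u)‖) := fun u hu => by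
    by_cases hd : DifferentiableAt ℝ (φ ∘ e.symm) u
    · refine (abs_fderiv_comp_chart_symm_le hX.smooth hφ p hu hd _).trans ?_
      refine mul_le_mul_of_nonneg_left ?_ c.coe_nonneg
      rw [(hGeq u hu).eq_of_nhds, hG₀, map_smul, norm_smul, Real.norm_of_nonneg (Real.sqrt_nonneg _)]
      exact mul_le_mul_of_nonneg_left ((hN.isFrame_chart hX p hu).norm_leftInv_le _)
        (Real.sqrt_nonneg _)
    · rw [fderiv_zero_of_not_differentiableAt hd]
      simp only [_root_.zero_apply, norm_zero]
      have := chartDensity_nonneg X p u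
      positivity
  have hVint : Integrable (fun q => ‖V q‖) (area X) := by
    have := isLocallyFiniteMeasure_area hX.smooth
    exact hV.continuous.norm.integrable_of_hasCompactSupport hVc.norm
  have hint : IntegrableOn (fun u => chartDensity X p u * ‖V (e.symm u)‖) e.target := by
    have h1 : Integrable (fun q => ‖V q‖) (chartArea X p) := by
      rw [← area_restrict_source hX.smooth p]; exact hVint.restrict
    rw [chartArea_eq] at h1
    have h2 := h1.comp_aemeasurable (aemeasurable_chart_symm_withDensity X p)
    rw [integrable_withDensity_iff_integrable_smul₀'
      (measurable_chartDensity X p).ennreal_ofReal.aemeasurable (by simp)] at h2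
    refine h2.congr (Filter.Eventually.of_forall fun u => ?_)
    simp [ENNReal.toReal_ofReal, chartDensity_nonneg, he]
  rw [hleft, ← abs_neg, ← hibp, hright, ← integral_const_mul,
    ← setIntegral_eq_integral_of_forall_compl_eq_zero (s := e.target)]
  · exact norm_integral_le_of_norm_le (hint.const_mul _)
      ((ae_restrict_iff' e.open_target.measurableSet).2 (Filter.Eventually.of_forall hbound))
  · intro u hu
    rw [hG, indicator_of_notMem hu, map_zero]

/-- The divergence theorem tested against a compactly supported function that is Lipschitz for
the induced distance. -/
theorem abs_integral_mul_divAlong_le [SecondCountableTopology M] {X N V : M → Euc (n + 1)}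
    (hX : IsSmoothImmersion X) (hN : IsUnitNormal X N)
    (hV : ContMDiff (𝓡 n) 𝓘(ℝ, Euc (n + 1)) ∞ V)
    (hVint : Integrable (fun q => ‖V q‖) (area X)) {φ : M → ℝ} {c : NNReal}
    (hφ : ∀ q q', edist (φ q) (φ q') ≤ c * inducedEDist X q q') (hφc : HasCompactSupport φ) :
    |∫ q, φ q * divAlong X N V q ∂(area X)| ≤ c * ∫ q, ‖V q‖ ∂(area X) := by
  have := isLocallyFiniteMeasure_area hX.smooth
  have : LocallyCompactSpace M := ChartedSpace.locallyCompactSpace (Euc n) M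
  have hcont := continuous_of_edist_le hX.smooth hφ
  have hnb : ∀ p : M, ∃ C : Set M, C ∈ 𝓝 p ∧ C ⊆ (chartAt (Euc n) p).source ∧ IsCompact C :=
    fun p => local_compact_nhds (chart_source_mem_nhds (Euc n) p)
  choose C hCn hCs hCc using hnb
  obtain ⟨t, -, ht⟩ := hφc.elim_nhds_subcover (fun p => interior (C p))
    fun p _ => interior_mem_nhds.2 (hCn p)
  obtain ⟨ρ, hρ⟩ := SmoothPartitionOfUnity.exists_isSubordinate (𝓡 n) (isClosed_tsupport φ)
    (fun p : t => interior (C p)) (fun _ => isOpen_interior)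
    (by simpa [iUnion_subtype] using ht)
  -- The pieces ρᵢ V are compactly supported in charts although V need not be. As the ρᵢ are
  -- nonnegative with sum at most 1, the norms of the pieces add up to at most ‖V‖, so localization
  -- costs no constant and no derivative of ρᵢ appears.
  set W : t → M → Euc (n + 1) := fun i q => ρ i q • V q with hW
  have hWs : ∀ i, ContMDiff (𝓡 n) 𝓘(ℝ, Euc (n + 1)) ∞ (W i) := fun i =>
    (ρ i).contMDiff.smul hV
  have hWsub : ∀ i, tsupport (W i) ⊆ C i := fun i =>
    (tsupport_smul_subset_left (fun q => ρ i q) V).trans ((hρ i).trans interior_subset)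
  have hWc : ∀ i, HasCompactSupport (W i) := fun i =>
    (hCc i).of_isClosed_subset (isClosed_tsupport _) (hWsub i)
  have hsum : ∀ q, φ q * divAlong X N V q = ∑ i, φ q * divAlong X N (W i) q := by
    intro q
    by_cases hq : φ q = 0
    · simp [hq]
    rw [← Finset.mul_sum, ← divAlong_sum Finset.univ hWs q]
    congr 1
    refine divAlong_congr ?_
    -- The divergence involves a derivative, so Σ ρᵢ = 1 is needed on a neighbourhood; the set where
    -- φ ≠ 0 is open and provides one.
    filter_upwards [hcont.isOpen_support.mem_nhds hq] with z hz
    have h1 : ∑ i, ρ i z = 1 := by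
      rw [← finsum_eq_sum_of_fintype]
      exact ρ.sum_eq_one (subset_tsupport φ hz)
    simp only [hW, ← Finset.sum_smul, h1, one_smul]
  have hint : ∀ i ∈ Finset.univ, Integrable (fun q => φ q * divAlong X N (W i) q) (area X) :=
    fun i _ => (hcont.mul (continuous_divAlong hX hN (hWs i))).integrable_of_hasCompactSupport
      hφc.mul_right
  have hWint : ∀ i ∈ Finset.univ, Integrable (fun q => ‖W i q‖) (area X) := fun i _ =>
    (hWs i).continuous.norm.integrable_of_hasCompactSupport (hWc i).norm
  simp only [hsum]
  rw [integral_finsetSum _ hint]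
  calc |∑ i, ∫ q, φ q * divAlong X N (W i) q ∂(area X)|
      ≤ ∑ i, |∫ q, φ q * divAlong X N (W i) q ∂(area X)| := Finset.abs_sum_le_sum_abs _ _
    _ ≤ ∑ i, c * ∫ q, ‖W i q‖ ∂(area X) := Finset.sum_le_sum fun i _ =>
        abs_integral_mul_divAlong_le_of_subset_source hX hN (hWs i) (hWc i)
          ((hWsub i).trans (hCs i)) hφ
    _ = c * ∫ q, ∑ i, ‖W i q‖ ∂(area X) := by
        rw [← Finset.mul_sum, integral_finsetSum _ hWint]
    _ ≤ c * ∫ q, ‖V q‖ ∂(area X) := by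
        refine mul_le_mul_of_nonneg_left
          (integral_mono (integrable_finsetSum _ hWint) hVint fun q => ?_) c.coe_nonneg
        have h1 : ∑ i, ρ i q ≤ 1 := by
          rw [← finsum_eq_sum_of_fintype]
          exact ρ.sum_le_one q
        have h2 : ∑ i, ‖W i q‖ = (∑ i, ρ i q) * ‖V q‖ := by
          rw [Finset.sum_mul]
          refine Finset.sum_congr rfl fun i _ => ?_
          rw [hW, norm_smul, Real.norm_of_nonneg (ρ.nonneg i q)]
        simp only [h2]
        exact mul_le_of_le_one_left (norm_nonneg _) h1

/-- The divergence theorem on a complete hypersurface. -/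
theorem integral_divAlong_eq_zero [SecondCountableTopology M] {X N V : M → Euc (n + 1)}
    (hX : IsSmoothImmersion X) (hN : IsUnitNormal X N) (hcomp : IsCompleteHypersurface X)
    (hV : ContMDiff (𝓡 n) 𝓘(ℝ, Euc (n + 1)) ∞ V)
    (hVint : Integrable (fun q => ‖V q‖) (area X)) (hdiv : Integrable (divAlong X N V) (area X)) :
    ∫ q, divAlong X N V q ∂(area X) = 0 := by
  obtain ⟨φ, hφ01, hφc, hφlip, hφ1⟩ := hX.exists_cutoff hcomp
  have hb : ∀ j : ℕ, |∫ q, φ j q * divAlong X N V q ∂(area X)| ≤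
      (j + 1 : ℝ)⁻¹ * ∫ q, ‖V q‖ ∂(area X) := fun j => by
    have := abs_integral_mul_divAlong_le hX hN hV hVint (c := ((j + 1 : ℝ)⁻¹).toNNReal)
      (hφlip j) (hφc j)
    rwa [Real.coe_toNNReal _ (by positivity)] at this
  have h0 : Filter.Tendsto (fun j : ℕ => (j + 1 : ℝ)⁻¹ * ∫ q, ‖V q‖ ∂(area X)) Filter.atTop
      (𝓝 0) := by
    have := (tendsto_one_div_add_atTop_nhds_zero_nat (𝕜 := ℝ)).mul_const (∫ q, ‖V q‖ ∂(area X))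
    simpa using this
  have h1 := squeeze_zero_norm (fun j => (Real.norm_eq_abs _).trans_le (hb j)) h0
  have h2 : Filter.Tendsto (fun j => ∫ q, φ j q * divAlong X N V q ∂(area X)) Filter.atTop
      (𝓝 (∫ q, divAlong X N V q ∂(area X))) := by
    refine tendsto_integral_of_dominated_convergence (fun q => ‖divAlong X N V q‖)
      (fun j => ?_) hdiv.norm (fun j => Filter.Eventually.of_forall fun q => ?_)
      (Filter.Eventually.of_forall fun q => ?_)
    · exact ((continuous_of_edist_le hX.smooth (c := ((j + 1 : ℝ)⁻¹).toNNReal)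
        (hφlip j)).mul (continuous_divAlong hX hN hV)).aestronglyMeasurable
    · rw [norm_mul, Real.norm_of_nonneg (hφ01 j q).1]
      exact mul_le_of_le_one_left (norm_nonneg _) (hφ01 j q).2
    · refine tendsto_const_nhds.congr' ?_
      filter_upwards [hφ1 q] with j hj
      rw [hj, one_mul]
  exact tendsto_nhds_unique h2 h1

end Divergence

/-! ### Gaussian integrability from polynomial area growth. -/

section Growth

open MeasureTheory Set

variable {n : ℕ} {M : Type*} [TopologicalSpace M] [ChartedSpace (Euc n) M] [MeasurableSpace M]
  [BorelSpace M]

theorem summable_pow_mul_exp_shift (k : ℕ) {a : ℝ} (ha : 0 < a) :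
    Summable fun m : ℕ => ((m : ℝ) + 2) ^ k * Real.exp (-a * m) := by
  have h := ((summable_nat_add_iff 2).2 (Real.summable_pow_mul_exp_neg_nat_mul k ha)).mul_left
    (Real.exp (2 * a))
  refine h.congr fun m => ?_
  push_cast
  rw [mul_left_comm, ← Real.exp_add]
  ring_nf

/-- On a hypersurface of polynomial area growth, polynomials are integrable against Gaussian
weights. -/
theorem HasPolynomialAreaGrowth.integrable_pow_mul_exp {X : M → Euc (n + 1)}
    (hg : HasPolynomialAreaGrowth X) (hX : Continuous X) (k : ℕ) {a : ℝ} (ha : 0 < a) :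
    Integrable (fun p => (1 + ‖X p‖) ^ k * Real.exp (-a * ‖X p‖ ^ 2)) (area X) := by
  obtain ⟨C, d, hC⟩ := hg
  set D : ℕ := ⌈d⌉₊ with hD
  have hcont : Continuous fun p => (1 + ‖X p‖) ^ k * Real.exp (-a * ‖X p‖ ^ 2) := by fun_prop
  refine ⟨hcont.aestronglyMeasurable, ?_⟩
  -- The shells m ≤ |X| < m + 1. On each, m ≤ m² bounds the Gaussian by exp(-am), and the area is at
  -- most |C| (m + 2)^D; D = ⌈d⌉₊ and |C| cover negative d and C as well.
  set S : ℕ → Set M := fun m => X ⁻¹' Metric.ball 0 (m + 1) ∩ {p | (m : ℝ) ≤ ‖X p‖} with hS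
  have hcover : (⋃ m, S m) = univ := by
    refine eq_univ_of_forall fun p => mem_iUnion.2 ⟨⌊‖X p‖⌋₊, ?_, Nat.floor_le (norm_nonneg _)⟩
    simpa using Nat.lt_floor_add_one ‖X p‖
  set B : ℕ → ℝ := fun m => |C| * (((m : ℝ) + 2) ^ (k + D) * Real.exp (-a * m)) with hB
  have hBs : Summable B := (summable_pow_mul_exp_shift (k + D) ha).mul_left _
  have hpiece : ∀ m, ∫⁻ p in S m, ‖(1 + ‖X p‖) ^ k * Real.exp (-a * ‖X p‖ ^ 2)‖ₑ ∂(area X) ≤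
      ENNReal.ofReal (B m) := by
    intro m
    have h1 : ∀ p ∈ S m, ‖(1 + ‖X p‖) ^ k * Real.exp (-a * ‖X p‖ ^ 2)‖ₑ ≤
        ENNReal.ofReal (((m : ℝ) + 2) ^ k * Real.exp (-a * m)) := by
      rintro p ⟨hp1, hp2⟩
      have hp1' : ‖X p‖ < m + 1 := by simpa using hp1
      have hp2' : (m : ℝ) ≤ ‖X p‖ := hp2
      rw [Real.enorm_of_nonneg (by positivity)]
      refine ENNReal.ofReal_le_ofReal (mul_le_mul ?_ ?_ (Real.exp_nonneg _) (by positivity))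
      · exact pow_le_pow_left₀ (by positivity) (by linarith) k
      · refine Real.exp_le_exp.2 ?_
        have hm : (m : ℝ) ≤ (m : ℝ) ^ 2 := by exact_mod_cast Nat.le_self_pow two_ne_zero m
        have : (m : ℝ) ^ 2 ≤ ‖X p‖ ^ 2 := pow_le_pow_left₀ (by positivity) hp2' 2
        nlinarith
    have h2 : area X (S m) ≤ ENNReal.ofReal (|C| * ((m : ℝ) + 2) ^ D) := by
      refine (measure_mono inter_subset_left).trans ((hC _ (by simp)).trans ?_)
      refine ENNReal.ofReal_le_ofReal (mul_le_mul (le_abs_self C) ?_ (by positivity)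
        (abs_nonneg C))
      have h3 : ((m : ℝ) + 1) ^ d ≤ ((m : ℝ) + 1) ^ (D : ℝ) :=
        Real.rpow_le_rpow_of_exponent_le (by simp) (Nat.le_ceil d)
      rw [Real.rpow_natCast] at h3
      exact h3.trans (pow_le_pow_left₀ (by positivity) (by linarith) D)
    have hm : MeasurableSet (S m) := (hX.measurable Metric.isOpen_ball.measurableSet).inter
      (measurableSet_le measurable_const hX.norm.measurable)
    calc _ ≤ ∫⁻ p in S m, ENNReal.ofReal (((m : ℝ) + 2) ^ k * Real.exp (-a * m)) ∂(area X) :=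
          setLIntegral_mono' hm h1
      _ ≤ ENNReal.ofReal (((m : ℝ) + 2) ^ k * Real.exp (-a * m)) *
          ENNReal.ofReal (|C| * ((m : ℝ) + 2) ^ D) := by
          rw [setLIntegral_const]; gcongr
      _ = ENNReal.ofReal (B m) := by
          rw [← ENNReal.ofReal_mul (by positivity)]
          congr 1
          rw [hB]
          ring
  calc _ = ∫⁻ p in ⋃ m, S m, ‖(1 + ‖X p‖) ^ k * Real.exp (-a * ‖X p‖ ^ 2)‖ₑ ∂(area X) := by
        rw [hcover, Measure.restrict_univ]
    _ ≤ ∑' m, ∫⁻ p in S m, ‖(1 + ‖X p‖) ^ k * Real.exp (-a * ‖X p‖ ^ 2)‖ₑ ∂(area X) :=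
        lintegral_iUnion_le _ _
    _ ≤ ∑' m, ENNReal.ofReal (B m) := ENNReal.tsum_le_tsum hpiece
    _ < ⊤ := hBs.tsum_ofReal_lt_top

end Growth

/-! ### Differentiation of integrals of smooth families. -/

section SmoothFamilies

open MeasureTheory Set

variable {n : ℕ} {M : Type*} [TopologicalSpace M] [ChartedSpace (Euc n) M]

/-- The family `Φ s` of functions on `M` is jointly smooth near `s = 0`. -/
def IsSmoothFamily (n : ℕ) {M : Type*} [TopologicalSpace M] [ChartedSpace (Euc n) M] {F : Type*} [NormedAddCommGroup F] [NormedSpace ℝ F]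
    (Φ : ℝ → M → F) : Prop :=
  ∀ p, ContDiffAt ℝ ∞ (fun z : ℝ × Euc n => Φ z.1 ((chartAt (Euc n) p).symm z.2))
    (0, chartAt (Euc n) p p)

theorem IsSmoothFamily.exists_local_bound {Φ : ℝ → M → ℝ} (h : IsSmoothFamily n Φ) (p : M) :
    ∃ U ∈ 𝓝 p, ∃ δ > 0, ∃ C : ℝ, ∀ s, |s| < δ → ∀ q ∈ U, ContinuousAt (Φ s) q ∧ |Φ s q| ≤ C ∧
      HasDerivAt (fun r => Φ r q) (deriv (fun r => Φ r q) s) s ∧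
      |deriv (fun r => Φ r q) s| ≤ C := by
  set e := chartAt (Euc n) p with he
  have hp := mem_chart_source (Euc n) p
  set Ψ : ℝ × Euc n → ℝ := fun z => Φ z.1 (e.symm z.2) with hΨ
  have h0 : ContDiffAt ℝ ∞ Ψ (0, e p) := h p
  have h1 : ∀ᶠ z in 𝓝 ((0 : ℝ), e p), ContDiffAt ℝ 1 Ψ z :=
    (h0.of_le (m := 1) (by norm_cast)).eventually (by simp)
  have hc : ContinuousAt (fun z => |fderiv ℝ Ψ z (1, 0)|) ((0 : ℝ), e p) :=
    ((h0.fderiv_right (m := 0) (by norm_cast)).continuousAt.clm_apply continuousAt_const).abs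
  set C := max (|fderiv ℝ Ψ (0, e p) (1, 0)| + 1) (|Ψ (0, e p)| + 1) with hC
  have h2 : ∀ᶠ z in 𝓝 ((0 : ℝ), e p), |fderiv ℝ Ψ z (1, 0)| < C :=
    hc.eventually_lt continuousAt_const ((lt_add_one _).trans_le (le_max_left _ _))
  have h3 : ∀ᶠ z in 𝓝 ((0 : ℝ), e p), |Ψ z| < C :=
    h0.continuousAt.abs.eventually_lt continuousAt_const
      ((lt_add_one _).trans_le (le_max_right _ _))
  obtain ⟨u, hu, v, hv, huv⟩ := mem_nhds_prod_iff.1 ((h1.and h2).and h3)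
  obtain ⟨δ, hδ, hδu⟩ := Metric.mem_nhds_iff.1 hu
  refine ⟨e.source ∩ e ⁻¹' v, Filter.inter_mem (chart_source_mem_nhds _ p)
    ((e.continuousAt hp).preimage_mem_nhds hv), δ, hδ, C, fun s hs q hq => ?_⟩
  have hz : ((s, e q) : ℝ × Euc n) ∈ u ×ˢ v := ⟨hδu (by simpa using hs), hq.2⟩
  obtain ⟨⟨hz1, hz2⟩, hz3⟩ := huv hz
  have hqe : ∀ r, Ψ (r, e q) = Φ r q := fun r => by simp [hΨ, e.left_inv hq.1]
  have hd : HasDerivAt (fun r => Φ r q) (fderiv ℝ Ψ (s, e q) (1, 0)) s := by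
    have h4 : HasDerivAt (fun r : ℝ => (r, e q)) ((1 : ℝ), (0 : Euc n)) s :=
      (hasDerivAt_id s).prodMk (hasDerivAt_const s _)
    have h5 := (hz1.differentiableAt one_ne_zero).hasFDerivAt.comp_hasDerivAt s h4
    exact h5.congr_of_eventuallyEq (Filter.Eventually.of_forall fun r => (hqe r).symm)
  refine ⟨?_, ?_, hd.differentiableAt.hasDerivAt, ?_⟩
  · have h4 : ContinuousAt (fun w => Ψ (s, e w)) q :=
      ContinuousAt.comp (f := fun w => (s, e w)) (g := Ψ) hz1.continuousAt
        (continuousAt_const.prodMk (e.continuousAt hq.1))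
    refine h4.congr ?_
    filter_upwards [e.open_source.mem_nhds hq.1] with w hw
    simp [hΨ, e.left_inv hw]
  · rw [← hqe]; exact hz3.le
  · rw [hd.deriv]; exact hz2.le

theorem IsSmoothFamily.continuous_deriv_zero {Φ : ℝ → M → ℝ} (h : IsSmoothFamily n Φ) :
    Continuous fun q => deriv (fun r => Φ r q) 0 := by
  refine continuous_iff_continuousAt.2 fun p => ?_
  set e := chartAt (Euc n) p with he
  have hp := mem_chart_source (Euc n) p
  set Ψ : ℝ × Euc n → ℝ := fun z => Φ z.1 (e.symm z.2) with hΨ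
  have h0 : ContDiffAt ℝ ∞ Ψ (0, e p) := h p
  have h1 : ∀ᶠ z in 𝓝 ((0 : ℝ), e p), ContDiffAt ℝ 1 Ψ z :=
    (h0.of_le (m := 1) (by norm_cast)).eventually (by simp)
  have hc : ContinuousAt (fun z => fderiv ℝ Ψ z (1, 0)) ((0 : ℝ), e p) :=
    (h0.fderiv_right (m := 0) (by norm_cast)).continuousAt.clm_apply continuousAt_const
  have hin : ContinuousAt (fun q => ((0 : ℝ), e q)) p :=
    continuousAt_const.prodMk (e.continuousAt hp)
  refine (ContinuousAt.comp (f := fun q => ((0 : ℝ), e q)) hc hin).congr ?_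
  filter_upwards [e.open_source.mem_nhds hp, hin.eventually h1] with q hq hq1
  have h4 : HasDerivAt (fun r : ℝ => (r, e q)) ((1 : ℝ), (0 : Euc n)) 0 :=
    (hasDerivAt_id _).prodMk (hasDerivAt_const _ _)
  have h5 := (hq1.differentiableAt one_ne_zero).hasFDerivAt.comp_hasDerivAt 0 h4
  refine (HasDerivAt.deriv (h5.congr_of_eventuallyEq
    (Filter.Eventually.of_forall fun r => ?_))).symm
  simp [hΨ, e.left_inv hq]

/-- Smoothness at s = 0 gives a time interval and a bound that depend on the point; compactness
makes both uniform. -/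
theorem IsSmoothFamily.exists_bound {Φ : ℝ → M → ℝ} (h : IsSmoothFamily n Φ) {K : Set M}
    (hK : IsCompact K) :
    ∃ δ > 0, ∃ C : ℝ, ∀ s, |s| < δ → ∀ q ∈ K, ContinuousAt (Φ s) q ∧ |Φ s q| ≤ C ∧
      HasDerivAt (fun r => Φ r q) (deriv (fun r => Φ r q) s) s ∧
      |deriv (fun r => Φ r q) s| ≤ C := by
  refine hK.induction_on (p := fun K => ∃ δ > 0, ∃ C : ℝ, ∀ s, |s| < δ → ∀ q ∈ K,
    ContinuousAt (Φ s) q ∧ |Φ s q| ≤ C ∧ HasDerivAt (fun r => Φ r q) (deriv (fun r => Φ r q) s) s ∧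
      |deriv (fun r => Φ r q) s| ≤ C) ?_ ?_ ?_ ?_
  · exact ⟨1, one_pos, 0, fun _ _ _ hq => hq.elim⟩
  · rintro s t hst ⟨δ, hδ, C, hC⟩
    exact ⟨δ, hδ, C, fun r hr q hq => hC r hr q (hst hq)⟩
  · rintro s t ⟨δ, hδ, C, hC⟩ ⟨δ', hδ', C', hC'⟩
    refine ⟨min δ δ', lt_min hδ hδ', max C C', fun r hr q hq => ?_⟩
    rcases hq with hq | hq
    · obtain ⟨h1, h2, h3, h4⟩ := hC r (hr.trans_le (min_le_left _ _)) q hq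
      exact ⟨h1, h2.trans (le_max_left _ _), h3, h4.trans (le_max_left _ _)⟩
    · obtain ⟨h1, h2, h3, h4⟩ := hC' r (hr.trans_le (min_le_right _ _)) q hq
      exact ⟨h1, h2.trans (le_max_right _ _), h3, h4.trans (le_max_right _ _)⟩
  · intro p _
    obtain ⟨U, hU, hδ⟩ := h.exists_local_bound p
    exact ⟨U, mem_nhdsWithin_of_mem_nhds hU, hδ⟩

/-- Differentiation under the integral sign for a smooth family that vanishes outside of a
compact set. -/
theorem IsSmoothFamily.hasDerivAt_integral [T2Space M] [MeasurableSpace M] [BorelSpace M]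
    {μ : Measure M} [IsLocallyFiniteMeasure μ] {Φ : ℝ → M → ℝ} (h : IsSmoothFamily n Φ) {K : Set M}
    (hK : IsCompact K) (hΦK : ∀ᶠ s in 𝓝 0, ∀ p ∉ K, Φ s p = 0) :
    (∀ᶠ s in 𝓝 0, Integrable (Φ s) μ) ∧
      Integrable (fun p => deriv (fun r => Φ r p) 0) μ ∧
      HasDerivAt (fun s => ∫ p, Φ s p ∂μ) (∫ p, deriv (fun r => Φ r p) 0 ∂μ) 0 := by
  obtain ⟨δ, hδ, C, hC⟩ := h.exists_bound hK
  have hKm := hK.isClosed.measurableSet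
  have hball : ∀ᶠ s : ℝ in 𝓝 0, |s| < δ := by
    filter_upwards [Metric.ball_mem_nhds (0 : ℝ) hδ] with s hs
    simpa using hs
  have hfin : IsFiniteMeasure (μ.restrict K) := ⟨by
    rw [Measure.restrict_apply_univ]; exact hK.measure_lt_top⟩
  have hmeas : ∀ s, |s| < δ → AEStronglyMeasurable (Φ s) (μ.restrict K) := fun s hs =>
    ContinuousOn.aestronglyMeasurable_of_isCompact
      (fun q hq => (hC s hs q hq).1.continuousWithinAt) hK hKm
  have hintK : ∀ s, |s| < δ → Integrable (Φ s) (μ.restrict K) := fun s hs =>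
    Integrable.of_bound (hmeas s hs) C ((ae_restrict_iff' hKm).2
      (Filter.Eventually.of_forall fun q hq => (hC s hs q hq).2.1))
  have hmain := hasDerivAt_integral_of_dominated_loc_of_deriv_le (𝕜 := ℝ) (μ := μ.restrict K)
    (F := Φ) (F' := fun s p => deriv (fun r => Φ r p) s) (x₀ := 0) (bound := fun _ => C)
    (Metric.ball_mem_nhds (0 : ℝ) hδ) (hball.mono hmeas) (hintK 0 (by simpa using hδ))
    h.continuous_deriv_zero.aestronglyMeasurable
    ((ae_restrict_iff' hKm).2 (Filter.Eventually.of_forall fun q hq s hs =>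
      (hC s (by simpa using hs) q hq).2.2.2)) (integrable_const C)
    ((ae_restrict_iff' hKm).2 (Filter.Eventually.of_forall fun q hq s hs =>
      (hC s (by simpa using hs) q hq).2.2.1))
  have hzero : ∀ p ∉ K, deriv (fun r => Φ r p) 0 = 0 := fun p hp => by
    have : (fun r => Φ r p) =ᶠ[𝓝 0] fun _ => 0 := hΦK.mono fun s hs => hs p hp
    rw [this.deriv_eq, deriv_const]
  refine ⟨?_, ?_, ?_⟩
  · filter_upwards [hball, hΦK] with s hs hs'
    exact (integrableOn_iff_integrable_of_support_subset
      (fun p hp => by_contra fun hpK => hp (hs' p hpK))).1 (hintK s hs)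
  · exact (integrableOn_iff_integrable_of_support_subset
      (fun p hp => by_contra fun hpK => hp (hzero p hpK))).1 hmain.1
  · rw [← setIntegral_eq_integral_of_forall_compl_eq_zero hzero]
    refine hmain.2.congr_of_eventuallyEq ?_
    filter_upwards [hΦK] with s hs
    exact (setIntegral_eq_integral_of_forall_compl_eq_zero hs).symm

end SmoothFamilies

/-! ### First variation of the area element. -/

section Variations

open MeasureTheory Set

/-- Mixed partial derivatives commute: the s-derivative of the spatial differential is the spatial
differential of the variation field. -/
theorem hasDerivAt_fderiv_of_contDiffAt {E F : Type*} [NormedAddCommGroup E] [NormedSpace ℝ E]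
    [NormedAddCommGroup F] [NormedSpace ℝ F] {Ψ : ℝ × E → F} {u : E}
    (h : ContDiffAt ℝ ∞ Ψ (0, u)) {V : E → F}
    (hV : ∀ᶠ w in 𝓝 u, HasDerivAt (fun s => Ψ (s, w)) (V w) 0) :
    DifferentiableAt ℝ V u ∧
      HasDerivAt (fun s => fderiv ℝ (fun w => Ψ (s, w)) u) (fderiv ℝ V u) 0 := by
  have h1 : ∀ᶠ z in 𝓝 ((0 : ℝ), u), DifferentiableAt ℝ Ψ z :=
    ((h.of_le (m := 1) (by norm_cast)).eventually (by simp)).mono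
      fun z hz => hz.differentiableAt one_ne_zero
  have h2 : HasFDerivAt (fderiv ℝ Ψ) (fderiv ℝ (fderiv ℝ Ψ) (0, u)) (0, u) :=
    ((h.fderiv_right (m := 1) (by norm_cast)).differentiableAt one_ne_zero).hasFDerivAt
  have hsymm : IsSymmSndFDerivAt ℝ Ψ (0, u) := h.isSymmSndFDerivAt (by
    rw [minSmoothness_of_isRCLikeNormedField]
    exact WithTop.coe_le_coe.2 (le_top : (2 : ℕ∞) ≤ ⊤))
  have hVeq : V =ᶠ[𝓝 u] fun w => fderiv ℝ Ψ (0, w) (1, 0) := by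
    have hin : Filter.Tendsto (fun w : E => ((0 : ℝ), w)) (𝓝 u) (𝓝 (0, u)) :=
      (Continuous.prodMk_right (0 : ℝ)).tendsto u
    filter_upwards [hV, hin.eventually h1] with w hw hw1
    have h4 : HasDerivAt (fun r : ℝ => (r, w)) ((1 : ℝ), (0 : E)) 0 :=
      (hasDerivAt_id _).prodMk (hasDerivAt_const _ _)
    exact hw.unique (hw1.hasFDerivAt.comp_hasDerivAt 0 h4)
  have hVd : HasFDerivAt (fun w => fderiv ℝ Ψ (0, w) (1, 0))
      (((fderiv ℝ (fderiv ℝ Ψ) (0, u)).comp (ContinuousLinearMap.inr ℝ ℝ E)).flip (1, 0)) u := by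
    have h5 : HasFDerivAt (fun w : E => ((0 : ℝ), w)) (ContinuousLinearMap.inr ℝ ℝ E) u :=
      hasFDerivAt_prodMk_right 0 u
    have h6 := (h2.comp u h5).clm_apply (hasFDerivAt_const ((1 : ℝ), (0 : E)) u)
    refine h6.congr_fderiv ?_
    ext v
    simp
  have hVd' := hVd.congr_of_eventuallyEq hVeq
  refine ⟨hVd'.differentiableAt, ?_⟩
  have h4 : HasDerivAt (fun r : ℝ => (r, u)) ((1 : ℝ), (0 : E)) 0 :=
    (hasDerivAt_id _).prodMk (hasDerivAt_const _ _)
  have h7 := h2.comp_hasDerivAt 0 h4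
  have h8 := h7.clm_comp (hasDerivAt_const 0 (ContinuousLinearMap.inr ℝ ℝ E))
  have hin : Filter.Tendsto (fun r : ℝ => (r, u)) (𝓝 0) (𝓝 (0, u)) :=
    (Continuous.prodMk_left u).tendsto 0
  refine (h8.congr_of_eventuallyEq ?_).congr_deriv ?_
  · filter_upwards [hin.eventually h1] with r hr
    have h5 : HasFDerivAt (fun w : E => (r, w)) (ContinuousLinearMap.inr ℝ ℝ E) u :=
      hasFDerivAt_prodMk_right r u
    exact (hr.hasFDerivAt.comp u h5).fderiv
  · rw [hVd'.fderiv]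
    ext v
    simp [hsymm.eq (1, 0) (0, v)]

/-- In d(fν) = df ν + f dν the first term is normal and is projected away. The function f is not
assumed differentiable; near u it equals ⟨V, ν⟩, which is differentiable at u. -/
theorem leftInv_comp_fderiv_normal {n : ℕ} {A : Euc n →L[ℝ] Euc (n + 1)}
    {ν V : Euc n → Euc (n + 1)} {f : Euc n → ℝ} {u : Euc n} (hA : IsFrame A (ν u))
    (hν : DifferentiableAt ℝ ν u) (hν1 : ∀ᶠ w in 𝓝 u, ‖ν w‖ = 1) (hV : DifferentiableAt ℝ V u)
    (hVf : ∀ᶠ w in 𝓝 u, V w = f w • ν w) :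
    (leftInv A (ν u)).comp (fderiv ℝ V u) = f u • (leftInv A (ν u)).comp (fderiv ℝ ν u) := by
  set g : Euc n → ℝ := fun w => ⟪V w, ν w⟫ with hg
  have hgd : DifferentiableAt ℝ g u := hV.inner ℝ hν
  have hgf : ∀ᶠ w in 𝓝 u, g w = f w := by
    filter_upwards [hν1, hVf] with w h1 h2
    simp [hg, h2, real_inner_smul_left, h1]
  have hVg : V =ᶠ[𝓝 u] fun w => g w • ν w := by
    filter_upwards [hgf, hVf] with w h1 h2
    rw [h2, h1]
  rw [hVg.fderiv_eq, fderiv_fun_smul hgd hν, hgf.self_of_nhds]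
  ext1 v
  simp [hA.leftInv_normal]

variable {n : ℕ} {M : Type*} [TopologicalSpace M] [ChartedSpace (Euc n) M]
  {X N : M → Euc (n + 1)} {ε : ℝ} {Y : ℝ → M → Euc (n + 1)}

theorem IsNormalVariation.contMDiff (hY : IsNormalVariation X N ε Y) {s : ℝ}
    (hs : s ∈ Ioo (-ε) ε) : ContMDiff (𝓡 n) 𝓘(ℝ, Euc (n + 1)) ∞ (Y s) := by
  have h : ContMDiff (𝓡 n) (𝓘(ℝ, ℝ).prod (𝓡 n)) ∞ (fun p : M => (s, p)) :=
    contMDiff_const.prodMk contMDiff_id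
  exact fun p => (hY.smooth.contMDiffAt ((isOpen_Ioo.prod isOpen_univ).mem_nhds
    ⟨hs, mem_univ p⟩)).comp p (h p)

variable [IsManifold (𝓡 n) ∞ M]

theorem IsNormalVariation.contDiffAt_chart (hY : IsNormalVariation X N ε Y) (hε : 0 < ε)
    (p : M) {u : Euc n} (hu : u ∈ (chartAt (Euc n) p).target) :
    ContDiffAt ℝ ∞ (fun z : ℝ × Euc n => Y z.1 ((chartAt (Euc n) p).symm z.2)) (0, u) := by
  set e := chartAt (Euc n) p with he
  have h1 : ContMDiffAt 𝓘(ℝ, ℝ × Euc n) (𝓘(ℝ, ℝ).prod (𝓡 n)) ∞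
      (fun z : ℝ × Euc n => (z.1, e.symm z.2)) (0, u) :=
    contDiffAt_fst.contMDiffAt.prodMk (((contMDiffOn_chart_symm (I := 𝓡 n) (x := p)).contMDiffAt
      (e.open_target.mem_nhds hu)).comp (0, u) contDiffAt_snd.contMDiffAt)
  exact contMDiffAt_iff_contDiffAt.1 ((hY.smooth.contMDiffAt ((isOpen_Ioo.prod isOpen_univ).mem_nhds
    ⟨⟨neg_lt_zero.2 hε, hε⟩, mem_univ (e.symm u)⟩)).comp ((0 : ℝ), u) h1)

theorem IsNormalVariation.isSmoothFamily (hY : IsNormalVariation X N ε Y) (hε : 0 < ε) :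
    IsSmoothFamily n Y := fun p =>
  hY.contDiffAt_chart hε p ((chartAt (Euc n) p).map_source (mem_chart_source _ p))

/-- The square root is smooth where the Gram determinant is positive. This is known at s = 0, where
Y is the immersion X, and that is all a smooth family requires. -/
theorem IsNormalVariation.isSmoothFamily_areaRatio (hX : IsSmoothImmersion X)
    (hY : IsNormalVariation X N ε Y) (hε : 0 < ε) :
    IsSmoothFamily n fun s => areaRatio X (Y s) := by
  intro p
  set e := chartAt (Euc n) p with he
  have hp := e.map_source (mem_chart_source (Euc n) p)
  have hYX : (fun w => Y 0 (e.symm w)) = X ∘ e.symm := funext fun w => hY.initial _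
  have h1 : ContDiffAt ℝ ∞ (fun z : ℝ × Euc n => fderiv ℝ (fun w => Y z.1 (e.symm w)) z.2)
      (0, e p) := by
    refine ContDiffAt.fderiv (f := fun (z : ℝ × Euc n) w => Y z.1 (e.symm w)) (n := ∞)
      (g := fun z => z.2) ?_ contDiffAt_snd (by simp)
    have h2 : ContDiffAt ℝ ∞ (fun y : (ℝ × Euc n) × Euc n => (y.1.1, y.2)) ((0, e p), e p) :=
      contDiffAt_fst.fst.prodMk contDiffAt_snd
    exact (hY.contDiffAt_chart hε p hp).comp ((0, e p), e p) h2
  have hpos : 0 < (gramOf (fderiv ℝ (fun w => Y 0 (e.symm w)) (e p))).det := by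
    rw [hYX]; exact det_gramOf_pos (hX.fderiv_chart_injective p hp)
  have h3 : ContDiffAt ℝ ∞ (fun z : ℝ × Euc n => chartDensity (Y z.1) p z.2) (0, e p) :=
    (contDiff_det_gramOf.contDiffAt.comp (0, e p) h1).sqrt hpos.ne'
  have h4 : ContDiffAt ℝ ∞ (fun z : ℝ × Euc n => chartDensity X p z.2) (0, e p) := by
    have h5 : ContDiffAt ℝ ∞ (chartDensity X p) (e p) :=
      (contDiff_det_gramOf.contDiffAt.comp (e p)
        (contDiffAt_fderiv_comp_chart_symm hX.smooth p hp)).sqrt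
        (det_gramOf_pos (hX.fderiv_chart_injective p hp)).ne'
    exact ContDiffAt.comp (g := chartDensity X p) (0, e p) h5 contDiffAt_snd
  refine (h3.div h4 (hX.chartDensity_pos p hp).ne').congr_of_eventuallyEq ?_
  filter_upwards [(isOpen_Ioo.prod e.open_target).mem_nhds
    (⟨⟨neg_lt_zero.2 hε, hε⟩, hp⟩ : ((0 : ℝ), e p) ∈ Ioo (-ε) ε ×ˢ e.target)] with z hz
  exact areaRatio_chart_symm hX.smooth (hY.contMDiff hz.1) p hz.2

/-- By Jacobi's formula the logarithmic derivative of the density is the tangential trace of d(fN),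
which is f times that of dN, that is, -fH. -/
theorem IsNormalVariation.hasDerivAt_areaRatio (hX : IsSmoothImmersion X) (hN : IsUnitNormal X N)
    (hY : IsNormalVariation X N ε Y) (hε : 0 < ε) {f : M → ℝ}
    (hf : ∀ p, HasDerivAt (fun s => Y s p) (f p • N p) 0) (p : M) :
    HasDerivAt (fun s => areaRatio X (Y s) p) (-(f p * meanCurvature X N p)) 0 := by
  set e := chartAt (Euc n) p with he
  have hp := e.map_source (mem_chart_source (Euc n) p)
  have hYX : (fun w => Y 0 (e.symm w)) = X ∘ e.symm := funext fun w => hY.initial _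
  have hXd : diff X p = fderiv ℝ (X ∘ e.symm) (e p) := diff_eq_fderiv hX.smooth p
  obtain ⟨hV, hA⟩ := hasDerivAt_fderiv_of_contDiffAt (hY.contDiffAt_chart hε p hp)
    (V := fun w => f (e.symm w) • N (e.symm w)) (Filter.Eventually.of_forall fun w => hf (e.symm w))
  have hfr : IsFrame (fderiv ℝ (fun w => Y 0 (e.symm w)) (e p)) (N p) := by
    rw [hYX, ← hXd]; exact hN.isFrame hX p
  have hp0 : e.symm (e p) = p := e.left_inv (mem_chart_source (Euc n) p)
  have htr := leftInv_comp_fderiv_normal (ν := N ∘ e.symm) (f := f ∘ e.symm)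
    (u := e p) (V := fun w => f (e.symm w) • N (e.symm w)) (A := diff X p)
    (by simpa [hp0] using hN.isFrame hX p)
    (((contDiffOn_comp_chart_symm hN.smooth p).contDiffAt
      (e.open_target.mem_nhds hp)).differentiableAt (by simp))
    (Filter.Eventually.of_forall fun w => hN.unit _) hV (Filter.Eventually.of_forall fun w => rfl)
  simp only [Function.comp_apply, hp0] at htr
  have hpos : 0 < Real.sqrt (gramOf (diff X p)).det :=
    Real.sqrt_pos.2 (det_gramOf_pos (hX.injective p))
  have h1 := (hfr.hasDerivAt_sqrt_det_gramOf hA).div_const (Real.sqrt (gramOf (diff X p)).det)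
  refine (h1.congr_of_eventuallyEq ?_).congr_deriv ?_
  · filter_upwards [isOpen_Ioo.mem_nhds (⟨neg_lt_zero.2 hε, hε⟩ : (0 : ℝ) ∈ Ioo (-ε) ε)] with s hs
    rw [areaRatio, diff_eq_fderiv (hY.contMDiff hs)]
    rfl
  · rw [hYX, ← hXd, htr, endTrace_smul, meanCurvature_eq hX hN, diff_eq_fderiv hN.smooth p,
      mul_div_cancel_left₀ _ hpos.ne']
    simp [Function.comp_def, ← he]

end Variations

/-! ### The two integrals of the functional along a variation. -/

section FirstVariation

open MeasureTheory Set

theorem hasDerivAt_exp_neg_norm_sq {E : Type*} [NormedAddCommGroup E] [InnerProductSpace ℝ E]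
    {y : ℝ → E} {y' : E} {t : ℝ → ℝ} {t' s : ℝ} (hy : HasDerivAt y y' s) (ht : HasDerivAt t t' s)
    (hts : t s ≠ 0) :
    HasDerivAt (fun r => Real.exp (-‖y r‖ ^ 2 / (2 * t r)))
      (Real.exp (-‖y s‖ ^ 2 / (2 * t s)) *
        (-(⟪y s, y'⟫ / t s) + ‖y s‖ ^ 2 * t' / (2 * t s ^ 2))) s := by
  refine ((hy.norm_sq.neg.div (ht.const_mul 2) (by simpa using hts)).exp).congr_deriv ?_
  simp only [Pi.neg_apply, Pi.div_apply]
  field_simp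
  ring

variable {n : ℕ} {M : Type*} [TopologicalSpace M] [ChartedSpace (Euc n) M]

theorem IsSmoothFamily.mul {Φ Ψ : ℝ → M → ℝ} (hΦ : IsSmoothFamily n Φ) (hΨ : IsSmoothFamily n Ψ) :
    IsSmoothFamily n fun s p => Φ s p * Ψ s p := fun p => (hΦ p).mul (hΨ p)

theorem IsSmoothFamily.sub {Φ Ψ : ℝ → M → ℝ} (hΦ : IsSmoothFamily n Φ) (hΨ : IsSmoothFamily n Ψ) :
    IsSmoothFamily n fun s p => Φ s p - Ψ s p := fun p => (hΦ p).sub (hΨ p)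

theorem IsSmoothFamily.areaIntegrand {Y : ℝ → M → Euc (n + 1)} (hY : IsSmoothFamily n Y)
    {x : ℝ → Euc (n + 1)} {t : ℝ → ℝ} (hx : ContDiffAt ℝ ∞ x 0) (ht : ContDiffAt ℝ ∞ t 0)
    (ht0 : t 0 ≠ 0) : IsSmoothFamily n fun s => areaIntegrand (Y s) (x s) (t s) := fun p => by
  have h1 : ContDiffAt ℝ ∞ (fun z : ℝ × Euc n => x z.1) (0, chartAt (Euc n) p p) :=
    ContDiffAt.comp (g := x) (0, chartAt (Euc n) p p) hx contDiffAt_fst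
  have h2 : ContDiffAt ℝ ∞ (fun z : ℝ × Euc n => t z.1) (0, chartAt (Euc n) p p) :=
    ContDiffAt.comp (g := t) (0, chartAt (Euc n) p p) ht contDiffAt_fst
  exact ((((hY p).sub h1).norm_sq ℝ).neg.div (contDiffAt_const.mul h2) (by simpa using ht0)).exp

theorem IsSmoothImmersion.areaRatio_self {X : M → Euc (n + 1)} (hX : IsSmoothImmersion X) (p : M) :
    areaRatio X X p = 1 :=
  div_self (Real.sqrt_pos.2 (det_gramOf_pos (hX.injective p))).ne'

variable [IsManifold (𝓡 n) ∞ M]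

theorem isSmoothFamily_const {F : Type*} [NormedAddCommGroup F] [NormedSpace ℝ F] {V : M → F}
    (hV : ContMDiff (𝓡 n) 𝓘(ℝ, F) ∞ V) : IsSmoothFamily n fun _ => V := fun p =>
  ContDiffAt.comp (g := V ∘ (chartAt (Euc n) p).symm) (0, chartAt (Euc n) p p)
    ((contDiffOn_comp_chart_symm hV p).contDiffAt ((chartAt (Euc n) p).open_target.mem_nhds
      ((chartAt (Euc n) p).map_source (mem_chart_source _ p)))) contDiffAt_snd

theorem IsSmoothFamily.volumeIntegrand {X N : M → Euc (n + 1)}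
    (hX : ContMDiff (𝓡 n) 𝓘(ℝ, Euc (n + 1)) ∞ X) (hN : ContMDiff (𝓡 n) 𝓘(ℝ, Euc (n + 1)) ∞ N)
    (X₀ : Euc (n + 1)) {t₀ : ℝ} (ht₀ : t₀ ≠ 0) {Y : ℝ → M → Euc (n + 1)} (hY : IsSmoothFamily n Y)
    {x : ℝ → Euc (n + 1)} (hx : ContDiffAt ℝ ∞ x 0) :
    IsSmoothFamily n fun s => volumeIntegrand X N X₀ t₀ (Y s) (x s) := fun p => by
  have h1 : ContDiffAt ℝ ∞ (fun z : ℝ × Euc n => x z.1) (0, chartAt (Euc n) p p) :=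
    ContDiffAt.comp (g := x) (0, chartAt (Euc n) p p) hx contDiffAt_fst
  exact (((hY p).sub h1).inner ℝ (isSmoothFamily_const hN p)).mul
    ((isSmoothFamily_const hX).areaIntegrand (x := fun _ => X₀) (t := fun _ => t₀)
      contDiffAt_const contDiffAt_const ht₀ p)

variable [SecondCountableTopology M] [MeasurableSpace M] [BorelSpace M]

theorem IsSmoothImmersion.integral_area {X Y : M → Euc (n + 1)} (hX : IsSmoothImmersion X)
    (hY : ContMDiff (𝓡 n) 𝓘(ℝ, Euc (n + 1)) ∞ Y) (φ : M → ℝ) :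
    ∫ p, φ p ∂(area Y) = ∫ p, φ p * areaRatio X Y p ∂(area X) := by
  rw [hX.area_eq_withDensity hY, integral_withDensity_eq_integral_toReal_smul
    (hX.continuous_areaRatio hY).measurable.ennreal_ofReal (by simp)]
  refine integral_congr_ae (Filter.Eventually.of_forall fun p => ?_)
  simp [ENNReal.toReal_ofReal (areaRatio_nonneg X Y p), mul_comm]

theorem IsSmoothImmersion.integrable_area_iff {X Y : M → Euc (n + 1)} (hX : IsSmoothImmersion X)
    (hY : ContMDiff (𝓡 n) 𝓘(ℝ, Euc (n + 1)) ∞ Y) (φ : M → ℝ) :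
    Integrable φ (area Y) ↔ Integrable (fun p => φ p * areaRatio X Y p) (area X) := by
  rw [hX.area_eq_withDensity hY, integrable_withDensity_iff_integrable_smul'
    (hX.continuous_areaRatio hY).measurable.ennreal_ofReal (by simp)]
  refine integrable_congr (Filter.Eventually.of_forall fun p => ?_)
  simp [ENNReal.toReal_ofReal (areaRatio_nonneg X Y p), mul_comm]

variable [T2Space M] {X N : M → Euc (n + 1)} {ε : ℝ} {Y : ℝ → M → Euc (n + 1)} {x : ℝ → Euc (n + 1)}
  {t : ℝ → ℝ} {f : M → ℝ}

theorem IsNormalVariation.hasDerivAt_integral_areaIntegrand (hX : IsSmoothImmersion X)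
    (hN : IsUnitNormal X N) (hY : IsNormalVariation X N ε Y) (hε : 0 < ε)
    (hf : ∀ p, HasDerivAt (fun s => Y s p) (f p • N p) 0)
    (hx : ContDiffAt ℝ ∞ x 0) (ht : ContDiffAt ℝ ∞ t 0) (ht0 : t 0 ≠ 0) {a : ℝ}
    (hA : ∀ᶠ s in 𝓝 0, Integrable (areaIntegrand X (x s) (t s)) (area X))
    (ha : HasDerivAt (fun s => ∫ p, areaIntegrand X (x s) (t s) p ∂(area X)) a 0) :
    (∀ᶠ s in 𝓝 0, Integrable (areaIntegrand (Y s) (x s) (t s)) (area (Y s))) ∧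
    Integrable (fun p => -(f p * (meanCurvature X N p + ⟪(1 / t 0) • (X p - x 0), N p⟫) *
      areaIntegrand X (x 0) (t 0) p)) (area X) ∧
    HasDerivAt (fun s => ∫ p, areaIntegrand (Y s) (x s) (t s) p ∂(area (Y s)))
      (a + ∫ p, -(f p * (meanCurvature X N p + ⟪(1 / t 0) • (X p - x 0), N p⟫) *
        areaIntegrand X (x 0) (t 0) p) ∂(area X)) 0 := by
  -- Both terms use the same moving centre and scale, so D vanishes off the compact set K and may be
  -- differentiated under the integral with no growth assumption. At s = 0 the contributions of x'
  -- and t' cancel; those are carried by a.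
  set D : ℝ → M → ℝ := fun s p => areaIntegrand (Y s) (x s) (t s) p * areaRatio X (Y s) p -
    areaIntegrand X (x s) (t s) p with hD
  have hDs : IsSmoothFamily n D :=
    (((hY.isSmoothFamily hε).areaIntegrand hx ht ht0).mul
      (IsNormalVariation.isSmoothFamily_areaRatio hX hY hε)).sub
      ((isSmoothFamily_const hX.smooth).areaIntegrand hx ht ht0)
  have hIoo : ∀ᶠ s in 𝓝 (0 : ℝ), s ∈ Ioo (-ε) ε := isOpen_Ioo.mem_nhds ⟨neg_lt_zero.2 hε, hε⟩
  obtain ⟨K, hK, hKY⟩ := hY.compact_support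
  have hDK : ∀ᶠ s in 𝓝 0, ∀ p ∉ K, D s p = 0 := by
    filter_upwards [hIoo] with s hs p hp
    have h1 : Y s =ᶠ[𝓝 p] X := by
      filter_upwards [hK.isClosed.isOpen_compl.mem_nhds hp] with q hq using hKY s hs q hq
    have h2 : areaRatio X (Y s) p = 1 := by
      rw [← hX.areaRatio_self p, areaRatio, areaRatio, diff_congr h1]
    simp [hD, h2, areaIntegrand, h1.self_of_nhds]
  have hDd : ∀ p, deriv (fun r => D r p) 0 =
      -(f p * (meanCurvature X N p + ⟪(1 / t 0) • (X p - x 0), N p⟫) *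
        areaIntegrand X (x 0) (t 0) p) := fun p => by
    have hx' := (hx.differentiableAt (by simp)).hasDerivAt
    have ht' := (ht.differentiableAt (by simp)).hasDerivAt
    have h1 := hasDerivAt_exp_neg_norm_sq ((hf p).sub hx') ht' ht0
    have h2 := hasDerivAt_exp_neg_norm_sq ((hasDerivAt_const (0 : ℝ) (X p)).sub hx') ht' ht0
    have h3 := (h1.mul (hY.hasDerivAt_areaRatio hX hN hε hf p)).sub h2
    refine HasDerivAt.deriv (h3.congr_deriv ?_)
    have hY0 : Y 0 = X := funext hY.initial
    simp only [Pi.sub_apply, hY0, hX.areaRatio_self, areaIntegrand, inner_sub_right,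
      real_inner_smul_right, real_inner_smul_left, inner_zero_right]
    field_simp
    ring
  have := isLocallyFiniteMeasure_area hX.smooth
  obtain ⟨h1, h2, h3⟩ := hDs.hasDerivAt_integral (μ := area X) hK hDK
  simp only [hDd] at h2 h3
  refine ⟨?_, h2, (ha.add h3).congr_of_eventuallyEq ?_⟩
  · filter_upwards [h1, hA, hIoo] with s hs1 hs2 hs
    rw [hX.integrable_area_iff (hY.contMDiff hs)]
    refine (hs1.add hs2).congr (Filter.Eventually.of_forall fun p => ?_)
    simp [hD]
  · filter_upwards [h1, hA, hIoo] with s hs1 hs2 hs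
    rw [hX.integral_area (hY.contMDiff hs), Pi.add_apply, ← integral_add hs2 hs1]
    refine integral_congr_ae (Filter.Eventually.of_forall fun p => ?_)
    simp [hD]

/-- The integrands for Y and X differ by ⟨Y s - X, N⟩ times a fixed Gaussian. The moving centre
drops out, and the derivative is f times that Gaussian since N is a unit field. -/
theorem IsNormalVariation.hasDerivAt_integral_volumeIntegrand (hX : IsSmoothImmersion X)
    (hN : IsUnitNormal X N) (hY : IsNormalVariation X N ε Y) (hε : 0 < ε)
    (hf : ∀ p, HasDerivAt (fun s => Y s p) (f p • N p) 0)
    (hx : ContDiffAt ℝ ∞ x 0) (X₀ : Euc (n + 1)) {t₀ : ℝ} (ht₀ : t₀ ≠ 0) {b : ℝ}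
    (hB : ∀ᶠ s in 𝓝 0, Integrable (volumeIntegrand X N X₀ t₀ X (x s)) (area X))
    (hb : HasDerivAt (fun s => ∫ p, volumeIntegrand X N X₀ t₀ X (x s) p ∂(area X)) b 0) :
    (∀ᶠ s in 𝓝 0, Integrable (volumeIntegrand X N X₀ t₀ (Y s) (x s)) (area X)) ∧
    Integrable (fun p => f p * areaIntegrand X X₀ t₀ p) (area X) ∧
    HasDerivAt (fun s => ∫ p, volumeIntegrand X N X₀ t₀ (Y s) (x s) p ∂(area X))
      (b + ∫ p, f p * areaIntegrand X X₀ t₀ p ∂(area X)) 0 := by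
  set D : ℝ → M → ℝ := fun s p => volumeIntegrand X N X₀ t₀ (Y s) (x s) p -
    volumeIntegrand X N X₀ t₀ X (x s) p with hD
  have hDs : IsSmoothFamily n D :=
    (IsSmoothFamily.volumeIntegrand hX.smooth hN.smooth X₀ ht₀ (hY.isSmoothFamily hε) hx).sub
      (IsSmoothFamily.volumeIntegrand hX.smooth hN.smooth X₀ ht₀
        (isSmoothFamily_const hX.smooth) hx)
  have hIoo : ∀ᶠ s in 𝓝 (0 : ℝ), s ∈ Ioo (-ε) ε := isOpen_Ioo.mem_nhds ⟨neg_lt_zero.2 hε, hε⟩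
  obtain ⟨K, hK, hKY⟩ := hY.compact_support
  have hDK : ∀ᶠ s in 𝓝 0, ∀ p ∉ K, D s p = 0 := by
    filter_upwards [hIoo] with s hs p hp
    simp [hD, volumeIntegrand, hKY s hs p hp]
  have hDd : ∀ p, deriv (fun r => D r p) 0 = f p * areaIntegrand X X₀ t₀ p := fun p => by
    have h1 : HasDerivAt (fun r => ⟪Y r p - X p, N p⟫ * areaIntegrand X X₀ t₀ p)
        (f p * areaIntegrand X X₀ t₀ p) 0 := by
      refine ((((hf p).sub_const (X p)).inner ℝ (hasDerivAt_const 0 (N p))).mul_const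
        (areaIntegrand X X₀ t₀ p)).congr_deriv ?_
      simp [real_inner_smul_left, hN.unit]
    refine HasDerivAt.deriv (h1.congr_of_eventuallyEq (Filter.Eventually.of_forall fun s => ?_))
    simp only [hD, volumeIntegrand, areaIntegrand, inner_sub_left]
    ring
  have := isLocallyFiniteMeasure_area hX.smooth
  obtain ⟨h1, h2, h3⟩ := hDs.hasDerivAt_integral (μ := area X) hK hDK
  simp only [hDd] at h2 h3
  refine ⟨?_, h2, (hb.add h3).congr_of_eventuallyEq ?_⟩
  · filter_upwards [h1, hB] with s hs1 hs2
    refine (hs1.add hs2).congr (Filter.Eventually.of_forall fun p => ?_)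
    simp [hD]
  · filter_upwards [h1, hB] with s hs1 hs2
    rw [Pi.add_apply, ← integral_add hs2 hs1]
    refine integral_congr_ae (Filter.Eventually.of_forall fun p => ?_)
    simp [hD]

end FirstVariation

/-! ### The derivative of the functional, and necessity of the equation. -/

section EulerLagrange

open MeasureTheory Set

theorem hasDerivAt_rpow_weight {t : ℝ → ℝ} {t' : ℝ} (ht : HasDerivAt t t' 0) (ht0 : 0 < t 0)
    (r : ℝ) : HasDerivAt (fun s => (4 * Real.pi * t s) ^ r)
      ((4 * Real.pi * t 0) ^ r * (r * t' / t 0)) 0 := by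
  have hpos : 0 < 4 * Real.pi * t 0 := by positivity
  refine ((ht.const_mul (4 * Real.pi)).rpow_const (p := r) (Or.inl hpos.ne')).congr_deriv ?_
  rw [Real.rpow_sub_one hpos.ne']
  field_simp

theorem hasDerivAt_rpow_ratio {t : ℝ → ℝ} {t' : ℝ} (ht : HasDerivAt t t' 0) (ht0 : 0 < t 0) :
    HasDerivAt (fun s => (t 0 / t s) ^ (1 / 2 : ℝ)) (-(t' / (2 * t 0))) 0 := by
  have h1 : HasDerivAt (fun s => t 0 / t s) (-(t' / t 0)) 0 := by
    refine ((hasDerivAt_const (0 : ℝ) (t 0)).div ht ht0.ne').congr_deriv ?_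
    field_simp
    ring
  refine (h1.rpow_const (p := 1 / 2) (Or.inl (by simp [ht0.ne']))).congr_deriv ?_
  simp [div_self ht0.ne']
  ring

theorem continuous_areaIntegrand {n : ℕ} {M : Type*} [TopologicalSpace M] {X : M → Euc (n + 1)}
    (hX : Continuous X) (X₀ : Euc (n + 1)) (t₀ : ℝ) :
    Continuous (areaIntegrand X X₀ t₀) := by
  unfold areaIntegrand; fun_prop

variable {n : ℕ} {M : Type*} [TopologicalSpace M] [ChartedSpace (Euc n) M] {X N : M → Euc (n + 1)}

/-- The normal variation `X + s f N`. -/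
theorem isNormalVariation_add_smul (hX : ContMDiff (𝓡 n) 𝓘(ℝ, Euc (n + 1)) ∞ X)
    (hN : ContMDiff (𝓡 n) 𝓘(ℝ, Euc (n + 1)) ∞ N) {f : M → ℝ}
    (hf : ContMDiff (𝓡 n) 𝓘(ℝ, ℝ) ∞ f) (hfc : HasCompactSupport f) (ε : ℝ) :
    IsNormalVariation X N ε fun s p => X p + s • f p • N p where
  smooth := ((hX.comp contMDiff_snd).add (contMDiff_fst.smul
    ((hf.comp contMDiff_snd).smul (hN.comp contMDiff_snd)))).contMDiffOn
  initial p := by simp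
  compact_support := ⟨tsupport f, hfc, fun s _ p hp => by simp [image_eq_zero_of_notMem_tsupport hp]⟩
  normal := ⟨f, fun p => by
    simpa using ((hasDerivAt_id (0 : ℝ)).smul_const (f p • N p)).const_add (X p)⟩

variable [IsManifold (𝓡 n) ∞ M] [SecondCountableTopology M] [MeasurableSpace M] [BorelSpace M]
  [T2Space M]

/-- The derivative of the functional along a variation, in terms of the derivatives `a` and `b` of
its two integrals along the variations of the centre and the scale alone. -/
theorem IsNormalVariation.hasDerivAt_functionalF {ε : ℝ} {Y : ℝ → M → Euc (n + 1)}
    {x : ℝ → Euc (n + 1)} {t : ℝ → ℝ} {f : M → ℝ} (lam : ℝ) (hX : IsSmoothImmersion X)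
    (hN : IsUnitNormal X N) (hY : IsNormalVariation X N ε Y) (hε : 0 < ε)
    (hf : ∀ p, HasDerivAt (fun s => Y s p) (f p • N p) 0)
    (hx : ContDiffAt ℝ ∞ x 0) (ht : ContDiffAt ℝ ∞ t 0) (ht0 : 0 < t 0) {a b : ℝ}
    (hA : ∀ᶠ s in 𝓝 0, Integrable (areaIntegrand X (x s) (t s)) (area X))
    (ha : HasDerivAt (fun s => ∫ p, areaIntegrand X (x s) (t s) p ∂(area X)) a 0)
    (hB : ∀ᶠ s in 𝓝 0, Integrable (volumeIntegrand X N (x 0) (t 0) X (x s)) (area X))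
    (hb : HasDerivAt (fun s => ∫ p, volumeIntegrand X N (x 0) (t 0) X (x s) p ∂(area X)) b 0) :
    (∀ᶠ s in 𝓝 0, FunctionalFDefined X N (x 0) (t 0) (Y s) (x s) (t s)) ∧
    Integrable (fun p => f p * ((lam - (meanCurvature X N p + ⟪(1 / t 0) • (X p - x 0), N p⟫)) *
      areaIntegrand X (x 0) (t 0) p)) (area X) ∧
    HasDerivAt (fun s => functionalF lam X N (x 0) (t 0) (Y s) (x s) (t s))
      ((4 * Real.pi * t 0) ^ (-(n : ℝ) / 2) *
        ((a - n * (deriv t 0 / (2 * t 0)) * ∫ p, areaIntegrand X (x 0) (t 0) p ∂(area X)) +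
        lam * (b - deriv t 0 / (2 * t 0) *
          ∫ p, volumeIntegrand X N (x 0) (t 0) X (x 0) p ∂(area X)) +
        ∫ p, f p * ((lam - (meanCurvature X N p + ⟪(1 / t 0) • (X p - x 0), N p⟫)) *
          areaIntegrand X (x 0) (t 0) p) ∂(area X))) 0 := by
  obtain ⟨hA1, hA2, hA3⟩ := hY.hasDerivAt_integral_areaIntegrand hX hN hε hf hx ht ht0.ne' hA ha
  obtain ⟨hB1, hB2, hB3⟩ := hY.hasDerivAt_integral_volumeIntegrand hX hN hε hf hx (x 0) ht0.ne'
    hB hb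
  have hY0 : Y 0 = X := funext hY.initial
  have ht' := (ht.differentiableAt (by simp)).hasDerivAt
  have heq : ∀ p, f p * ((lam - (meanCurvature X N p + ⟪(1 / t 0) • (X p - x 0), N p⟫)) *
      areaIntegrand X (x 0) (t 0) p) =
      -(f p * (meanCurvature X N p + ⟪(1 / t 0) • (X p - x 0), N p⟫) *
        areaIntegrand X (x 0) (t 0) p) + lam * (f p * areaIntegrand X (x 0) (t 0) p) :=
    fun p => by ring
  refine ⟨hA1.and hB1, ?_, ?_⟩
  · simp only [heq]
    exact hA2.add (hB2.const_mul lam)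
  · have h1 := ((hasDerivAt_rpow_weight ht' ht0 (-(n : ℝ) / 2)).mul hA3).add
      (((hasDerivAt_rpow_ratio ht' ht0).const_mul
        (lam * (4 * Real.pi * t 0) ^ (-(n : ℝ) / 2))).mul hB3)
    refine h1.congr_deriv ?_
    simp only [heq]
    rw [integral_add hA2 (hB2.const_mul lam), integral_const_mul, hY0, div_self ht0.ne',
      Real.one_rpow]
    ring

theorem IsCriticalPoint.equation {lam : ℝ} {X₀ : Euc (n + 1)} {t₀ : ℝ} (hX : IsSmoothImmersion X)
    (hN : IsUnitNormal X N) (ht₀ : 0 < t₀) (h : IsCriticalPoint lam X N X₀ t₀) (p : M) :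
    meanCurvature X N p + ⟪(1 / t₀) • (X p - X₀), N p⟫ = lam := by
  set φ : M → ℝ := fun p => (lam - (meanCurvature X N p + ⟪(1 / t₀) • (X p - X₀), N p⟫)) *
    areaIntegrand X X₀ t₀ p with hφ
  have hXc := hX.smooth.continuous
  have hφc : Continuous φ := (continuous_const.sub ((hN.continuous_meanCurvature hX).add
    (((hXc.sub continuous_const).const_smul (1 / t₀)).inner hN.smooth.continuous))).mul
    (continuous_areaIntegrand hXc X₀ t₀)
  have := isLocallyFiniteMeasure_area hX.smooth
  have := hX.isOpenPosMeasure_area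
  have : LocallyCompactSpace M := ChartedSpace.locallyCompactSpace (Euc n) M
  have h0 : φ =ᵐ[area X] 0 := by
    refine ae_eq_zero_of_integral_contMDiff_smul_eq_zero (𝓡 n) hφc.locallyIntegrable
      fun f hf hfc => ?_
    have hY := isNormalVariation_add_smul hX.smooth hN.smooth hf hfc 1
    obtain ⟨h1, h2⟩ := h 1 _ (fun _ => X₀) (fun _ => t₀) one_pos hY contDiffOn_const rfl
      contDiffOn_const rfl fun _ _ => ht₀
    -- Criticality includes convergence of both integrals at s = 0. With centre and scale fixed this
    -- is all the integrability needed, and a = b = 0.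
    obtain ⟨hA, hB⟩ := h1.self_of_nhds
    have hY0 : (fun p => X p + (0 : ℝ) • f p • N p) = X := funext fun p => by simp
    rw [hY0] at hA hB
    obtain ⟨-, -, h3⟩ := hY.hasDerivAt_functionalF (x := fun _ => X₀) (t := fun _ => t₀) (f := f)
      lam hX hN one_pos (fun p => by
        simpa using ((hasDerivAt_id (0 : ℝ)).smul_const (f p • N p)).const_add (X p))
      contDiffAt_const contDiffAt_const ht₀ (Filter.Eventually.of_forall fun _ => hA)
      (hasDerivAt_const _ _) (Filter.Eventually.of_forall fun _ => hB) (hasDerivAt_const _ _)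
    have h4 := h3.unique h2
    have hpos : 0 < (4 * Real.pi * t₀) ^ (-(n : ℝ) / 2) := by positivity
    simpa [hpos.ne', hφ] using h4
  have h1 : φ = 0 := (Continuous.ae_eq_iff_eq (area X) hφc continuous_const).1 h0
  have h2 : φ p = 0 := congrFun h1 p
  rcases mul_eq_zero.1 h2 with h3 | h3
  · linarith
  · exact absurd h3 (Real.exp_pos _).ne'

end EulerLagrange

/-! ### Differentiating Gaussian integrals in centre and scale. -/

section GaussianBounds

open MeasureTheory Set

/-- From |y|² ≤ 2|y - x|² + 2R² and t ≤ 2t₀. The bound is uniform in nearby centres and scales, as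
dominated convergence requires. -/
theorem exp_neg_norm_sub_sq_le {E : Type*} [NormedAddCommGroup E] {y x : E} {R t t₀ : ℝ}
    (hx : ‖x‖ ≤ R) (ht : 0 < t) (htt : t ≤ 2 * t₀) :
    Real.exp (-‖y - x‖ ^ 2 / (2 * t)) ≤
      Real.exp (R ^ 2 / (4 * t₀)) * Real.exp (-(1 / (8 * t₀)) * ‖y‖ ^ 2) := by
  rw [← Real.exp_add, Real.exp_le_exp]
  have ht₀ : 0 < t₀ := by linarith
  have h1 : ‖y‖ ≤ ‖y - x‖ + R := by
    have := norm_add_le (y - x) x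
    rw [sub_add_cancel] at this
    linarith
  have hR : 0 ≤ R := (norm_nonneg x).trans hx
  have h2 : ‖y‖ ^ 2 ≤ 2 * ‖y - x‖ ^ 2 + 2 * R ^ 2 := by
    nlinarith [norm_nonneg y, norm_nonneg (y - x), sq_nonneg (‖y - x‖ - R)]
  have h3 : ‖y - x‖ ^ 2 / (2 * (2 * t₀)) ≤ ‖y - x‖ ^ 2 / (2 * t) := by gcongr
  have h4 : R ^ 2 / (4 * t₀) + -(1 / (8 * t₀)) * ‖y‖ ^ 2 + ‖y - x‖ ^ 2 / (2 * (2 * t₀)) =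
      (2 * ‖y - x‖ ^ 2 + 2 * R ^ 2 - ‖y‖ ^ 2) / (8 * t₀) := by
    field_simp
    ring
  have h5 : 0 ≤ (2 * ‖y - x‖ ^ 2 + 2 * R ^ 2 - ‖y‖ ^ 2) / (8 * t₀) := by
    apply div_nonneg <;> linarith
  rw [neg_div]
  linarith

variable {n : ℕ} {M : Type*} [TopologicalSpace M] [ChartedSpace (Euc n) M] [MeasurableSpace M]
  [BorelSpace M] {X : M → Euc (n + 1)}

theorem HasPolynomialAreaGrowth.integrable_of_le (hg : HasPolynomialAreaGrowth X)
    (hX : Continuous X) {φ : M → ℝ} (hφ : Continuous φ) {C a : ℝ} {k : ℕ} (ha : 0 < a)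
    (h : ∀ p, |φ p| ≤ C * ((1 + ‖X p‖) ^ k * Real.exp (-a * ‖X p‖ ^ 2))) :
    Integrable φ (area X) :=
  ((hg.integrable_pow_mul_exp hX k ha).const_mul C).mono' hφ.aestronglyMeasurable
    (Filter.Eventually.of_forall h)

/-- Functions of at most quadratic growth are integrable against the Gaussian weight. -/
theorem HasPolynomialAreaGrowth.integrable_mul_areaIntegrand (hg : HasPolynomialAreaGrowth X)
    (hX : Continuous X) (x : Euc (n + 1)) {t : ℝ} (ht : 0 < t) {φ : M → ℝ} (hφ : Continuous φ)
    {C : ℝ} (h : ∀ p, |φ p| ≤ C * (1 + ‖X p‖) ^ 2) :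
    Integrable (fun p => φ p * areaIntegrand X x t p) (area X) := by
  refine hg.integrable_of_le hX (hφ.mul (continuous_areaIntegrand hX x t))
    (C := C * Real.exp (‖x‖ ^ 2 / (4 * t))) (a := 1 / (8 * t)) (k := 2) (by positivity) fun p => ?_
  have h1 := exp_neg_norm_sub_sq_le (y := X p) le_rfl ht (by linarith : t ≤ 2 * t) (x := x)
  have h2 : 0 < areaIntegrand X x t p := Real.exp_pos _
  rw [abs_mul, abs_of_pos h2]
  calc |φ p| * areaIntegrand X x t p
      ≤ C * (1 + ‖X p‖) ^ 2 * (Real.exp (‖x‖ ^ 2 / (4 * t)) *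
        Real.exp (-(1 / (8 * t)) * ‖X p‖ ^ 2)) :=
        mul_le_mul (h p) h1 h2.le ((abs_nonneg _).trans (h p))
    _ = _ := by ring

theorem HasPolynomialAreaGrowth.integrable_areaIntegrand (hg : HasPolynomialAreaGrowth X)
    (hX : Continuous X) (x : Euc (n + 1)) {t : ℝ} (ht : 0 < t) :
    Integrable (areaIntegrand X x t) (area X) := by
  have := hg.integrable_mul_areaIntegrand hX x ht (φ := fun _ => 1) continuous_const (C := 1)
    fun p => by
      rw [abs_one, one_mul]
      exact one_le_pow₀ (by linarith [norm_nonneg (X p)])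
  simpa using this

/-- Differentiation of the Gaussian area in the centre and the scale. -/
theorem HasPolynomialAreaGrowth.hasDerivAt_integral_areaIntegrand (hg : HasPolynomialAreaGrowth X)
    (hX : Continuous X) {x : ℝ → Euc (n + 1)} {t : ℝ → ℝ} (hx : ContDiffAt ℝ ∞ x 0)
    (ht : ContDiffAt ℝ ∞ t 0) (ht0 : 0 < t 0) :
    HasDerivAt (fun s => ∫ p, areaIntegrand X (x s) (t s) p ∂(area X))
      (∫ p, (⟪X p - x 0, deriv x 0⟫ / t 0 + ‖X p - x 0‖ ^ 2 * deriv t 0 / (2 * t 0 ^ 2)) *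
        areaIntegrand X (x 0) (t 0) p ∂(area X)) 0 := by
  set R := ‖x 0‖ + 1 with hR
  set R' := ‖deriv x 0‖ + 1 with hR'
  set T' := |deriv t 0| + 1 with hT'
  have hRpos : 0 < R := by positivity
  have hdc : ∀ {F : Type} [NormedAddCommGroup F] [NormedSpace ℝ F] {y : ℝ → F},
      ContDiffAt ℝ ∞ y 0 → ContinuousAt (deriv y) 0 := fun {F} _ _ {y} hy =>
    ((hy.fderiv_right (m := 0) (by norm_cast)).continuousAt.clm_apply
      (continuousAt_const (y := (1 : ℝ)))).congr (Filter.Eventually.of_forall fun s =>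
        fderiv_apply_one_eq_deriv)
  have hdd : ∀ {F : Type} [NormedAddCommGroup F] [NormedSpace ℝ F] {y : ℝ → F},
      ContDiffAt ℝ ∞ y 0 → ∀ᶠ s in 𝓝 0, HasDerivAt y (deriv y s) s := fun {F} _ _ {y} hy =>
    ((hy.of_le (m := 1) (by norm_cast)).eventually (by simp)).mono
      fun z hz => (hz.differentiableAt one_ne_zero).hasDerivAt
  have hev : ∀ᶠ s in 𝓝 (0 : ℝ), ((‖x s‖ < R ∧ ‖deriv x s‖ < R') ∧ (t 0 / 2 < t s ∧ t s < 2 * t 0)) ∧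
      |deriv t s| < T' ∧ HasDerivAt x (deriv x s) s ∧ HasDerivAt t (deriv t s) s := by
    have e1 := hx.continuousAt.norm.eventually_lt continuousAt_const (lt_add_one ‖x 0‖)
    have e2 := (hdc hx).norm.eventually_lt continuousAt_const (lt_add_one ‖deriv x 0‖)
    have e3 := continuousAt_const.eventually_lt ht.continuousAt (half_lt_self ht0)
    have e4 := ht.continuousAt.eventually_lt continuousAt_const (by linarith : t 0 < 2 * t 0)
    have e5 := (hdc ht).abs.eventually_lt continuousAt_const (lt_add_one |deriv t 0|)
    filter_upwards [e1, e2, e3, e4, e5, hdd hx, hdd ht] with s h1 h2 h3 h4 h5 h6 h7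
    exact ⟨⟨⟨h1, h2⟩, h3, h4⟩, h5, h6, h7⟩
  obtain ⟨δ, hδ, hball⟩ := Metric.eventually_nhds_iff_ball.1 hev
  -- For |s| < δ one has ‖x s‖ < R, ‖x' s‖ < R', |t' s| < T' and t 0/2 < t s < 2 t 0. With ‖X - x s‖
  -- ≤ (1 + R)(1 + ‖X‖), these bound the polynomial factor of the derivative by a multiple of (1 +
  -- ‖X‖)².
  set C := Real.exp (R ^ 2 / (4 * t 0)) *
    ((1 + R) * R' / (t 0 / 2) + (1 + R) ^ 2 * T' / (2 * (t 0 / 2) ^ 2)) with hC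
  have hmain := hasDerivAt_integral_of_dominated_loc_of_deriv_le (𝕜 := ℝ) (μ := area X)
    (F := fun s p => areaIntegrand X (x s) (t s) p)
    (F' := fun s p => areaIntegrand X (x s) (t s) p *
      (-(⟪X p - x s, -deriv x s⟫ / t s) + ‖X p - x s‖ ^ 2 * deriv t s / (2 * t s ^ 2)))
    (x₀ := 0) (bound := fun p => C * ((1 + ‖X p‖) ^ 2 * Real.exp (-(1 / (8 * t 0)) * ‖X p‖ ^ 2)))
    (Metric.ball_mem_nhds (0 : ℝ) hδ)
    (Filter.Eventually.of_forall fun s => (continuous_areaIntegrand hX _ _).aestronglyMeasurable)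
    (hg.integrable_areaIntegrand hX _ ht0)
    (by
      refine Continuous.aestronglyMeasurable ?_
      have := continuous_areaIntegrand hX (x 0) (t 0)
      fun_prop)
    (Filter.Eventually.of_forall fun p s hs => ?_)
    ((hg.integrable_pow_mul_exp hX 2 (by positivity)).const_mul C)
    (Filter.Eventually.of_forall fun p s hs => ?_)
  · refine hmain.2.congr_deriv (integral_congr_ae (Filter.Eventually.of_forall fun p => ?_))
    simp only [inner_neg_right]
    ring
  · obtain ⟨⟨⟨h1, h2⟩, h3, h4⟩, h5, -, -⟩ := hball s hs
    have hts : 0 < t s := by linarith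
    have hE := exp_neg_norm_sub_sq_le (y := X p) h1.le hts h4.le
    have hn : ‖X p - x s‖ ≤ (1 + R) * (1 + ‖X p‖) := by
      have := norm_sub_le (X p) (x s)
      nlinarith [norm_nonneg (X p)]
    have hp1 : 1 ≤ 1 + ‖X p‖ := by linarith [norm_nonneg (X p)]
    have hi : |⟪X p - x s, -deriv x s⟫ / t s| ≤
        (1 + R) * R' / (t 0 / 2) * (1 + ‖X p‖) ^ 2 := by
      have := abs_real_inner_le_norm (X p - x s) (-deriv x s)
      rw [norm_neg] at this
      rw [abs_div, abs_of_pos hts]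
      calc |⟪X p - x s, -deriv x s⟫| / t s ≤ ((1 + R) * (1 + ‖X p‖) * R') / (t 0 / 2) := by
            gcongr
            exact this.trans (by gcongr)
        _ = (1 + R) * R' / (t 0 / 2) * (1 + ‖X p‖) := by ring
        _ ≤ _ := by
            gcongr
            exact le_self_pow₀ hp1 two_ne_zero
    have hq : |‖X p - x s‖ ^ 2 * deriv t s / (2 * t s ^ 2)| ≤
        (1 + R) ^ 2 * T' / (2 * (t 0 / 2) ^ 2) * (1 + ‖X p‖) ^ 2 := by
      rw [abs_div, abs_mul, abs_of_nonneg (sq_nonneg _), abs_of_pos (by positivity : 0 < 2 * t s ^ 2)]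
      calc ‖X p - x s‖ ^ 2 * |deriv t s| / (2 * t s ^ 2)
          ≤ ((1 + R) * (1 + ‖X p‖)) ^ 2 * T' / (2 * (t 0 / 2) ^ 2) := by gcongr
        _ = _ := by ring
    have hpos : 0 < areaIntegrand X (x s) (t s) p := Real.exp_pos _
    rw [Real.norm_eq_abs, abs_mul, abs_of_pos hpos]
    calc _ ≤ Real.exp (R ^ 2 / (4 * t 0)) * Real.exp (-(1 / (8 * t 0)) * ‖X p‖ ^ 2) *
          ((1 + R) * R' / (t 0 / 2) * (1 + ‖X p‖) ^ 2 +
            (1 + R) ^ 2 * T' / (2 * (t 0 / 2) ^ 2) * (1 + ‖X p‖) ^ 2) := by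
          refine mul_le_mul hE ((abs_add_le _ _).trans (add_le_add ?_ hq)) (abs_nonneg _)
            (by positivity)
          rwa [abs_neg]
      _ = _ := by rw [hC]; ring
  · obtain ⟨⟨⟨h1, h2⟩, h3, h4⟩, h5, h6, h7⟩ := hball s hs
    have := hasDerivAt_exp_neg_norm_sq ((hasDerivAt_const s (X p)).sub h6) h7
      (by linarith : 0 < t s).ne'
    refine this.congr_deriv ?_
    simp [areaIntegrand]

/-- The integral is affine in the centre, a constant minus ⟨x s, ∫ E N⟩, so no domination argument
is needed. -/
theorem HasPolynomialAreaGrowth.hasDerivAt_integral_volumeIntegrand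
    (hg : HasPolynomialAreaGrowth X) (hX : Continuous X) {N : M → Euc (n + 1)} (hN : Continuous N)
    (hN1 : ∀ p, ‖N p‖ = 1) (X₀ : Euc (n + 1)) {t₀ : ℝ} (ht₀ : 0 < t₀) {x : ℝ → Euc (n + 1)}
    {x' : Euc (n + 1)} (hx : HasDerivAt x x' 0) :
    (∀ c : Euc (n + 1), Integrable (volumeIntegrand X N X₀ t₀ X c) (area X)) ∧
    HasDerivAt (fun s => ∫ p, volumeIntegrand X N X₀ t₀ X (x s) p ∂(area X))
      (-∫ p, ⟪x', N p⟫ * areaIntegrand X X₀ t₀ p ∂(area X)) 0 := by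
  have hNi : Integrable (fun p => areaIntegrand X X₀ t₀ p • N p) (area X) := by
    refine (hg.integrable_areaIntegrand hX X₀ ht₀).mono
      ((continuous_areaIntegrand hX X₀ t₀).smul hN).aestronglyMeasurable
      (Filter.Eventually.of_forall fun p => ?_)
    simp [norm_smul, hN1]
  have hci : ∀ c : Euc (n + 1), Integrable (fun p => ⟪c, N p⟫ * areaIntegrand X X₀ t₀ p)
      (area X) := fun c => by
    refine (hNi.const_inner c).congr (Filter.Eventually.of_forall fun p => ?_)
    simp [real_inner_smul_right, mul_comm]
  have hce : ∀ c : Euc (n + 1), ∫ p, ⟪c, N p⟫ * areaIntegrand X X₀ t₀ p ∂(area X) =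
      ⟪c, ∫ p, areaIntegrand X X₀ t₀ p • N p ∂(area X)⟫ := fun c => by
    rw [← integral_inner hNi c]
    refine integral_congr_ae (Filter.Eventually.of_forall fun p => ?_)
    simp [real_inner_smul_right, mul_comm]
  have hXi : Integrable (fun p => ⟪X p, N p⟫ * areaIntegrand X X₀ t₀ p) (area X) := by
    refine hg.integrable_mul_areaIntegrand hX X₀ ht₀ (hX.inner hN) (C := 1) fun p => ?_
    have := abs_real_inner_le_norm (X p) (N p)
    rw [hN1, mul_one] at this
    nlinarith [norm_nonneg (X p)]
  have hv : ∀ c, volumeIntegrand X N X₀ t₀ X c = fun p =>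
      ⟪X p, N p⟫ * areaIntegrand X X₀ t₀ p - ⟪c, N p⟫ * areaIntegrand X X₀ t₀ p := fun c => by
    funext p
    rw [volumeIntegrand, areaIntegrand, inner_sub_left]
    ring
  refine ⟨fun c => by rw [hv]; exact hXi.sub (hci c), ?_⟩
  simp only [hv]
  have h1 : ∀ s, ∫ p, (⟪X p, N p⟫ * areaIntegrand X X₀ t₀ p -
      ⟪x s, N p⟫ * areaIntegrand X X₀ t₀ p) ∂(area X) =
      ∫ p, ⟪X p, N p⟫ * areaIntegrand X X₀ t₀ p ∂(area X) -
        ⟪x s, ∫ p, areaIntegrand X X₀ t₀ p • N p ∂(area X)⟫ := fun s => by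
    rw [integral_sub hXi (hci _), hce]
  simp only [h1]
  refine ((hx.inner ℝ (hasDerivAt_const (0 : ℝ) _)).const_sub _).congr_deriv ?_
  rw [hce]
  simp

end GaussianBounds

/-! ### Sufficiency of the equation. -/

section Converse

open MeasureTheory Set

theorem hasFDerivAt_exp_smul_affine {E : Type*} [NormedAddCommGroup E] [InnerProductSpace ℝ E]
    (x₀ a : E) (b t₀ : ℝ) (y : E) :
    HasFDerivAt (fun z : E => Real.exp (-‖z - x₀‖ ^ 2 / (2 * t₀)) • (a + b • (z - x₀)))
      (Real.exp (-‖y - x₀‖ ^ 2 / (2 * t₀)) • (b • ContinuousLinearMap.id ℝ E -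
        ((1 / t₀) • innerSL ℝ (y - x₀)).smulRight (a + b • (y - x₀)))) y := by
  have h0 : HasFDerivAt (fun z : E => z - x₀) (ContinuousLinearMap.id ℝ E) y :=
    (hasFDerivAt_id y).sub_const x₀
  have h1 := ((h0.norm_sq.neg.mul_const (1 / (2 * t₀))).exp).smul ((h0.const_smul b).const_add a)
  simp only [mul_one_div] at h1
  refine h1.congr_fderiv ?_
  ext1 v
  simp [smul_sub, smul_smul]
  module

variable {n : ℕ} {M : Type*} [TopologicalSpace M] [ChartedSpace (Euc n) M] {X N : M → Euc (n + 1)}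

theorem diff_comp {g : Euc (n + 1) → Euc (n + 1)} {g' : Euc (n + 1) →L[ℝ] Euc (n + 1)} {p : M}
    (hg : HasFDerivAt g g' (X p)) (hX : MDifferentiableAt (𝓡 n) 𝓘(ℝ, Euc (n + 1)) X p) :
    diff (fun q => g (X q)) p = g'.comp (diff X p) :=
  (hg.hasMFDerivAt.comp p hX.hasMFDerivAt).mfderiv

/-- With W = a + bZ, the tangential trace of dW is nb, and the tangential gradient of E is -E Zᵀ/t₀.
Writing ⟨Zᵀ, W⟩ = ⟨Z, W⟩ - ⟨Z, N⟩⟨W, N⟩, the normal term joins H⟨W, N⟩, so that the left side of the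
equation appears as a factor. -/
theorem divAlong_exp_smul_affine (hX : IsSmoothImmersion X) (hN : IsUnitNormal X N)
    (X₀ a : Euc (n + 1)) (b t₀ : ℝ) (p : M) :
    divAlong X N (fun q => areaIntegrand X X₀ t₀ q • (a + b • (X q - X₀))) p =
      (n * b - ⟪X p - X₀, a + b • (X p - X₀)⟫ / t₀ +
        (meanCurvature X N p + ⟪(1 / t₀) • (X p - X₀), N p⟫) * ⟪a + b • (X p - X₀), N p⟫) *
          areaIntegrand X X₀ t₀ p := by
  have hfr := hN.isFrame hX p
  have hd := diff_comp (hasFDerivAt_exp_smul_affine X₀ a b t₀ (X p))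
    (hX.smooth.mdifferentiable (by simp) p)
  set W := a + b • (X p - X₀) with hW
  set L := leftInv (diff X p) (N p) with hL
  have hcomp : L.comp (diff (fun q => areaIntegrand X X₀ t₀ q • (a + b • (X q - X₀))) p) =
      areaIntegrand X X₀ t₀ p • (b • ContinuousLinearMap.id ℝ (Euc n) +
        (-1 : ℝ) • (((1 / t₀) • innerSL ℝ (X p - X₀)).comp (diff X p)).smulRight (L W)) := by
    refine (congrArg L.comp hd).trans ?_
    ext1 v
    simp [areaIntegrand, hL, hfr.leftInv_apply, sub_eq_add_neg]
  have hLW : diff X p (L W) = W - ⟪W, N p⟫ • N p := eq_sub_of_add_eq (hfr.decomp W).symm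
  rw [divAlong, hcomp, endTrace_smul, endTrace_add, endTrace_smul, endTrace_smul, endTrace_id,
    endTrace_smulRight]
  simp only [ContinuousLinearMap.comp_apply, smul_apply, innerSL_apply_apply, hLW,
    inner_sub_right, real_inner_smul_left, real_inner_smul_right, smul_eq_mul]
  ring

variable [IsManifold (𝓡 n) ∞ M] [SecondCountableTopology M] [MeasurableSpace M] [BorelSpace M]
  [T2Space M]

theorem isCriticalPoint_of_equation {lam : ℝ} {X₀ : Euc (n + 1)} {t₀ : ℝ}
    (hX : IsSmoothImmersion X) (hN : IsUnitNormal X N) (ht₀ : 0 < t₀)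
    (hcomp : IsCompleteHypersurface X) (hg : HasPolynomialAreaGrowth X)
    (heq : ∀ p, meanCurvature X N p + ⟪(1 / t₀) • (X p - X₀), N p⟫ = lam) :
    IsCriticalPoint lam X N X₀ t₀ := by
  intro ε Y x t hε hY hx hx0 ht ht0 _
  have hnhds : Ioo (-ε) ε ∈ 𝓝 (0 : ℝ) := isOpen_Ioo.mem_nhds ⟨neg_lt_zero.2 hε, hε⟩
  replace hx := hx.contDiffAt hnhds
  replace ht := ht.contDiffAt hnhds
  subst hx0 ht0
  have hXc := hX.smooth.continuous
  have hNc := hN.smooth.continuous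
  obtain ⟨f, hf⟩ := hY.normal
  have hA : ∀ᶠ s in 𝓝 0, Integrable (areaIntegrand X (x s) (t s)) (area X) :=
    (continuousAt_const.eventually_lt ht.continuousAt ht₀).mono fun s hs =>
      hg.integrable_areaIntegrand hXc _ hs
  have ha := hg.hasDerivAt_integral_areaIntegrand hXc hx ht ht₀
  obtain ⟨hB, hb⟩ := hg.hasDerivAt_integral_volumeIntegrand hXc hNc hN.unit (x 0) ht₀
    (hx.differentiableAt (by simp)).hasDerivAt
  obtain ⟨h1, -, h2⟩ := hY.hasDerivAt_functionalF lam hX hN hε hf hx ht ht₀ hA ha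
    (Filter.Eventually.of_forall fun s => hB _) hb
  refine ⟨h1, h2.congr_deriv ?_⟩
  set E := areaIntegrand X (x 0) (t 0) with hE
  set β := deriv t 0 / (2 * t 0) with hβ
  set x' := deriv x 0 with hx'
  set Z : M → Euc (n + 1) := fun p => X p - x 0 with hZ
  have hZc : Continuous Z := hXc.sub continuous_const
  have hZn : ∀ p, ‖Z p‖ ≤ (1 + ‖x 0‖) * (1 + ‖X p‖) := fun p => by
    have := norm_sub_le (X p) (x 0)
    nlinarith [norm_nonneg (X p), norm_nonneg (x 0),
      mul_nonneg (norm_nonneg (X p)) (norm_nonneg (x 0))]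
  have hp1 : ∀ p, 1 + ‖X p‖ ≤ (1 + ‖X p‖) ^ 2 := fun p =>
    le_self_pow₀ (by linarith [norm_nonneg (X p)]) two_ne_zero
  have iE : Integrable E (area X) := hg.integrable_areaIntegrand hXc _ ht₀
  have iN : Integrable (fun p => ⟪x', N p⟫ * E p) (area X) :=
    hg.integrable_mul_areaIntegrand hXc _ ht₀ (continuous_const.inner hNc) (C := ‖x'‖) fun p => by
      have h3 := abs_real_inner_le_norm x' (N p)
      rw [hN.unit, mul_one] at h3
      exact h3.trans (le_mul_of_one_le_right (norm_nonneg _)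
        (one_le_pow₀ (by linarith [norm_nonneg (X p)])))
  have iV : Integrable (fun p => ⟪Z p, N p⟫ * E p) (area X) :=
    hg.integrable_mul_areaIntegrand hXc _ ht₀ (hZc.inner hNc) (C := 1 + ‖x 0‖) fun p => by
      have h3 := abs_real_inner_le_norm (Z p) (N p)
      rw [hN.unit, mul_one] at h3
      exact (h3.trans (hZn p)).trans (by gcongr; exact hp1 p)
  have iA : Integrable (fun p => (⟪Z p, x'⟫ / t 0 + ‖Z p‖ ^ 2 * deriv t 0 / (2 * t 0 ^ 2)) * E p)
      (area X) := by
    refine hg.integrable_mul_areaIntegrand hXc _ ht₀ (by fun_prop)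
      (C := (1 + ‖x 0‖) * ‖x'‖ / t 0 + (1 + ‖x 0‖) ^ 2 * |deriv t 0| / (2 * t 0 ^ 2)) fun p => ?_
    refine (abs_add_le _ _).trans ?_
    rw [add_mul]
    refine add_le_add ?_ ?_
    · rw [abs_div, abs_of_pos ht₀]
      calc |⟪Z p, x'⟫| / t 0 ≤ (1 + ‖x 0‖) * (1 + ‖X p‖) * ‖x'‖ / t 0 := by
            gcongr
            exact (abs_real_inner_le_norm _ _).trans (by gcongr; exact hZn p)
        _ = (1 + ‖x 0‖) * ‖x'‖ / t 0 * (1 + ‖X p‖) := by ring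
        _ ≤ _ := by gcongr; exact hp1 p
    · rw [abs_div, abs_mul, abs_of_nonneg (sq_nonneg _), abs_of_pos (by positivity : 0 < 2 * t 0 ^ 2)]
      calc ‖Z p‖ ^ 2 * |deriv t 0| / (2 * t 0 ^ 2)
          ≤ ((1 + ‖x 0‖) * (1 + ‖X p‖)) ^ 2 * |deriv t 0| / (2 * t 0 ^ 2) := by
            gcongr; exact hZn p
        _ = _ := by ring
  -- The translation x' matches the motion of the centre and the dilation β Z the change of scale.
  -- With the equation inserted, the integral of the divergence is minus the remaining derivative.
  set V : M → Euc (n + 1) := fun q => E q • (x' + β • (X q - x 0)) with hV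
  have hdiv : ∀ p, divAlong X N V p = n * β * E p -
      (⟪Z p, x'⟫ / t 0 + ‖Z p‖ ^ 2 * deriv t 0 / (2 * t 0 ^ 2)) * E p +
        lam * (⟪x', N p⟫ * E p + β * (⟪Z p, N p⟫ * E p)) := fun p => by
    rw [hV, divAlong_exp_smul_affine hX hN (x 0) x' β (t 0) p, heq p, inner_add_right,
      inner_add_left, real_inner_smul_right, real_inner_smul_left, real_inner_self_eq_norm_sq, hβ]
    simp only [hZ]
    field_simp
    ring
  have i1 : Integrable (fun p => n * β * E p -
      (⟪Z p, x'⟫ / t 0 + ‖Z p‖ ^ 2 * deriv t 0 / (2 * t 0 ^ 2)) * E p) (area X) :=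
    (iE.const_mul (n * β)).sub iA
  have i2 : Integrable (fun p => lam * (⟪x', N p⟫ * E p + β * (⟪Z p, N p⟫ * E p))) (area X) :=
    (iN.add (iV.const_mul β)).const_mul lam
  have hVint : Integrable (fun q => ‖V q‖) (area X) := by
    have := hg.integrable_mul_areaIntegrand hXc (x 0) ht₀
      (φ := fun q => ‖x' + β • (X q - x 0)‖) (by fun_prop)
      (C := ‖x'‖ + |β| * (1 + ‖x 0‖)) fun p => by
        rw [abs_norm]
        refine (norm_add_le _ _).trans ?_
        rw [norm_smul, Real.norm_eq_abs, add_mul]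
        refine add_le_add (le_mul_of_one_le_right (norm_nonneg _)
          (one_le_pow₀ (by linarith [norm_nonneg (X p)]))) ?_
        rw [mul_assoc]
        gcongr
        exact (hZn p).trans (by gcongr; exact hp1 p)
    refine this.congr (Filter.Eventually.of_forall fun q => ?_)
    have hpos : 0 < E q := Real.exp_pos _
    simp only [hV, norm_smul, Real.norm_eq_abs, abs_of_pos hpos]
    exact mul_comm _ _
  have hVs : ContMDiff (𝓡 n) 𝓘(ℝ, Euc (n + 1)) ∞ V := by
    have hgs : ContDiff ℝ ∞ fun z : Euc (n + 1) =>
        Real.exp (-‖z - x 0‖ ^ 2 / (2 * t 0)) • (x' + β • (z - x 0)) :=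
      (((contDiff_id.sub contDiff_const).norm_sq ℝ).neg.div_const _).exp.smul
        (contDiff_const.add ((contDiff_id.sub contDiff_const).const_smul β))
    exact hgs.contMDiff.comp hX.smooth
  have hkey := integral_divAlong_eq_zero hX hN hcomp hVs hVint (by
    rw [funext hdiv]; exact i1.add i2)
  simp only [hdiv] at hkey
  rw [integral_add i1 i2, integral_sub (iE.const_mul _) iA, integral_const_mul,
    integral_const_mul, integral_add iN (iV.const_mul β), integral_const_mul] at hkey
  have hzero : ∀ p, f p * ((lam - (meanCurvature X N p + ⟪(1 / t 0) • (X p - x 0), N p⟫)) * E p) =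
      0 := fun p => by rw [heq p]; ring
  have hvol : volumeIntegrand X N (x 0) (t 0) X (x 0) = fun p => ⟪Z p, N p⟫ * E p := rfl
  simp only [hzero, hvol, integral_zero]
  refine mul_eq_zero_of_right _ ?_
  linarith

end Converse

end LambdaHypersurface

theorem mainTheorem6 {n : ℕ} {M : Type*} [TopologicalSpace M] [T2Space M]
    [SecondCountableTopology M] [ChartedSpace (Euc n) M] [IsManifold (𝓡 n) ∞ M]
    [MeasurableSpace M] [BorelSpace M]
    (X N : M → Euc (n + 1)) (hX : IsSmoothImmersion X) (hN : IsUnitNormal X N)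
    (lam : ℝ) (X₀ : Euc (n + 1)) (t₀ : ℝ) (ht₀ : 0 < t₀) :
    (IsCriticalPoint lam X N X₀ t₀ →
      ∀ p, meanCurvature X N p + ⟪(1 / t₀) • (X p - X₀), N p⟫ = lam) ∧
    (IsCompleteHypersurface X → HasPolynomialAreaGrowth X →
      (IsCriticalPoint lam X N X₀ t₀ ↔
        ∀ p, meanCurvature X N p + ⟪(1 / t₀) • (X p - X₀), N p⟫ = lam)) := by
  refine ⟨fun h => h.equation hX hN ht₀, fun hcomp hg => ⟨fun h => h.equation hX hN ht₀, fun heq =>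
    isCriticalPoint_of_equation hX hN ht₀ hcomp hg heq⟩⟩
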